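/- **Setting.** Let $P=p_1p_2\cdots p_n$ and $Q=q_1q_2\cdots q_m$ be polygonal curves in $\mathbb R^d$ with $n,m\ge 2$ vertices, parameterized by arc length as $P(x)$, $0\le x\le \|P\|$, and $Q(y)$, $0\le y\le\|Q\|$. Let $x_i$ (resp. $y_j$) be the length of $P$ up to $p_i$ (resp. of $Q$ up to $q_j$). The free space diagram is the rectangle $[0,\|P\|]\times[0,\|Q\|]$ with elevation function $e(x,y)=\|P(x)-Q(y)\|$; the lines $x=x_i$ and $y=y_j$ partition it into $(n-1)\times(m-1)$ cells $[x_i,x_{i+1}]\times[y_j,y_{j+1}]$. *VE graph.* Each grid edge (boundary edge of a cell) carries one vertex, its portal, located at the unique point of the grid edge where $e$ is minimal, except that the two grid edges at the corner $(0,0)$ carry the common start vertex $s$, located at $(0,0)$, and the two grid edges at the corner $(\|P\|,\|Q\|)$ carry the common target vertex $t$, located there. Portals of different grid edges are otherwise different vertices, even if their locations coincide. In every cell there are directed edges from each of the vertices on its bottom and left edges to each of the vertices on its top and right edges. The height $h(v)$ of a vertex is the elevation of its location. *VE‑Fréchet distance.* $d_{VE}(P,Q)$ is the minimum, over all directed paths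 from $s$ to $t$ in the VE graph, of the maximum height of a vertex of the path. *Retractable paths.* Give the edge $u\to v$ the weight $\max(h(u),h(v))$. The bottleneck of a path is its largest edge weight, and a bottleneck edge of $(a,b)$ is an edge whose weight is the least bottleneck of a path from $a$ to $b$ and which lies on a path from $a$ to $b$ with that bottleneck. A path from $a$ to $b$ is retractable if it is a single vertex, or if it contains a bottleneck edge $u\to v$ of $(a,b)$ such that its subpaths from $a$ to $u$ and from $v$ to $b$ are retractable. A retractable VE path is a retractable path from $s$ to $t$ such that, moreover, every contiguous subpath of it, from $a$ to $b$ say, minimizes among all paths from $a$ to $b$ the maximum height of the vertices strictly between $a$ and $b$. (If the heights are pairwise distinct, there is only one such path.) The retractable VE‑Fréchet morphing realized by the path is the polygonal curve in the free space diagram through the locations of its vertices. *Reachable complexity.* For $r\ge 0$ let $\mathsf N_{\le r}(P,Q)$ be the number of vertices $v$ of the VE graph for which there is a path from $s$ to $v$ all of whose vertices have height at most $r$. *Model.* A real RAM with unit cost operations $+,-,\times,/,\sqrt{\ }$, comparison and memory access on reals, and unit cost integer operations, comparison and memory access on words of $O(\log(n+m))$ bits; the memory that does not hold the input is initially zero.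 **Corollary.** For every fixed dimension $d$ there is a real RAM program that, given polygonal curves $P$ and $Q$ in $\mathbb R^d$ with $n\ge2$ and $m\ge 2$ vertices, computes $d_{VE}(P,Q)$ and the sequence of vertex locations of a retractable VE‑Fréchet morphing between $P$ and $Q$, where the maximum elevation along the morphing equals $d_{VE}(P,Q)$, in time $$O(n+m+\mathsf N\log \mathsf N),\qquad \mathsf N=\mathsf N_{\le r}(P,Q),\quad r=d_{VE}(P,Q),$$ where the constant in the $O$ depends only on $d$. -/

import Mathlib

noncomputable section

namespace VEFrechet

/-! ### Paths, bottlenecks and retractable paths in a directed graph -/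

section Graph

variable {V : Type}

/-- `l` lists the vertices of a directed path from `u` to `v` in the graph with edge relation `G`.
(The graphs used below are acyclic, so every such path is simple.) -/
def IsPath (G : V → V → Prop) (u v : V) (l : List V) : Prop :=
  l.IsChain G ∧ l.head? = some u ∧ l.getLast? = some v

/-- The edges of a path, in order. -/
def pathEdges (l : List V) : List (V × V) := l.zip l.tail

/-- The bottleneck of a path: the largest weight of its edges (`⊥` if it has no edge). -/
def bottleneck (w : V → V → ℝ) (l : List V) : WithBot ℝ :=
  ((pathEdges l).map fun e => w e.1 e.2).maximum

/-- `u → v` is a bottleneck edge of `s` and `t`: its weight is the bottleneck distance from `s` to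
`t`, and it realizes the bottleneck of a path from `s` to `t` that is optimal in this sense.
(If the weights of the edges are pairwise distinct there is at most one such edge.) -/
def IsBottleneckEdge (G : V → V → Prop) (w : V → V → ℝ) (s t u v : V) : Prop :=
  (∃ l, IsPath G s t l ∧ (u, v) ∈ pathEdges l ∧ bottleneck w l = (w u v : WithBot ℝ)) ∧
    ∀ l, IsPath G s t l → (w u v : WithBot ℝ) ≤ bottleneck w l

/-- Retractable paths for edge weights `w`: a path with at least one edge is retractable if it
contains a bottleneck edge `u → v` of its endpoints `s`, `t`, and its subpaths from `s` to `u` and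
from `v` to `t` are both retractable. -/
inductive IsRetractable (G : V → V → Prop) (w : V → V → ℝ) : List V → Prop
  | single (v : V) : IsRetractable G w [v]
  | join {s t u v : V} {p q : List V} (hp : IsPath G s u p) (hq : IsPath G v t q) (huv : G u v)
      (hb : IsBottleneckEdge G w s t u v)
      (rp : IsRetractable G w p) (rq : IsRetractable G w q) : IsRetractable G w (p ++ q)

/-- The inner width of a path: the largest height of a vertex strictly between its endpoints
(`⊥` if there is none). -/
def innerWidth (h : V → ℝ) (l : List V) : WithBot ℝ :=
  (l.tail.dropLast.map h).maximum

/-- Every contiguous subpath of `l` has the least inner width among all paths of the graph with the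
same endpoints. -/
def IsLocallyOptimal (G : V → V → Prop) (h : V → ℝ) (l : List V) : Prop :=
  ∀ l₁, l₁ <:+: l → ∀ u v l', IsPath G u v l₁ → IsPath G u v l' →
    innerWidth h l₁ ≤ innerWidth h l'

end Graph

/-! ### Polygonal curves and their free space diagram -/

/-- A polygonal curve in `ℝ^d`, given by its sequence of at least two vertices. Vertices are
numbered from `0`; edge `i` joins vertex `i` to vertex `i + 1`. -/
structure PolyCurve (d : ℕ) where
  size : ℕ
  two_le_size : 2 ≤ size
  pt : Fin size → EuclideanSpace ℝ (Fin d)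

namespace PolyCurve

variable {d : ℕ}

/-- The `i`-th vertex (`0` if there is no such vertex). -/
def vert (P : PolyCurve d) (i : ℕ) : EuclideanSpace ℝ (Fin d) :=
  if h : i < P.size then P.pt ⟨i, h⟩ else 0

/-- The length of edge `i`. -/
def edgeLen (P : PolyCurve d) (i : ℕ) : ℝ := dist (P.vert i) (P.vert (i + 1))

/-- The unit direction vector of edge `i` (zero if the edge has length zero). -/
def edgeDir (P : PolyCurve d) (i : ℕ) : EuclideanSpace ℝ (Fin d) :=
  (P.edgeLen i)⁻¹ • (P.vert (i + 1) - P.vert i)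

/-- The length of the curve between vertices `0` and `i`. -/
def arc (P : PolyCurve d) (i : ℕ) : ℝ := ∑ k ∈ Finset.range i, P.edgeLen k

/-- The uniform (arc length) parameterization, for `x` between `0` and the length of the curve: the
part of edge `k` that has been traversed when the length `x` has been covered is
`x - P.arc k`, clamped to `[0, P.edgeLen k]`. -/
def param (P : PolyCurve d) (x : ℝ) : EuclideanSpace ℝ (Fin d) :=
  P.vert 0 + ∑ k ∈ Finset.range (P.size - 1),
    (min (max (x - P.arc k) 0) (P.edgeLen k)) • P.edgeDir k

end PolyCurve

section VE

variable {d : ℕ}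

/-- The elevation function of the free space diagram of `P` and `Q`. -/
def elevation (P Q : PolyCurve d) (z : ℝ × ℝ) : ℝ := dist (P.param z.1) (Q.param z.2)

/-! ### The VE graph -/

/-- Vertices of the VE graph: the start vertex, the target vertex, the portals on the horizontal
grid edges `[x_i, x_{i+1}] × {y_j}` and the portals on the vertical grid edges
`{x_i} × [y_j, y_{j+1}]`. The portals of different grid edges are different vertices, also where
their locations coincide. -/
inductive VEVertex where
  | start
  | target
  | hor (i j : ℕ)
  | ver (i j : ℕ)

/-- The vertex on the grid edge `[x_i, x_{i+1}] × {y_j}`; it is the start (target) vertex if the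
edge is incident to the bottom left (top right) corner of the diagram. -/
def horVertex (P Q : PolyCurve d) (i j : ℕ) : VEVertex :=
  if i = 0 ∧ j = 0 then .start
  else if i + 2 = P.size ∧ j + 1 = Q.size then .target
  else .hor i j

/-- The vertex on the grid edge `{x_i} × [y_j, y_{j+1}]`; it is the start (target) vertex if the
edge is incident to the bottom left (top right) corner of the diagram. -/
def verVertex (P Q : PolyCurve d) (i j : ℕ) : VEVertex :=
  if i = 0 ∧ j = 0 then .start
  else if i + 1 = P.size ∧ j + 2 = Q.size then .target
  else .ver i j

/-- The edges of the VE graph: in each cell `(i, j)`, from each of the two incoming vertices (on the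
bottom and the left edge) to each of the two outgoing vertices (on the top and the right edge). -/
def VEAdj (P Q : PolyCurve d) (u v : VEVertex) : Prop :=
  ∃ i j, i + 1 < P.size ∧ j + 1 < Q.size ∧
    (u = horVertex P Q i j ∨ u = verVertex P Q i j) ∧
    (v = horVertex P Q i (j + 1) ∨ v = verVertex P Q (i + 1) j)

/-- The location of a vertex in the free space diagram. A portal lies at the point of its grid edge
where the elevation is minimal; this point is unique, so that the infimum is over one element. -/
def location (P Q : PolyCurve d) : VEVertex → ℝ × ℝ
  | .start => (0, 0)
  | .target => (P.arc (P.size - 1), Q.arc (Q.size - 1))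
  | .hor i j =>
      (sInf {x | x ∈ Set.Icc (P.arc i) (P.arc (i + 1)) ∧
        IsMinOn (fun x' => elevation P Q (x', Q.arc j)) (Set.Icc (P.arc i) (P.arc (i + 1))) x},
       Q.arc j)
  | .ver i j =>
      (P.arc i,
       sInf {y | y ∈ Set.Icc (Q.arc j) (Q.arc (j + 1)) ∧
        IsMinOn (fun y' => elevation P Q (P.arc i, y')) (Set.Icc (Q.arc j) (Q.arc (j + 1))) y})

/-- The height of a vertex is the elevation of its location. -/
def height (P Q : PolyCurve d) (v : VEVertex) : ℝ := elevation P Q (location P Q v)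

/-- The weight of an edge: the larger height of its endpoints. -/
def weight (P Q : PolyCurve d) (u v : VEVertex) : ℝ := max (height P Q u) (height P Q v)

/-- The VE-Fréchet distance: the bottleneck distance from start to target in the VE graph. -/
def veDist (P Q : PolyCurve d) : ℝ :=
  sInf {r | ∃ l, IsPath (VEAdj P Q) .start .target l ∧ ∀ v ∈ l, height P Q v ≤ r}

/-- The `r`-reachable complexity: the number of vertices of the VE graph that can be reached from
the start vertex by a path of maximum elevation at most `r`. -/
def reachableComplexity (P Q : PolyCurve d) (r : ℝ) : ℕ :=
  Set.ncard {v | ∃ l, IsPath (VEAdj P Q) .start v l ∧ ∀ u ∈ l, height P Q u ≤ r}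

/-- The curve in the free space diagram that is realized by a path of the VE graph: the union of the
segments between the locations of consecutive vertices. -/
def morphing (P Q : PolyCurve d) (l : List VEVertex) : Set (ℝ × ℝ) :=
  {z | ∃ e ∈ pathEdges l, z ∈ segment ℝ (location P Q e.1) (location P Q e.2)}

/-- `l` is a path from start to target that realizes a retractable VE-Fréchet morphing: it is
retractable for the edge weights, and, for the heights of the vertices, all of its subpaths have
the least possible inner width. (If the heights are pairwise distinct there is only one such
path.) -/
def IsRetractableVEPath (P Q : PolyCurve d) (l : List VEVertex) : Prop :=
  IsPath (VEAdj P Q) .start .target l ∧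
    IsRetractable (VEAdj P Q) (weight P Q) l ∧
    IsLocallyOptimal (VEAdj P Q) (height P Q) l

end VE

/-! ### Real RAM programs with a step count -/

/-- The state of a real RAM: registers and memory for words (natural numbers), and registers and
memory for real numbers. Each memory is split into arrays `0, 1, 2, …`; a program mentions only
finitely many registers and arrays. -/
structure State where
  ireg : ℕ → ℕ
  rreg : ℕ → ℝ
  iarr : ℕ → ℕ → ℕ
  rarr : ℕ → ℕ → ℝ

/-- Operations on words: addition, truncated subtraction, multiplication, division with rounding
down. -/
inductive IOp where
  | add
  | sub
  | mul
  | div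

def IOp.eval : IOp → ℕ → ℕ → ℕ
  | .add, a, b => a + b
  | .sub, a, b => a - b
  | .mul, a, b => a * b
  | .div, a, b => a / b

/-- Operations on reals (the quotient by zero is zero). -/
inductive ROp where
  | add
  | sub
  | mul
  | div

def ROp.eval : ROp → ℝ → ℝ → ℝ
  | .add, a, b => a + b
  | .sub, a, b => a - b
  | .mul, a, b => a * b
  | .div, a, b => a / b

/-- Instructions. There is no way to round a real number or to turn it into a word, and the only
real constants are natural numbers. -/
inductive Instr where
  /-- `ireg x := c` -/
  | iconst (x c : ℕ)
  /-- `ireg x := ireg y` op `ireg z` -/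
  | iop (o : IOp) (x y z : ℕ)
  /-- `ireg x := iarr a [ireg y]` -/
  | iload (x a y : ℕ)
  /-- `iarr a [ireg y] := ireg x` -/
  | istore (a y x : ℕ)
  /-- `rreg x := c` -/
  | rconst (x c : ℕ)
  /-- `rreg x := rreg y` op `rreg z` -/
  | rop (o : ROp) (x y z : ℕ)
  /-- `rreg x := √(rreg y)` -/
  | rsqrt (x y : ℕ)
  /-- `rreg x := rarr a [ireg y]` -/
  | rload (x a y : ℕ)
  /-- `rarr a [ireg y] := rreg x` -/
  | rstore (a y x : ℕ)

/-- The effect of an instruction. -/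
def Instr.exec (σ : State) : Instr → State
  | .iconst x c => { σ with ireg := Function.update σ.ireg x c }
  | .iop o x y z => { σ with ireg := Function.update σ.ireg x (o.eval (σ.ireg y) (σ.ireg z)) }
  | .iload x a y => { σ with ireg := Function.update σ.ireg x (σ.iarr a (σ.ireg y)) }
  | .istore a y x =>
      { σ with iarr := Function.update σ.iarr a
                (Function.update (σ.iarr a) (σ.ireg y) (σ.ireg x)) }
  | .rconst x c => { σ with rreg := Function.update σ.rreg x (c : ℝ) }
  | .rop o x y z => { σ with rreg := Function.update σ.rreg x (o.eval (σ.rreg y) (σ.rreg z)) }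
  | .rsqrt x y => { σ with rreg := Function.update σ.rreg x (Real.sqrt (σ.rreg y)) }
  | .rload x a y => { σ with rreg := Function.update σ.rreg x (σ.rarr a (σ.ireg y)) }
  | .rstore a y x =>
      { σ with rarr := Function.update σ.rarr a
                (Function.update (σ.rarr a) (σ.ireg y) (σ.rreg x)) }

/-- Tests: comparison of two word registers, or of two real registers. -/
inductive Test where
  | ilt (x y : ℕ)
  | ieq (x y : ℕ)
  | rlt (x y : ℕ)

def Test.holds (σ : State) : Test → Prop
  | .ilt x y => σ.ireg x < σ.ireg y
  | .ieq x y => σ.ireg x = σ.ireg y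
  | .rlt x y => σ.rreg x < σ.rreg y

/-- Programs. -/
inductive Prog where
  | skip
  | instr (i : Instr)
  | seq (a b : Prog)
  | ite (c : Test) (a b : Prog)
  | loop (c : Test) (a : Prog)

/-- All words in registers and memory are at most `W`. -/
def State.WordsLE (W : ℕ) (σ : State) : Prop :=
  (∀ x, σ.ireg x ≤ W) ∧ ∀ a i, σ.iarr a i ≤ W

/-- `Runs W a σ T σ'`: started in state `σ`, on a machine whose words hold the numbers from `0` to
`W`, the program `a` halts in state `σ'` after `T` steps. Every executed instruction and every
executed test is one step; no instruction may produce a number that is too large for a word.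
(`loop c a` means: while `c` holds, do `a`.) -/
inductive Runs (W : ℕ) : Prog → State → ℕ → State → Prop
  | skip (σ : State) : Runs W .skip σ 0 σ
  | instr (i : Instr) (σ : State) (h : (i.exec σ).WordsLE W) :
      Runs W (.instr i) σ 1 (i.exec σ)
  | seq {a b : Prog} {σ σ' σ'' : State} {T T' : ℕ} (ha : Runs W a σ T σ')
      (hb : Runs W b σ' T' σ'') : Runs W (.seq a b) σ (T + T') σ''
  | ite_true {c : Test} {a b : Prog} {σ σ' : State} {T : ℕ} (hc : c.holds σ)
      (ha : Runs W a σ T σ') : Runs W (.ite c a b) σ (T + 1) σ'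
  | ite_false {c : Test} {a b : Prog} {σ σ' : State} {T : ℕ} (hc : ¬ c.holds σ)
      (hb : Runs W b σ T σ') : Runs W (.ite c a b) σ (T + 1) σ'
  | loop_done {c : Test} {a : Prog} {σ : State} (hc : ¬ c.holds σ) :
      Runs W (.loop c a) σ 1 σ
  | loop_step {c : Test} {a : Prog} {σ σ' σ'' : State} {T T' : ℕ} (hc : c.holds σ)
      (ha : Runs W a σ T σ') (hb : Runs W (.loop c a) σ' T' σ'') :
      Runs W (.loop c a) σ (T + T' + 1) σ''

/-- The coordinates of the vertices of a curve in one sequence: coordinate `c` of vertex `i` has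
index `i * d + c`. -/
def PolyCurve.coord {d : ℕ} (P : PolyCurve d) (k : ℕ) : ℝ :=
  if h : 0 < d then P.vert (k / d) ⟨k % d, Nat.mod_lt k h⟩ else 0

/-- The initial state on input `P`, `Q`: the numbers of vertices are in the word registers `0` and
`1`, the coordinates of the vertices in the real arrays `0` and `1`, and everything else is `0`. -/
def initState {d : ℕ} (P Q : PolyCurve d) : State where
  ireg := fun x => if x = 0 then P.size else if x = 1 then Q.size else 0
  rreg := fun _ => 0
  iarr := fun _ _ => 0
  rarr := fun a k => if a = 0 then P.coord k else if a = 1 then Q.coord k else 0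

/-- The state holds the sequence `L` of points of the plane as output: the length of the sequence is
in word register `0`, the first and second coordinates of the points are in the real arrays
`2` and `3`. -/
def State.Outputs (σ : State) (L : List (ℝ × ℝ)) : Prop :=
  σ.ireg 0 = L.length ∧
    ∀ (k : ℕ) (hk : k < L.length), σ.rarr 2 k = L[k].1 ∧ σ.rarr 3 k = L[k].2

end VEFrechet

end

/-! The program is a best-first search from `start`, in the manner of Prim's algorithm. Among the
discovered but unprocessed vertices, the frontier, it always processes one of least height; a newly
discovered vertex becomes a child of the vertex being processed, and the search stops when `target`
comes up. The tree path to `target` is the output. Ties between heights do no harm.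

Correctness rests on the invariant `wide` of `Search`: if `v` comes after `a` on the tree path to a
popped vertex, then every path from `a` to an unprocessed vertex contains, after `a`, a vertex at
least as high as `v`. The reason is that such a path had to cross the frontier at the moment when
`v` was popped, and `v` was lowest there (`Search.exists_frontier`, `Search.pop`). When `b` is
discovered, its predecessor on any competing path is unprocessed, since otherwise `b` would have
been discovered before. So `wide` bounds the inner vertices of the tree path by those of the
competitor (`Search.opt_concat`), and all tree paths are locally optimal.

Local optimality gives the rest. Between distinct endpoints the bottleneck of a path is the maximum
of the endpoint heights and the inner width, so a heaviest edge of a locally optimal path is a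
bottleneck edge, and it cuts the path into two pieces that are again locally optimal. By induction
the path is retractable (`IsLocallyOptimal.isRetractable`). Its largest vertex height is the
VE-Fréchet distance (`veDist_eq`), and convexity of the elevation in each cell extends this from the
vertices to the whole morphing (`isGreatest_elevation_morphing`).

For the running time, `wide` with `a` the start vertex shows that up to the arrival at the target
only vertices reachable at height at most the VE-Fréchet distance are popped (`Search.height_le`,
`Search.card_le`). So at most `N` vertices are popped, and as a vertex has at most two successors,
at most `2 * N` are discovered. The diagram is never built: a portal is computed from the indices of
its grid edge at a cost that depends only on `d`, and marks are kept in memory that is zero from the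
start. The priority queue is a tournament tree whose capacity doubles along with the number of
discovered vertices, so that an operation costs `O(log N)` and not `O(log (n * m))`. The arc lengths
account for the term `n + m`.

To bring this to the machine, a small structured language is compiled to real RAM programs. `Ev` is
its total correctness judgement with a time bound; loop-free code is handled by the weakest
precondition `Stmt.wp`, loops by invariants with a decreasing counter. -/

noncomputable section

namespace VEFrechet

/-! ### A structured language on top of the real RAM -/

/-- Registers with numbers below this one are variables; the others hold intermediate results. -/
abbrev numVars : ℕ := 40

namespace State

def setI (s : State) (x v : ℕ) : State := { s with ireg := Function.update s.ireg x v }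

def setR (s : State) (x : ℕ) (v : ℝ) : State := { s with rreg := Function.update s.rreg x v }

def setIArr (s : State) (a i v : ℕ) : State :=
  { s with iarr := Function.update s.iarr a (Function.update (s.iarr a) i v) }

def setRArr (s : State) (a i : ℕ) (v : ℝ) : State :=
  { s with rarr := Function.update s.rarr a (Function.update (s.rarr a) i v) }

section
variable (s : State) (x y a b i j v : ℕ) (r : ℝ)

@[simp] lemma setI_ireg : (s.setI x v).ireg y = if y = x then v else s.ireg y := by
  simp [setI, Function.update_apply]
@[simp] lemma setI_rreg : (s.setI x v).rreg = s.rreg := rfl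
@[simp] lemma setI_iarr : (s.setI x v).iarr = s.iarr := rfl
@[simp] lemma setI_rarr : (s.setI x v).rarr = s.rarr := rfl
@[simp] lemma setR_rreg : (s.setR x r).rreg y = if y = x then r else s.rreg y := by
  simp [setR, Function.update_apply]
@[simp] lemma setR_ireg : (s.setR x r).ireg = s.ireg := rfl
@[simp] lemma setR_iarr : (s.setR x r).iarr = s.iarr := rfl
@[simp] lemma setR_rarr : (s.setR x r).rarr = s.rarr := rfl
@[simp] lemma setIArr_iarr : (s.setIArr a i v).iarr b =
    if b = a then Function.update (s.iarr a) i v else s.iarr b := by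
  simp [setIArr, Function.update_apply]
@[simp] lemma setIArr_ireg : (s.setIArr a i v).ireg = s.ireg := rfl
@[simp] lemma setIArr_rreg : (s.setIArr a i v).rreg = s.rreg := rfl
@[simp] lemma setIArr_rarr : (s.setIArr a i v).rarr = s.rarr := rfl
@[simp] lemma setRArr_rarr : (s.setRArr a i r).rarr b =
    if b = a then Function.update (s.rarr a) i r else s.rarr b := by
  simp [setRArr, Function.update_apply]
@[simp] lemma setRArr_ireg : (s.setRArr a i r).ireg = s.ireg := rfl
@[simp] lemma setRArr_rreg : (s.setRArr a i r).rreg = s.rreg := rfl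
@[simp] lemma setRArr_iarr : (s.setRArr a i r).iarr = s.iarr := rfl

end

/-- The two states have the same variables and the same memory. -/
def Agree (σ s : State) : Prop :=
  (∀ x < numVars, σ.ireg x = s.ireg x) ∧ (∀ x < numVars, σ.rreg x = s.rreg x) ∧
    σ.iarr = s.iarr ∧ σ.rarr = s.rarr

/-- Nothing differs between the two states but registers from `t` on. -/
def AgreeBelow (t : ℕ) (σ s : State) : Prop :=
  (∀ x < t, σ.ireg x = s.ireg x) ∧ (∀ x < t, σ.rreg x = s.rreg x) ∧
    σ.iarr = s.iarr ∧ σ.rarr = s.rarr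

lemma Agree.trans_below {t : ℕ} (ht : numVars ≤ t) {σ σ' s : State} (h : AgreeBelow t σ' σ)
    (h' : Agree σ s) : Agree σ' s :=
  ⟨fun x hx => (h.1 x (by omega)).trans (h'.1 x hx),
    fun x hx => (h.2.1 x (by omega)).trans (h'.2.1 x hx), h.2.2.1.trans h'.2.2.1,
    h.2.2.2.trans h'.2.2.2⟩

lemma WordsLE.set {W : ℕ} {σ : State} (h : σ.WordsLE W) {x v : ℕ} (hv : v ≤ W) :
    WordsLE W { σ with ireg := Function.update σ.ireg x v } := by
  refine ⟨fun y => ?_, h.2⟩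
  by_cases hy : y = x
  · subst hy; simpa using hv
  · simpa [hy] using h.1 y

end State

open State

/-- Word expressions. -/
inductive IExpr where
  | var (x : ℕ)
  | const (c : ℕ)
  | op (o : IOp) (e f : IExpr)
  | load (a : ℕ) (e : IExpr)

namespace IExpr

def eval (s : State) : IExpr → ℕ
  | var x => s.ireg x
  | const c => c
  | op o e f => o.eval (e.eval s) (f.eval s)
  | load a e => s.iarr a (e.eval s)

/-- All intermediate results fit into a word. -/
def Fits (W : ℕ) (s : State) : IExpr → Prop
  | var x => x < numVars
  | const c => c ≤ W
  | op .add e f => e.Fits W s ∧ f.Fits W s ∧ e.eval s + f.eval s ≤ W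
  | op .mul e f => e.Fits W s ∧ f.Fits W s ∧ e.eval s * f.eval s ≤ W
  | op .sub e f => e.Fits W s ∧ f.Fits W s
  | op .div e f => e.Fits W s ∧ f.Fits W s
  | load _ e => e.Fits W s

/-- The program that computes the expression in register `t`, with the help of later registers. -/
def compile : IExpr → ℕ → Prog
  | var x, t => .seq (.instr (.iconst t 0)) (.instr (.iop .add t x t))
  | const c, t => .instr (.iconst t c)
  | op o e f, t => .seq (e.compile t) (.seq (f.compile (t + 1)) (.instr (.iop o t t (t + 1))))
  | load a e, t => .seq (e.compile t) (.instr (.iload t a t))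

def cost : IExpr → ℕ
  | var _ => 2
  | const _ => 1
  | op _ e f => e.cost + (f.cost + 1)
  | load _ e => e.cost + 1

lemma runs_set {W : ℕ} {σ : State} (hσ : σ.WordsLE W) (i : Instr) {x v : ℕ}
    (hi : i.exec σ = { σ with ireg := Function.update σ.ireg x v }) (hv : v ≤ W) :
    Runs W (.instr i) σ 1 { σ with ireg := Function.update σ.ireg x v } := by
  have := Runs.instr (W := W) i σ (by rw [hi]; exact hσ.set hv)
  rwa [hi] at this

/-- The scratch registers serve as a stack: the second operand is evaluated in register `t + 1`, and
by `AgreeBelow` this leaves the first operand in register `t` intact. Differences, quotients and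
loaded words cannot overflow, as they are bounded by words already present; this is why `Fits` asks
for a bound only at sums, products and constants. -/
lemma runs_compile {W : ℕ} {s : State} (e : IExpr) :
    ∀ (t : ℕ) (σ : State), numVars ≤ t → Agree σ s → σ.WordsLE W → e.Fits W s →
      ∃ T σ', Runs W (e.compile t) σ T σ' ∧ T ≤ e.cost ∧ σ'.WordsLE W ∧
        AgreeBelow t σ' σ ∧ σ'.ireg t = e.eval s := by
  induction e with
  | var x =>
    intro t σ ht hσ hW hf
    have hf : x < numVars := hf
    have h1 := runs_set hW (.iconst t 0) (x := t) (v := 0) rfl (Nat.zero_le _)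
    have hW1 := hW.set (x := t) (v := 0) (Nat.zero_le _)
    have h2 := runs_set hW1 (.iop .add t x t) (x := t) (v := σ.ireg x)
      (by
        have : x ≠ t := by omega
        simp [Instr.exec, IOp.eval, this]) (hW.1 x)
    refine ⟨_, _, .seq h1 h2, le_rfl, hW1.set (hW.1 x), ⟨fun y hy => ?_, fun _ _ => rfl, rfl, rfl⟩, ?_⟩
    · simp [hy.ne]
    · simp [eval, hσ.1 x hf]
  | const c =>
    intro t σ ht hσ hW hf
    exact ⟨_, _, runs_set hW (.iconst t c) (x := t) (v := c) rfl hf, le_rfl, hW.set hf,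
      ⟨fun y hy => by simp [hy.ne], fun _ _ => rfl, rfl, rfl⟩, by simp [eval]⟩
  | op o e f ihe ihf =>
    intro t σ ht hσ hW hfit
    have hfe : e.Fits W s := by cases o <;> exact hfit.1
    have hff : f.Fits W s := by cases o <;> first | exact hfit.2.1 | exact hfit.2
    obtain ⟨T1, σ1, r1, c1, w1, a1, v1⟩ := ihe t σ ht hσ hW hfe
    obtain ⟨T2, σ2, r2, c2, w2, a2, v2⟩ :=
      ihf (t + 1) σ1 (by omega) (Agree.trans_below ht a1 hσ) w1 hff
    have v1' : σ2.ireg t = e.eval s := by rw [a2.1 t (by omega), v1]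
    have hle : o.eval (σ2.ireg t) (σ2.ireg (t + 1)) ≤ W := by
      cases o
      · simpa [IOp.eval, v1', v2] using hfit.2.2
      · exact (Nat.sub_le _ _).trans (w2.1 t)
      · simpa [IOp.eval, v1', v2] using hfit.2.2
      · exact (Nat.div_le_self _ _).trans (w2.1 t)
    refine ⟨_, _, .seq r1 (.seq r2 (runs_set w2 (.iop o t t (t + 1)) rfl hle)), ?_, w2.set hle,
      ⟨fun y hy => ?_, fun y hy => ?_, ?_, ?_⟩, ?_⟩
    · simp only [cost]; omega
    · simp [hy.ne, a2.1 y (by omega), a1.1 y hy]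
    · simp [a2.2.1 y (by omega), a1.2.1 y hy]
    · simp [a2.2.2.1, a1.2.2.1]
    · simp [a2.2.2.2, a1.2.2.2]
    · simp [eval, v1', v2]
  | load a e ih =>
    intro t σ ht hσ hW hfit
    obtain ⟨T1, σ1, r1, c1, w1, a1, v1⟩ := ih t σ ht hσ hW hfit
    have hle := w1.2 a (σ1.ireg t)
    refine ⟨_, _, .seq r1 (runs_set w1 (.iload t a t) rfl hle), ?_, w1.set hle,
      ⟨fun y hy => ?_, a1.2.1, a1.2.2.1, a1.2.2.2⟩, ?_⟩
    · simp only [cost]; omega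
    · simp [hy.ne, a1.1 y hy]
    · simp [eval, v1, a1.2.2.1, hσ.2.2.1]

end IExpr

/-- Real expressions. -/
inductive RExpr where
  | var (x : ℕ)
  | const (c : ℕ)
  | op (o : ROp) (e f : RExpr)
  | sqrt (e : RExpr)
  | load (a : ℕ) (e : IExpr)

namespace RExpr

def eval (s : State) : RExpr → ℝ
  | var x => s.rreg x
  | const c => c
  | op o e f => o.eval (e.eval s) (f.eval s)
  | sqrt e => Real.sqrt (e.eval s)
  | load a e => s.rarr a (e.eval s)

def Fits (W : ℕ) (s : State) : RExpr → Prop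
  | var x => x < numVars
  | const _ => True
  | op _ e f => e.Fits W s ∧ f.Fits W s
  | sqrt e => e.Fits W s
  | load _ e => e.Fits W s

def compile : RExpr → ℕ → Prog
  | var x, t => .seq (.instr (.rconst t 0)) (.instr (.rop .add t x t))
  | const c, t => .instr (.rconst t c)
  | op o e f, t => .seq (e.compile t) (.seq (f.compile (t + 1)) (.instr (.rop o t t (t + 1))))
  | sqrt e, t => .seq (e.compile t) (.instr (.rsqrt t t))
  | load a e, t => .seq (e.compile t) (.instr (.rload t a t))

def cost : RExpr → ℕ
  | var _ => 2
  | const _ => 1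
  | op _ e f => e.cost + (f.cost + 1)
  | sqrt e => e.cost + 1
  | load _ e => e.cost + 1

lemma runs_set {W : ℕ} {σ : State} (hσ : σ.WordsLE W) (i : Instr) {x : ℕ} {v : ℝ}
    (hi : i.exec σ = { σ with rreg := Function.update σ.rreg x v }) :
    Runs W (.instr i) σ 1 { σ with rreg := Function.update σ.rreg x v } := by
  have := Runs.instr (W := W) i σ (by rw [hi]; exact hσ)
  rwa [hi] at this

lemma runs_compile {W : ℕ} {s : State} (e : RExpr) :
    ∀ (t : ℕ) (σ : State), numVars ≤ t → Agree σ s → σ.WordsLE W → e.Fits W s →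
      ∃ T σ', Runs W (e.compile t) σ T σ' ∧ T ≤ e.cost ∧ σ'.WordsLE W ∧
        AgreeBelow t σ' σ ∧ σ'.rreg t = e.eval s := by
  induction e with
  | var x =>
    intro t σ ht hσ hW hf
    have hf : x < numVars := hf
    have h1 := runs_set hW (.rconst t 0) (x := t) (v := 0) (by simp [Instr.exec])
    have h2 := runs_set (σ := { σ with rreg := Function.update σ.rreg t 0 }) hW
      (.rop .add t x t) (x := t) (v := σ.rreg x)
      (by
        have : x ≠ t := by omega
        simp [Instr.exec, ROp.eval, this])
    refine ⟨_, _, .seq h1 h2, le_rfl, hW, ⟨fun _ _ => rfl, fun y hy => ?_, rfl, rfl⟩, ?_⟩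
    · simp [hy.ne]
    · simp [eval, hσ.2.1 x hf]
  | const c =>
    intro t σ ht hσ hW hf
    exact ⟨_, _, runs_set hW (.rconst t c) (x := t) (v := c) rfl, le_rfl, hW,
      ⟨fun _ _ => rfl, fun y hy => by simp [hy.ne], rfl, rfl⟩, by simp [eval]⟩
  | op o e f ihe ihf =>
    intro t σ ht hσ hW hfit
    obtain ⟨T1, σ1, r1, c1, w1, a1, v1⟩ := ihe t σ ht hσ hW hfit.1
    obtain ⟨T2, σ2, r2, c2, w2, a2, v2⟩ :=
      ihf (t + 1) σ1 (by omega) (Agree.trans_below ht a1 hσ) w1 hfit.2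
    have v1' : σ2.rreg t = e.eval s := by rw [a2.2.1 t (by omega), v1]
    refine ⟨_, _, .seq r1 (.seq r2 (runs_set w2 (.rop o t t (t + 1)) rfl)), ?_, w2,
      ⟨fun y hy => ?_, fun y hy => ?_, ?_, ?_⟩, ?_⟩
    · simp only [cost]; omega
    · simp [a2.1 y (by omega), a1.1 y hy]
    · simp [hy.ne, a2.2.1 y (by omega), a1.2.1 y hy]
    · simp [a2.2.2.1, a1.2.2.1]
    · simp [a2.2.2.2, a1.2.2.2]
    · simp [eval, v1', v2]
  | sqrt e ih =>
    intro t σ ht hσ hW hfit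
    obtain ⟨T1, σ1, r1, c1, w1, a1, v1⟩ := ih t σ ht hσ hW hfit
    refine ⟨_, _, .seq r1 (runs_set w1 (.rsqrt t t) rfl), ?_, w1,
      ⟨a1.1, fun y hy => ?_, a1.2.2.1, a1.2.2.2⟩, ?_⟩
    · simp only [cost]; omega
    · simp [hy.ne, a1.2.1 y hy]
    · simp [eval, v1]
  | load a e =>
    intro t σ ht hσ hW hfit
    obtain ⟨T1, σ1, r1, c1, w1, a1, v1⟩ := e.runs_compile t σ ht hσ hW hfit
    refine ⟨_, _, .seq r1 (runs_set w1 (.rload t a t) rfl), ?_, w1,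
      ⟨a1.1, fun y hy => ?_, a1.2.2.1, a1.2.2.2⟩, ?_⟩
    · simp only [cost]; omega
    · simp [hy.ne, a1.2.1 y hy]
    · simp [eval, v1, a1.2.2.2, hσ.2.2.2]

end RExpr

/-- Conditions. -/
inductive Cond where
  | ilt (e f : IExpr)
  | ieq (e f : IExpr)
  | rlt (e f : RExpr)

namespace Cond

def holds (s : State) : Cond → Prop
  | ilt e f => e.eval s < f.eval s
  | ieq e f => e.eval s = f.eval s
  | rlt e f => e.eval s < f.eval s

def Fits (W : ℕ) (s : State) : Cond → Prop
  | ilt e f => e.Fits W s ∧ f.Fits W s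
  | ieq e f => e.Fits W s ∧ f.Fits W s
  | rlt e f => e.Fits W s ∧ f.Fits W s

def compile : Cond → Prog
  | ilt e f => .seq (e.compile numVars) (f.compile (numVars + 1))
  | ieq e f => .seq (e.compile numVars) (f.compile (numVars + 1))
  | rlt e f => .seq (e.compile numVars) (f.compile (numVars + 1))

def test : Cond → Test
  | ilt _ _ => .ilt numVars (numVars + 1)
  | ieq _ _ => .ieq numVars (numVars + 1)
  | rlt _ _ => .rlt numVars (numVars + 1)

def cost : Cond → ℕ
  | ilt e f => e.cost + f.cost
  | ieq e f => e.cost + f.cost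
  | rlt e f => e.cost + f.cost

lemma runs_compile {W : ℕ} {s σ : State} (c : Cond) (hσ : Agree σ s) (hW : σ.WordsLE W)
    (hf : c.Fits W s) :
    ∃ T σ', Runs W c.compile σ T σ' ∧ T ≤ c.cost ∧ σ'.WordsLE W ∧ Agree σ' s ∧
      (c.test.holds σ' ↔ c.holds s) := by
  cases c with
  | ilt e f =>
    obtain ⟨T1, σ1, r1, c1, w1, a1, v1⟩ := e.runs_compile numVars σ le_rfl hσ hW hf.1
    have hσ1 := Agree.trans_below le_rfl a1 hσ
    obtain ⟨T2, σ2, r2, c2, w2, a2, v2⟩ := f.runs_compile (numVars + 1) σ1 (by omega) hσ1 w1 hf.2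
    refine ⟨_, _, .seq r1 r2, Nat.add_le_add c1 c2, w2,
      Agree.trans_below (by omega) a2 hσ1, ?_⟩
    simp only [test, Test.holds, holds]
    rw [v2, a2.1 numVars (by omega), v1]
  | ieq e f =>
    obtain ⟨T1, σ1, r1, c1, w1, a1, v1⟩ := e.runs_compile numVars σ le_rfl hσ hW hf.1
    have hσ1 := Agree.trans_below le_rfl a1 hσ
    obtain ⟨T2, σ2, r2, c2, w2, a2, v2⟩ := f.runs_compile (numVars + 1) σ1 (by omega) hσ1 w1 hf.2
    refine ⟨_, _, .seq r1 r2, Nat.add_le_add c1 c2, w2,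
      Agree.trans_below (by omega) a2 hσ1, ?_⟩
    simp only [test, Test.holds, holds]
    rw [v2, a2.1 numVars (by omega), v1]
  | rlt e f =>
    obtain ⟨T1, σ1, r1, c1, w1, a1, v1⟩ := e.runs_compile numVars σ le_rfl hσ hW hf.1
    have hσ1 := Agree.trans_below le_rfl a1 hσ
    obtain ⟨T2, σ2, r2, c2, w2, a2, v2⟩ := f.runs_compile (numVars + 1) σ1 (by omega) hσ1 w1 hf.2
    refine ⟨_, _, .seq r1 r2, Nat.add_le_add c1 c2, w2,
      Agree.trans_below (by omega) a2 hσ1, ?_⟩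
    simp only [test, Test.holds, holds]
    rw [v2, a2.2.1 numVars (by omega), v1]

end Cond

/-- Statements. -/
inductive Stmt where
  | skip
  | iset (x : ℕ) (e : IExpr)
  | rset (x : ℕ) (e : RExpr)
  | iput (a : ℕ) (e f : IExpr)
  | rput (a : ℕ) (e : IExpr) (f : RExpr)
  | seq (a b : Stmt)
  | ite (c : Cond) (a b : Stmt)
  | loop (c : Cond) (a : Stmt)

namespace Stmt

/-- The machine has no instruction that copies a register, so values are moved by adding zero. Its
loops test registers only; hence the code for the condition is placed before the loop and again at
the end of the body. -/
def compile : Stmt → Prog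
  | skip => .skip
  | iset x e => .seq (e.compile numVars)
      (.seq (.instr (.iconst (numVars + 1) 0)) (.instr (.iop .add x numVars (numVars + 1))))
  | rset x e => .seq (e.compile numVars)
      (.seq (.instr (.rconst (numVars + 1) 0)) (.instr (.rop .add x numVars (numVars + 1))))
  | iput a e f => .seq (e.compile numVars) (.seq (f.compile (numVars + 1))
      (.instr (.istore a numVars (numVars + 1))))
  | rput a e f => .seq (e.compile numVars) (.seq (f.compile (numVars + 1))
      (.instr (.rstore a numVars (numVars + 1))))
  | seq a b => .seq a.compile b.compile
  | ite c a b => .seq c.compile (.ite c.test a.compile b.compile)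
  | loop c a => .seq c.compile (.loop c.test (.seq a.compile c.compile))

/-- An upper bound for the number of steps of a statement without loops. -/
def cost : Stmt → ℕ
  | skip => 0
  | iset _ e => e.cost + 2
  | rset _ e => e.cost + 2
  | iput _ e f => e.cost + f.cost + 1
  | rput _ e f => e.cost + f.cost + 1
  | seq a b => a.cost + b.cost
  | ite c a b => c.cost + (a.cost + b.cost + 1)
  | loop _ _ => 0

end Stmt

/-- Started in a machine state that agrees with `s`, the statement halts after at most `n` steps in
a state that agrees with one that satisfies `Q`. -/
def Ev (W : ℕ) (a : Stmt) (s : State) (n : ℕ) (Q : State → Prop) : Prop :=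
  ∀ σ, Agree σ s → σ.WordsLE W →
    ∃ T σ' s', Runs W a.compile σ T σ' ∧ T ≤ n ∧ σ'.WordsLE W ∧ Agree σ' s' ∧ Q s'

/-! ### Proof rules for timed total correctness -/

namespace Ev

variable {W : ℕ} {s : State} {Q : State → Prop}

lemma mono {a : Stmt} {n n' : ℕ} {Q' : State → Prop} (h : Ev W a s n Q) (hn : n ≤ n')
    (hQ : ∀ s', Q s' → Q' s') : Ev W a s n' Q' := by
  intro σ hσ hW
  obtain ⟨T, σ', s', r, c, w, a, q⟩ := h σ hσ hW
  exact ⟨T, σ', s', r, c.trans hn, w, a, hQ _ q⟩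

lemma skip (h : Q s) : Ev W .skip s 0 Q :=
  fun σ hσ hW => ⟨0, σ, s, .skip σ, le_rfl, hW, hσ, h⟩

lemma iset {x : ℕ} {e : IExpr} (hx : x < numVars) (he : e.Fits W s)
    (h : Q (s.setI x (e.eval s))) : Ev W (.iset x e) s (e.cost + 2) Q := by
  intro σ hσ hW
  obtain ⟨T1, σ1, r1, c1, w1, a1, v1⟩ := e.runs_compile numVars σ le_rfl hσ hW he
  have hσ1 := Agree.trans_below le_rfl a1 hσ
  have r2 := IExpr.runs_set w1 (.iconst (numVars + 1) 0) (x := numVars + 1) (v := 0) rfl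
    (Nat.zero_le _)
  have w2 := w1.set (x := numVars + 1) (v := 0) (Nat.zero_le _)
  have hle : e.eval s ≤ W := by rw [← v1]; exact w1.1 _
  have r3 := IExpr.runs_set w2 (.iop .add x numVars (numVars + 1)) (x := x) (v := e.eval s)
    (by simp [Instr.exec, IOp.eval, ← v1]) hle
  refine ⟨_, _, s.setI x (e.eval s), .seq r1 (.seq r2 r3), by omega, w2.set hle,
    ⟨fun y hy => ?_, hσ1.2.1, hσ1.2.2.1, hσ1.2.2.2⟩, h⟩
  by_cases hyx : y = x
  · subst hyx; simp [setI]
  · have : y ≠ numVars + 1 := by omega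
    simp [hyx, this, setI, hσ1.1 y hy]

lemma rset {x : ℕ} {e : RExpr} (hx : x < numVars) (he : e.Fits W s)
    (h : Q (s.setR x (e.eval s))) : Ev W (.rset x e) s (e.cost + 2) Q := by
  intro σ hσ hW
  obtain ⟨T1, σ1, r1, c1, w1, a1, v1⟩ := e.runs_compile numVars σ le_rfl hσ hW he
  have hσ1 := Agree.trans_below le_rfl a1 hσ
  have r2 := RExpr.runs_set w1 (.rconst (numVars + 1) 0) (x := numVars + 1) (v := 0)
    (by simp [Instr.exec])
  have r3 := RExpr.runs_set (σ := { σ1 with rreg := Function.update σ1.rreg (numVars + 1) 0 }) w1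
    (.rop .add x numVars (numVars + 1)) (x := x) (v := e.eval s)
    (by simp [Instr.exec, ROp.eval, ← v1])
  refine ⟨_, _, s.setR x (e.eval s), .seq r1 (.seq r2 r3), by omega, w1,
    ⟨hσ1.1, fun y hy => ?_, hσ1.2.2.1, hσ1.2.2.2⟩, h⟩
  by_cases hyx : y = x
  · subst hyx; simp [setR]
  · have : y ≠ numVars + 1 := by omega
    simp [hyx, this, setR, hσ1.2.1 y hy]

lemma iput {a : ℕ} {e f : IExpr} (he : e.Fits W s) (hf : f.Fits W s)
    (h : Q (s.setIArr a (e.eval s) (f.eval s))) :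
    Ev W (.iput a e f) s (e.cost + f.cost + 1) Q := by
  intro σ hσ hW
  obtain ⟨T1, σ1, r1, c1, w1, a1, v1⟩ := e.runs_compile numVars σ le_rfl hσ hW he
  have hσ1 := Agree.trans_below le_rfl a1 hσ
  obtain ⟨T2, σ2, r2, c2, w2, a2, v2⟩ := f.runs_compile (numVars + 1) σ1 (by omega) hσ1 w1 hf
  have hσ2 := Agree.trans_below (by omega) a2 hσ1
  have hw : (Instr.exec σ2 (.istore a numVars (numVars + 1))).WordsLE W := by
    refine ⟨w2.1, fun b i => ?_⟩
    simp only [Instr.exec, Function.update_apply]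
    split_ifs
    · simp only [Function.update_apply]; split_ifs
      · exact w2.1 _
      · exact w2.2 _ _
    · exact w2.2 _ _
  refine ⟨_, _, s.setIArr a (e.eval s) (f.eval s),
    .seq r1 (.seq r2 (.instr (.istore a numVars (numVars + 1)) σ2 hw)), by omega, hw,
    ⟨hσ2.1, hσ2.2.1, ?_, hσ2.2.2.2⟩, h⟩
  simp [Instr.exec, setIArr, v2, a2.1 numVars (by omega), v1, hσ2.2.2.1]

lemma rput {a : ℕ} {e : IExpr} {f : RExpr} (he : e.Fits W s) (hf : f.Fits W s)
    (h : Q (s.setRArr a (e.eval s) (f.eval s))) :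
    Ev W (.rput a e f) s (e.cost + f.cost + 1) Q := by
  intro σ hσ hW
  obtain ⟨T1, σ1, r1, c1, w1, a1, v1⟩ := e.runs_compile numVars σ le_rfl hσ hW he
  have hσ1 := Agree.trans_below le_rfl a1 hσ
  obtain ⟨T2, σ2, r2, c2, w2, a2, v2⟩ := f.runs_compile (numVars + 1) σ1 (by omega) hσ1 w1 hf
  have hσ2 := Agree.trans_below (by omega) a2 hσ1
  have hw : (Instr.exec σ2 (.rstore a numVars (numVars + 1))).WordsLE W := w2
  refine ⟨_, _, s.setRArr a (e.eval s) (f.eval s),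
    .seq r1 (.seq r2 (.instr (.rstore a numVars (numVars + 1)) σ2 hw)), by omega, hw,
    ⟨hσ2.1, hσ2.2.1, hσ2.2.2.1, ?_⟩, h⟩
  simp [Instr.exec, setRArr, v2, a2.1 numVars (by omega), v1, hσ2.2.2.2]

lemma seq {a b : Stmt} {n m : ℕ} (h : Ev W a s n fun s' => Ev W b s' m Q) :
    Ev W (.seq a b) s (n + m) Q := by
  intro σ hσ hW
  obtain ⟨T, σ', s', r, c, w, a, q⟩ := h σ hσ hW
  obtain ⟨T', σ'', s'', r', c', w', a', q'⟩ := q σ' a w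
  exact ⟨_, _, s'', .seq r r', Nat.add_le_add c c', w', a', q'⟩

lemma ite {c : Cond} {a b : Stmt} {n : ℕ} (hc : c.Fits W s) (ha : c.holds s → Ev W a s n Q)
    (hb : ¬ c.holds s → Ev W b s n Q) : Ev W (.ite c a b) s (c.cost + (n + 1)) Q := by
  intro σ hσ hW
  obtain ⟨T, σ', r, t, w, ag, hiff⟩ := c.runs_compile hσ hW hc
  by_cases h : c.holds s
  · obtain ⟨T', σ'', s'', r', c', w', a', q'⟩ := ha h σ' ag w
    exact ⟨_, _, s'', .seq r (.ite_true (hiff.2 h) r'), by omega, w', a', q'⟩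
  · obtain ⟨T', σ'', s'', r', c', w', a', q'⟩ := hb h σ' ag w
    exact ⟨_, _, s'', .seq r (.ite_false (fun h' => h (hiff.1 h')) r'), by omega, w', a', q'⟩

/-- A loop with an invariant `I k`, where `k` bounds the number of rounds that are left. -/
lemma loop {c : Cond} {a : Stmt} {n : ℕ} (I : ℕ → State → Prop)
    (hfit : ∀ k s, I k s → c.Fits W s)
    (hstep : ∀ k s, I k s → c.holds s → ∃ k' < k, Ev W a s n (I k'))
    (k : ℕ) (hs : I k s) :
    Ev W (.loop c a) s (k * (n + c.cost + 1) + (c.cost + 1))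
      fun s' => ¬ c.holds s' ∧ ∃ k', I k' s' := by
  have key : ∀ k s σ, I k s → Agree σ s → σ.WordsLE W → (c.test.holds σ ↔ c.holds s) →
      ∃ T σ' s', Runs W (.loop c.test (.seq a.compile c.compile)) σ T σ' ∧
        T ≤ k * (n + c.cost + 1) + 1 ∧ σ'.WordsLE W ∧ Agree σ' s' ∧
        (¬ c.holds s' ∧ ∃ k', I k' s') := by
    intro k
    induction k using Nat.strong_induction_on with
    | _ k ih =>
      intro s σ hI hσ hW hiff
      by_cases h : c.holds s
      · obtain ⟨k', hk', he⟩ := hstep k s hI h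
        obtain ⟨T, σ1, s1, r1, c1, w1, a1, q1⟩ := he σ hσ hW
        obtain ⟨T2, σ2, r2, t2, w2, a2, hiff2⟩ := c.runs_compile a1 w1 (hfit _ _ q1)
        obtain ⟨T3, σ3, s3, r3, c3, w3, a3, q3⟩ := ih k' hk' s1 σ2 q1 a2 w2 hiff2
        refine ⟨_, _, s3, .loop_step (hiff.2 h) (.seq r1 r2) r3, ?_, w3, a3, q3⟩
        have : (k' + 1) * (n + c.cost + 1) ≤ k * (n + c.cost + 1) := Nat.mul_le_mul_right _ hk'
        rw [Nat.add_mul] at this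
        omega
      · exact ⟨_, σ, s, .loop_done (fun h' => h (hiff.1 h')), by omega, hW, hσ, h, k, hI⟩
  intro σ hσ hW
  obtain ⟨T, σ', r, t, w, ag, hiff⟩ := c.runs_compile hσ hW (hfit _ _ hs)
  obtain ⟨T', σ'', s'', r', t', w', a', q'⟩ := key k s σ' hs ag w hiff
  exact ⟨_, _, s'', .seq r r', by omega, w', a', q'⟩

end Ev

/-- The weakest precondition of a statement without loops. -/
def Stmt.wp (W : ℕ) : Stmt → (State → Prop) → State → Prop
  | .skip, Q, s => Q s
  | .iset x e, Q, s => x < numVars ∧ e.Fits W s ∧ Q (s.setI x (e.eval s))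
  | .rset x e, Q, s => x < numVars ∧ e.Fits W s ∧ Q (s.setR x (e.eval s))
  | .iput a e f, Q, s => e.Fits W s ∧ f.Fits W s ∧ Q (s.setIArr a (e.eval s) (f.eval s))
  | .rput a e f, Q, s => e.Fits W s ∧ f.Fits W s ∧ Q (s.setRArr a (e.eval s) (f.eval s))
  | .seq a b, Q, s => a.wp W (b.wp W Q) s
  | .ite c a b, Q, s => c.Fits W s ∧ (c.holds s → a.wp W Q s) ∧ (¬ c.holds s → b.wp W Q s)
  | .loop _ _, _, _ => False

lemma Ev.of_wp {W : ℕ} (a : Stmt) :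
    ∀ {s : State} {Q : State → Prop}, a.wp W Q s → Ev W a s a.cost Q := by
  induction a with
  | skip => exact fun h => Ev.skip h
  | iset x e => exact fun h => Ev.iset h.1 h.2.1 h.2.2
  | rset x e => exact fun h => Ev.rset h.1 h.2.1 h.2.2
  | iput a e f => exact fun h => Ev.iput h.1 h.2.1 h.2.2
  | rput a e f => exact fun h => Ev.rput h.1 h.2.1 h.2.2
  | seq a b iha ihb => exact fun h => Ev.seq ((iha h).mono le_rfl fun s' h' => ihb h')
  | ite c a b iha ihb =>
    intro s Q h
    exact Ev.ite h.1 (fun hc => (iha (h.2.1 hc)).mono (Nat.le_add_right _ _) fun _ h => h)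
      (fun hc => (ihb (h.2.2 hc)).mono (Nat.le_add_left _ _) fun _ h => h)
  | loop c a => exact fun h => h.elim

/-! ### Paths -/

section Graph

variable {V : Type} {G : V → V → Prop} {h : V → ℝ}

lemma IsPath.single (v : V) : IsPath G v v [v] := by simp [IsPath]

lemma IsPath.ne_nil {u v : V} {l : List V} (hl : IsPath G u v l) : l ≠ [] := by
  rintro rfl; simp [IsPath] at hl

lemma IsPath.concat {u v w : V} {l : List V} (hl : IsPath G u v l) (e : G v w) :
    IsPath G u w (l ++ [w]) := by
  refine ⟨?_, ?_, by simp⟩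
  · rw [List.isChain_append]
    refine ⟨hl.1, by simp, fun x hx y hy => ?_⟩
    rw [hl.2.2] at hx
    simp only [Option.mem_def, Option.some.injEq, List.head?_cons] at hx hy
    subst hx; subst hy; exact e
  · simp [hl.2.1]

/-- A path ends with an edge unless it is a single vertex. -/
lemma IsPath.eq_single_or {u v : V} {l : List V} (hl : IsPath G u v l) :
    (l = [v] ∧ u = v) ∨ ∃ l' z, l = l' ++ [v] ∧ IsPath G u z l' ∧ G z v := by
  obtain ⟨l', w, rfl⟩ : ∃ l' w, l = l' ++ [w] := by
    exact ⟨l.dropLast, l.getLast hl.ne_nil, (List.dropLast_append_getLast hl.ne_nil).symm⟩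
  obtain ⟨hc, hh, ht⟩ := hl
  simp only [List.getLast?_append, List.getLast?_singleton, Option.some_or,
    Option.some.injEq] at ht
  subst ht
  rcases eq_or_ne l' [] with rfl | hne
  · left; simpa [eq_comm] using hh
  · right
    refine ⟨l', l'.getLast hne, rfl, ⟨?_, ?_, ?_⟩, ?_⟩
    · exact (List.isChain_append.1 hc).1
    · rwa [List.head?_append_of_ne_nil _ hne] at hh
    · exact List.getLast?_eq_getLast_of_ne_nil hne
    · exact (List.isChain_append.1 hc).2.2 _ (by simp [List.getLast?_eq_getLast_of_ne_nil hne]) _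
        (by simp)

lemma IsPath.reflTransGen {u v : V} {l : List V} (hl : IsPath G u v l) :
    Relation.ReflTransGen G u v := by
  induction l using List.reverseRecOn generalizing v with
  | nil => exact absurd rfl hl.ne_nil
  | append_singleton l w ih =>
    rcases hl.eq_single_or with ⟨-, rfl⟩ | ⟨l', z, hl', hp, e⟩
    · exact .refl
    · obtain ⟨rfl, -⟩ := List.append_inj' hl' rfl
      exact (ih hp).tail e

lemma exists_isPath_of_reflTransGen {u v : V} (huv : Relation.ReflTransGen G u v) :
    ∃ l, IsPath G u v l := by
  induction huv with
  | refl => exact ⟨[u], .single u⟩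
  | tail _ e ih => obtain ⟨l, hl⟩ := ih; exact ⟨_, hl.concat e⟩

lemma List.le_maximum_of_exists {l l' : List V} (H : ∀ v ∈ l, ∃ x ∈ l', h v ≤ h x) :
    (l.map h).maximum ≤ (l'.map h).maximum := by
  refine List.maximum_le_of_forall_le fun a ha => ?_
  obtain ⟨v, hv, rfl⟩ := List.mem_map.1 ha
  obtain ⟨x, hx, hvx⟩ := H v hv
  exact (WithBot.coe_le_coe.2 hvx).trans (List.le_maximum_of_mem' (List.mem_map_of_mem hx))

lemma isPath_infix {l l₁ : List V} (hl : l.IsChain G) (hi : l₁ <:+: l) (hne : l₁ ≠ []) :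
    IsPath G (l₁.head hne) (l₁.getLast hne) l₁ :=
  ⟨hl.infix hi, List.head?_eq_some_head hne, List.getLast?_eq_getLast_of_ne_nil hne⟩

end Graph

/-! ### Locally optimal paths are retractable -/

section Retractable

variable {V : Type} {G : V → V → Prop} {h : V → ℝ}

/-- The largest weight of an edge is the largest height of a vertex. -/
lemma bottleneck_cons_cons (h : V → ℝ) (a b : V) (l : List V) :
    bottleneck (fun u v => max (h u) (h v)) (a :: b :: l) = ((a :: b :: l).map h).maximum := by
  induction l generalizing a b with
  | nil => simp [bottleneck, pathEdges, List.maximum_cons]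
  | cons c l ih =>
    have h1 : bottleneck (fun u v => max (h u) (h v)) (a :: b :: c :: l) =
        max ((max (h a) (h b) : ℝ) : WithBot ℝ)
          (bottleneck (fun u v => max (h u) (h v)) (b :: c :: l)) := by
      simp [bottleneck, pathEdges, List.maximum_cons]
    rw [h1, ih]
    simp only [List.map_cons, List.maximum_cons, WithBot.coe_max]
    rw [max_assoc, ← max_assoc (h b : WithBot ℝ) (h b : WithBot ℝ), max_self]

lemma maximum_eq_innerWidth (h : V → ℝ) (a b : V) (l : List V) :
    ((a :: (l ++ [b])).map h).maximum =
      max (max (h a : WithBot ℝ) (h b)) (innerWidth h (a :: (l ++ [b]))) := by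
  have h1 : innerWidth h (a :: (l ++ [b])) = (l.map h).maximum := by
    simp [innerWidth]
  have h2 : ((l ++ [b]).map h).maximum = max (h b : WithBot ℝ) (l.map h).maximum := by
    rw [List.map_append]
    induction l with
    | nil => simp
    | cons c l ih =>
      simp only [List.map_cons, List.cons_append, List.maximum_cons] at ih ⊢
      rw [ih (by simp [innerWidth])]
      exact max_left_comm _ _ _
  rw [h1, List.map_cons, List.maximum_cons, h2, max_assoc]

lemma IsPath.eq_cons_append {u v : V} {l : List V} (hl : IsPath G u v l) (huv : u ≠ v) :
    ∃ l', l = u :: (l' ++ [v]) := by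
  rcases hl.eq_single_or with ⟨-, h⟩ | ⟨l₁, z, rfl, hp, -⟩
  · exact absurd h huv
  · obtain ⟨w, l₂, rfl⟩ := List.exists_cons_of_ne_nil hp.ne_nil
    have := hp.2.1
    simp only [List.head?_cons, Option.some.injEq] at this
    subst this
    exact ⟨l₂, rfl⟩

lemma exists_cons_cons (u v : V) (l : List V) : ∃ b l', u :: (l ++ [v]) = u :: b :: l' := by
  cases l with
  | nil => exact ⟨v, [], rfl⟩
  | cons b l => exact ⟨b, l ++ [v], rfl⟩

/-- Every vertex of a path with at least one edge lies on an edge, so edge weights and vertex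
heights have the same maximum. Thus, for fixed distinct endpoints, least inner width implies least
bottleneck. For `u = v` this fails, as a single vertex has bottleneck `⊥`. -/
lemma bottleneck_eq {u v : V} {l : List V} (hl : IsPath G u v l) (huv : u ≠ v) :
    bottleneck (fun u v => max (h u) (h v)) l =
      max (max (h u : WithBot ℝ) (h v)) (innerWidth h l) := by
  obtain ⟨l', rfl⟩ := hl.eq_cons_append huv
  rw [← maximum_eq_innerWidth]
  obtain ⟨b, l'', e⟩ := exists_cons_cons u v l'
  rw [e, bottleneck_cons_cons]

/-- Every edge of a path splits it. -/
lemma exists_split_of_mem_pathEdges {u v : V} {l : List V} (he : (u, v) ∈ pathEdges l) :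
    ∃ p q, l = (p ++ [u]) ++ (v :: q) := by
  induction l with
  | nil => simp [pathEdges] at he
  | cons a l ih =>
    cases l with
    | nil => simp [pathEdges] at he
    | cons b l =>
      simp only [pathEdges, List.tail_cons, List.zip_cons_cons, List.mem_cons, Prod.mk.injEq] at he
      rcases he with ⟨rfl, rfl⟩ | he
      · exact ⟨[], l, rfl⟩
      · obtain ⟨p, q, hpq⟩ := ih (by simpa [pathEdges] using he)
        exact ⟨a :: p, q, by rw [hpq]; rfl⟩

lemma exists_mem_pathEdges_bottleneck (w : V → V → ℝ) (a b : V) (l : List V) :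
    ∃ e ∈ pathEdges (a :: b :: l), bottleneck w (a :: b :: l) = (w e.1 e.2 : WithBot ℝ) := by
  have hne : ((pathEdges (a :: b :: l)).map fun e => w e.1 e.2) ≠ [] := by simp [pathEdges]
  obtain ⟨m, hm⟩ := WithBot.ne_bot_iff_exists.1 (List.maximum_ne_bot_of_ne_nil hne)
  have := List.maximum_mem hm.symm
  obtain ⟨e, he, rfl⟩ := List.mem_map.1 this
  exact ⟨e, he, hm.symm⟩

/-- In an acyclic graph locally optimal paths are retractable. -/
lemma IsLocallyOptimal.isRetractable (hG : ∀ v, ¬ Relation.TransGen G v v) {l : List V}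
    (hchain : l.IsChain G) (hne : l ≠ []) (hopt : IsLocallyOptimal G h l) :
    IsRetractable G (fun u v => max (h u) (h v)) l := by
  induction hn : l.length using Nat.strong_induction_on generalizing l with
  | _ n ih =>
  match l, hne with
  | [a], _ => exact .single a
  | a :: b :: l', _ =>
    have hpath := isPath_infix hchain (List.infix_refl _) (by simp)
    set t := (a :: b :: l').getLast (by simp) with ht
    -- Acyclicity enters here. With equal endpoints the single vertex would be a competitor of
    -- bottleneck `⊥`, and no edge could be a bottleneck edge.
    have hst : a ≠ t := by
      intro hat
      have h1 : IsPath G b t (b :: l') :=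
        ⟨hchain.tail, rfl, by rw [ht, List.getLast?_eq_getLast_of_ne_nil (by simp)]; simp⟩
      have h2 : G a b := by simpa using hchain.rel
      exact hG a (by
        have := Relation.TransGen.head' h2 h1.reflTransGen
        rwa [← hat] at this)
    simp only [List.head_cons] at hpath
    -- Split at an edge of largest weight; both pieces are infixes and inherit local optimality.
    obtain ⟨⟨u, v⟩, he, hb⟩ :=
      exists_mem_pathEdges_bottleneck (fun u v => max (h u) (h v)) a b l'
    obtain ⟨p, q, hpq⟩ := exists_split_of_mem_pathEdges he
    have hchain' := hchain
    have hpath' := hpath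
    rw [hpq] at hchain'
    have hcp := (List.isChain_append.1 hchain').1
    have hcq := (List.isChain_append.1 hchain').2.1
    have huv : G u v := (List.isChain_append.1 hchain').2.2 u (by simp) v (by simp)
    have hp : IsPath G a u (p ++ [u]) := by
      refine ⟨hcp, ?_, by simp⟩
      have := congrArg List.head? hpq
      rw [List.head?_append_of_ne_nil _ (by simp)] at this
      rw [← this]; rfl
    have hq : IsPath G v t (v :: q) := by
      refine ⟨hcq, rfl, ?_⟩
      have := hpath.2.2
      rwa [hpq, List.getLast?_append_of_ne_nil _ (by simp)] at this
    have hlen : (p ++ [u]).length + (v :: q).length = n := by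
      rw [← List.length_append, ← hpq, hn]
    have infp : p ++ [u] <:+: a :: b :: l' := by
      rw [hpq]; exact (List.prefix_append _ _).isInfix
    have infq : v :: q <:+: a :: b :: l' := by
      rw [hpq]; exact (List.suffix_append _ _).isInfix
    have := IsRetractable.join (w := fun u v => max (h u) (h v)) hp hq huv ⟨⟨_, hpath, he, hb⟩,
      fun l₂ hl₂ => ?_⟩
      (ih _ (by simp only [List.length_cons] at hlen; omega) hcp (by simp)
        (fun l₁ h₁ => hopt l₁ (h₁.trans infp)) rfl)
      (ih _ (by simp only [List.length_append, List.length_singleton] at hlen; omega) hcq (by simp)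
        (fun l₁ h₁ => hopt l₁ (h₁.trans infq)) rfl)
    · rwa [← hpq] at this
    -- The endpoint heights are common to both paths, so only the inner widths have to be compared.
    · rw [← hb, bottleneck_eq hpath hst, bottleneck_eq hl₂ hst]
      exact max_le_max le_rfl (hopt _ (List.infix_refl _) _ _ _ hpath hl₂)

/-- A locally optimal path between different vertices has the least maximal height. -/
lemma IsLocallyOptimal.exists_le {l l' : List V} {u v : V} (hopt : IsLocallyOptimal G h l)
    (huv : u ≠ v) (hl : IsPath G u v l) (hl' : IsPath G u v l') :
    ∀ x ∈ l, ∃ y ∈ l', h x ≤ h y := by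
  have hle := hopt _ (List.infix_refl _) _ _ _ hl hl'
  obtain ⟨k, rfl⟩ := hl.eq_cons_append huv
  obtain ⟨k', rfl⟩ := hl'.eq_cons_append huv
  intro x hx
  have h1 : (h x : WithBot ℝ) ≤ ((u :: (k ++ [v])).map h).maximum :=
    List.le_maximum_of_mem' (List.mem_map_of_mem hx)
  rw [maximum_eq_innerWidth] at h1
  have h2 := h1.trans (max_le_max le_rfl hle)
  rw [← maximum_eq_innerWidth] at h2
  obtain ⟨m, hm⟩ := WithBot.ne_bot_iff_exists.1
    (List.maximum_ne_bot_of_ne_nil (l := (u :: (k' ++ [v])).map h) (by simp))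
  obtain ⟨y, hy, rfl⟩ := List.mem_map.1 (List.maximum_mem hm.symm)
  exact ⟨y, hy, by rw [← hm] at h2; exact WithBot.coe_le_coe.1 h2⟩

end Retractable

/-! ### The search -/

/-- The state of the search: the discovered vertices are numbered from `0` to `c - 1`, the search
tree is given by `par`, and `p k` is the path in the tree from the root to vertex `k`. -/
structure Tree (V : Type) where
  c : ℕ
  vx : ℕ → V
  par : ℕ → ℕ
  p : ℕ → List V

/-- The invariants of a search that has processed the vertices in `E` and is about to process
vertex `y`. -/
structure Search {V : Type} (G : V → V → Prop) (h : V → ℝ) (s : V) (g : Tree V)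
    (E : Finset ℕ) (y : ℕ) : Prop where
  pos : 0 < g.c
  lt : ∀ k ∈ insert y E, k < g.c
  y_notMem : y ∉ E
  zero_mem : 0 ∈ insert y E
  inj : ∀ i < g.c, ∀ j < g.c, g.vx i = g.vx j → i = j
  root : g.vx 0 = s ∧ g.p 0 = [s]
  parent : ∀ k < g.c, 0 < k → g.par k ∈ insert y E ∧ g.par k < k ∧ G (g.vx (g.par k)) (g.vx k) ∧
    g.p k = g.p (g.par k) ++ [g.vx k]
  opt : ∀ k < g.c, IsLocallyOptimal G h (g.p k)
  -- The end `z` has to avoid only `E`, not `y`: a competing path to a vertex discovered from `y`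
  -- may itself arrive through `y`.
  wide : ∀ k ∈ insert y E, ∀ l₁ a l₂, g.p k = l₁ ++ a :: l₂ → ∀ v ∈ l₂, ∀ z, (∀ j ∈ E, g.vx j ≠ z) →
    ∀ l, IsPath G a z l → ∃ x ∈ l.tail, h v ≤ h x
  closed : ∀ k ∈ E, ∀ v, G (g.vx k) v → ∃ j < g.c, g.vx j = v

namespace Search

variable {V : Type} {G : V → V → Prop} {h : V → ℝ} {s : V} {g : Tree V} {E : Finset ℕ} {y : ℕ}

lemma init (G : V → V → Prop) (h : V → ℝ) (s : V) (g : Tree V) (hc : g.c = 1)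
    (hv : g.vx 0 = s) (hp : g.p 0 = [s]) : Search G h s g ∅ 0 where
  pos := by omega
  lt := by simp [hc]
  y_notMem := by simp
  zero_mem := by simp
  inj := fun i hi j hj _ => by omega
  root := ⟨hv, hp⟩
  parent := fun k hk hk' => by omega
  opt := fun k hk l₁ hl₁ u v l' h1 _ => by
    obtain rfl : k = 0 := by omega
    rw [hp] at hl₁
    have hlen := hl₁.length_le
    have : l₁.tail = [] := by
      apply List.eq_nil_of_length_eq_zero
      simp only [List.length_singleton] at hlen
      simp; omega
    simp [innerWidth, this]
  wide := fun k hk l₁ a l₂ e v hv' => by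
    have hk : k = 0 := by simpa using hk
    subst hk
    rw [hp] at e
    have := congrArg List.length e
    simp only [List.length_append, List.length_cons, List.length_nil] at this
    have : l₂ = [] := List.eq_nil_of_length_eq_zero (by omega)
    simp [this] at hv'
  closed := by simp

lemma isPath (S : Search G h s g E y) : ∀ k < g.c, IsPath G s (g.vx k) (g.p k) := by
  intro k
  induction k using Nat.strong_induction_on with
  | _ k ih =>
    intro hk
    rcases Nat.eq_zero_or_pos k with rfl | h0
    · rw [S.root.1, S.root.2]; exact .single s
    · obtain ⟨h1, h2, h3, h4⟩ := S.parent k hk h0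
      rw [h4]
      exact (ih _ h2 (S.lt _ h1)).concat h3

/-- The vertices of the path to vertex `k` other than its end have been popped. -/
lemma mem_path (S : Search G h s g E y) : ∀ k < g.c, ∀ v ∈ g.p k,
    v = g.vx k ∨ ∃ j ∈ insert y E, g.vx j = v := by
  intro k
  induction k using Nat.strong_induction_on with
  | _ k ih =>
    intro hk v hv
    rcases Nat.eq_zero_or_pos k with rfl | h0
    · rw [S.root.2, ← S.root.1] at hv; left; simpa using hv
    · obtain ⟨h1, h2, h3, h4⟩ := S.parent k hk h0
      rw [h4, List.mem_append, List.mem_singleton] at hv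
      rcases hv with hv | hv
      · rcases ih _ h2 (S.lt _ h1) v hv with rfl | h5
        · exact .inr ⟨_, h1, rfl⟩
        · exact .inr h5
      · exact .inl hv

lemma mem_path_of_mem (S : Search G h s g E y) {k : ℕ} (hk : k ∈ insert y E) {v : V}
    (hv : v ∈ g.p k) : ∃ j ∈ insert y E, g.vx j = v := by
  rcases S.mem_path k (S.lt k hk) v hv with rfl | h1
  · exact ⟨k, hk, rfl⟩
  · exact h1

lemma length_path_le (S : Search G h s g E y) : ∀ k < g.c, (g.p k).length ≤ k + 1 := by
  intro k
  induction k using Nat.strong_induction_on with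
  | _ k ih =>
    intro hk
    rcases Nat.eq_zero_or_pos k with rfl | h0
    · simp [S.root.2]
    · obtain ⟨h1, h2, h3, h4⟩ := S.parent k hk h0
      have := ih _ h2 (S.lt _ h1)
      rw [h4]; simp; omega

/-- The tree after the discovery of `b` from vertex `y`. -/
def discover (g : Tree V) (y : ℕ) (b : V) : Tree V where
  c := g.c + 1
  vx := Function.update g.vx g.c b
  par := Function.update g.par g.c y
  p := Function.update g.p g.c (g.p y ++ [b])

/-- The tree path to the current vertex can be extended to a new vertex. -/
lemma opt_concat (S : Search G h s g E y) {b : V} (hb : ∀ k < g.c, g.vx k ≠ b) :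
    IsLocallyOptimal G h (g.p y ++ [b]) := by
  have hyD : y ∈ insert y E := Finset.mem_insert_self _ _
  have hy := S.lt y hyD
  intro l₁ hl₁ u v l' hp hp'
  rw [List.infix_concat_iff] at hl₁
  rcases hl₁ with hl₁ | hl₁
  swap
  · exact S.opt y hy l₁ hl₁ u v l' hp hp'
  have hsuf : l₁ = [] ∨ ∃ l₃, l₃ <:+ g.p y ∧ l₁ = l₃ ++ [b] := by
    have := List.suffix_concat_iff.1 hl₁
    rcases this with h1 | ⟨l₃, h1, h2⟩
    · exact .inl h1
    · exact .inr ⟨l₃, h2, by simpa using h1⟩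
  rcases hsuf with rfl | ⟨l₃, hs3, rfl⟩
  · exact absurd rfl hp.ne_nil
  cases l₃ with
  | nil => simp [innerWidth]
  | cons a l₂ =>
    have hu : a = u := by simpa using hp.2.1
    have hv : b = v := by
      have := hp.2.2
      rwa [List.getLast?_concat, Option.some.injEq] at this
    subst hu; subst hv
    obtain ⟨l₀, hl₀⟩ := hs3
    have hab : a ≠ b := by
      rintro rfl
      obtain ⟨j, hj, hjv⟩ := S.mem_path_of_mem hyD (v := a) (by rw [← hl₀]; simp)
      exact hb j (S.lt j hj) hjv
    rcases hp'.eq_single_or with ⟨-, h1⟩ | ⟨l'', z, rfl, hz, hzb⟩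
    · exact absurd h1 hab
    have e1 : innerWidth h (a :: l₂ ++ [b]) = (l₂.map h).maximum := by
      simp [innerWidth]
    have e2 : innerWidth h (l'' ++ [b]) = (l''.tail.map h).maximum := by
      rw [innerWidth, List.tail_append_of_ne_nil hz.ne_nil, List.dropLast_concat]
    rw [e1, e2]
    -- The competitor reaches `b` from `z`. As `b` is undiscovered, `z` is not in `E`, so `wide`
    -- finds for each inner vertex `v` one at least as high in `l''.tail`, that is, among the inner
    -- vertices of the competitor.
    refine List.le_maximum_of_exists fun v hv => ?_
    refine S.wide y hyD l₀ a l₂ hl₀.symm v hv z (fun j hj hjz => ?_) l'' hz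
    obtain ⟨i, hi, hib⟩ := S.closed j hj b (by rw [hjz]; exact hzb)
    exact hb i hi hib

/-- The numbers and tree paths of the old vertices do not change, and the new vertex is not popped;
so `opt` is the only invariant with new content, and `opt_concat` supplies it. -/
lemma discover_search (S : Search G h s g E y) {b : V} (hyb : G (g.vx y) b)
    (hb : ∀ k < g.c, g.vx k ≠ b) : Search G h s (discover g y b) E y := by
  have hyD : y ∈ insert y E := Finset.mem_insert_self _ _
  have hy := S.lt y hyD
  have hvx : ∀ k < g.c, (discover g y b).vx k = g.vx k := fun k hk => by
    simp [discover, hk.ne]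
  have hpp : ∀ k < g.c, (discover g y b).p k = g.p k := fun k hk => by
    simp [discover, hk.ne]
  have hpar : ∀ k < g.c, (discover g y b).par k = g.par k := fun k hk => by
    simp [discover, hk.ne]
  have hvx' : (discover g y b).vx g.c = b := by simp [discover]
  have hpp' : (discover g y b).p g.c = g.p y ++ [b] := by simp [discover]
  have hpar' : (discover g y b).par g.c = y := by simp [discover]
  have hc : (discover g y b).c = g.c + 1 := rfl
  refine ⟨by omega, fun k hk => (S.lt k hk).trans (by omega), S.y_notMem, S.zero_mem, ?_, ?_, ?_,
    ?_, ?_, ?_⟩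
  · intro i hi j hj hij
    rw [hc] at hi hj
    rcases Nat.lt_succ_iff_lt_or_eq.1 hi with hi | rfl <;>
      rcases Nat.lt_succ_iff_lt_or_eq.1 hj with hj | rfl
    · rw [hvx i hi, hvx j hj] at hij; exact S.inj i hi j hj hij
    · rw [hvx i hi, hvx'] at hij; exact absurd hij (hb i hi)
    · rw [hvx j hj, hvx'] at hij; exact absurd hij.symm (hb j hj)
    · rfl
  · rw [hvx 0 S.pos, hpp 0 S.pos]; exact S.root
  · intro k hk h0
    rw [hc] at hk
    rcases Nat.lt_succ_iff_lt_or_eq.1 hk with hk | rfl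
    · obtain ⟨h1, h2, h3, h4⟩ := S.parent k hk h0
      rw [hpar k hk, hvx k hk, hpp k hk, hvx _ (S.lt _ h1), hpp _ (S.lt _ h1)]
      exact ⟨h1, h2, h3, h4⟩
    · rw [hpar', hvx', hpp', hvx y hy, hpp y hy]
      exact ⟨hyD, hy, hyb, rfl⟩
  · intro k hk
    rw [hc] at hk
    rcases Nat.lt_succ_iff_lt_or_eq.1 hk with hk | rfl
    · rw [hpp k hk]; exact S.opt k hk
    · rw [hpp']; exact S.opt_concat hb
  · intro k hk l₁ a l₂ e v hv z hz
    rw [hpp k (S.lt k hk)] at e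
    exact S.wide k hk l₁ a l₂ e v hv z fun j hj => by
      rw [← hvx j (S.lt j (Finset.mem_insert_of_mem hj))]; exact hz j hj
  · intro k hk v hkv
    rw [hvx k (S.lt k (Finset.mem_insert_of_mem hk))] at hkv
    obtain ⟨j, hj, e⟩ := S.closed k hk v hkv
    exact ⟨j, by omega, by rw [hvx j hj, e]⟩

/-- A path that leaves the popped vertices contains a vertex of the frontier. -/
lemma exists_frontier (g : Tree V) (D : Finset ℕ)
    (hcl : ∀ k ∈ D, ∀ v, G (g.vx k) v → ∃ j < g.c, g.vx j = v) {z : V}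
    (hz : ∀ j ∈ D, g.vx j ≠ z) : ∀ {l : List V} {a : V}, (∃ i ∈ D, g.vx i = a) → IsPath G a z l →
      ∃ j < g.c, j ∉ D ∧ g.vx j ∈ l.tail := by
  intro l
  induction l with
  | nil => intro a _ hl; exact absurd rfl hl.ne_nil
  | cons a l ih =>
    rintro a' ⟨i, hi, rfl⟩ hl
    have ha : a = g.vx i := by simpa using hl.2.1
    subst ha
    cases l with
    | nil =>
      have : g.vx i = z := by simpa using hl.2.2
      exact absurd this (hz i hi)
    | cons b l =>
      have hib : G (g.vx i) b := by simpa using hl.1.rel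
      obtain ⟨j, hj, rfl⟩ := hcl i hi b hib
      by_cases hjD : j ∈ D
      · obtain ⟨j', h1, h2, h3⟩ := ih ⟨j, hjD, rfl⟩
          (a := g.vx j) ⟨hl.1.tail, rfl, by simpa [List.getLast?_cons_cons] using hl.2.2⟩
        exact ⟨j', h1, h2, by simp only [List.tail_cons] at h3 ⊢; exact List.mem_cons_of_mem _ h3⟩
      · exact ⟨j, hj, hjD, by simp⟩

/-- The search goes on with a lowest vertex of the frontier. -/
lemma pop (S : Search G h s g E y) (hcl : ∀ v, G (g.vx y) v → ∃ j < g.c, g.vx j = v) {y' : ℕ}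
    (hy' : y' < g.c) (hn : y' ∉ insert y E)
    (hmin : ∀ k < g.c, k ∉ insert y E → h (g.vx y') ≤ h (g.vx k)) :
    Search G h s g (insert y E) y' := by
  have hcl' : ∀ k ∈ insert y E, ∀ v, G (g.vx k) v → ∃ j < g.c, g.vx j = v := by
    intro k hk v hkv
    rcases Finset.mem_insert.1 hk with rfl | hk
    · exact hcl v hkv
    · exact S.closed k hk v hkv
  have hwide : ∀ k ∈ insert y E, ∀ l₁ a l₂, g.p k = l₁ ++ a :: l₂ → ∀ v ∈ l₂, ∀ z,
      (∀ j ∈ insert y E, g.vx j ≠ z) → ∀ l, IsPath G a z l → ∃ x ∈ l.tail, h v ≤ h x :=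
    fun k hk l₁ a l₂ e v hv z hz => S.wide k hk l₁ a l₂ e v hv z
      fun j hj => hz j (Finset.mem_insert_of_mem hj)
  refine ⟨S.pos, ?_, hn, Finset.mem_insert_of_mem S.zero_mem, S.inj, S.root, ?_, S.opt, ?_, hcl'⟩
  · intro k hk
    rcases Finset.mem_insert.1 hk with rfl | hk
    · exact hy'
    · exact S.lt k hk
  · intro k hk h0
    obtain ⟨h1, h2⟩ := S.parent k hk h0
    exact ⟨Finset.mem_insert_of_mem h1, h2⟩
  · intro k hk l₁ a l₂ e v hv z hz l hl
    rcases Finset.mem_insert.1 hk with rfl | hk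
    · have h0 : 0 < k := by
        rcases Nat.eq_zero_or_pos k with rfl | h0
        · exact absurd S.zero_mem hn
        · exact h0
      obtain ⟨h1, -, -, h4⟩ := S.parent k hy' h0
      rw [h4] at e
      obtain ⟨l₃, w, rfl⟩ : ∃ l₃ w, l₂ = l₃ ++ [w] :=
        ⟨l₂.dropLast, l₂.getLast (List.ne_nil_of_mem hv),
          (List.dropLast_append_getLast _).symm⟩
      rw [← List.cons_append, ← List.append_assoc] at e
      obtain ⟨e1, e2⟩ := List.append_inj' e rfl
      rcases List.mem_append.1 hv with hv | hv
      -- Before the last vertex, the path to `k` is the path to its parent, which was popped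
      -- earlier.
      · exact hwide _ h1 l₁ a l₃ e1 v hv z hz l hl
      · have hvk : v = g.vx k := by
          simp only [List.cons.injEq, and_true] at e2
          simpa [e2] using hv
        obtain ⟨i, hi, hia⟩ := S.mem_path_of_mem h1 (v := a) (by rw [e1]; simp)
        -- For the popped vertex itself: a path from the popped `a` to an unpopped `z` crosses the
        -- frontier, where no vertex is lower than the one just chosen.
        obtain ⟨j, hj, hjD, hjl⟩ := exists_frontier g (insert y E) hcl' hz ⟨i, hi, hia⟩ hl
        exact ⟨_, hjl, by rw [hvk]; exact hmin j hj hjD⟩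
    · exact hwide k hk l₁ a l₂ e v hv z hz l hl

/-- While the target has not been processed, all popped vertices are at most as high as any path to
the target. -/
lemma height_le (S : Search G h s g E y) {t : V} (ht : ∀ j ∈ E, g.vx j ≠ t) {l : List V}
    (hl : IsPath G s t l) {r : ℝ} (hr : ∀ v ∈ l, h v ≤ r) {k : ℕ} (hk : k ∈ insert y E) :
    ∀ v ∈ g.p k, h v ≤ r := by
  have hp := S.isPath k (S.lt k hk)
  obtain ⟨w, l₂, e⟩ := List.exists_cons_of_ne_nil hp.ne_nil
  have hw : w = s := by have := hp.2.1; rw [e] at this; simpa using this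
  subst hw
  intro v hv
  rw [e] at hv
  rcases List.mem_cons.1 hv with rfl | hv
  · exact hr _ (List.mem_of_mem_head? hl.2.1)
  · obtain ⟨x, hx, hvx⟩ := S.wide k hk [] w l₂ e v hv t ht l hl
    exact hvx.trans (hr x (List.mem_of_mem_tail hx))

end Search

/-! ### Geometry of the free space diagram -/

namespace PolyCurve

variable {d : ℕ} (P : PolyCurve d)

lemma edgeLen_nonneg (i : ℕ) : 0 ≤ P.edgeLen i := dist_nonneg

lemma arc_zero : P.arc 0 = 0 := by simp [arc]

lemma arc_succ (i : ℕ) : P.arc (i + 1) = P.arc i + P.edgeLen i := by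
  simp [arc, Finset.sum_range_succ]

lemma arc_mono : Monotone P.arc :=
  monotone_nat_of_le_succ fun i => by rw [arc_succ]; linarith [P.edgeLen_nonneg i]

lemma edgeLen_smul_edgeDir (i : ℕ) :
    P.edgeLen i • P.edgeDir i = P.vert (i + 1) - P.vert i := by
  by_cases h : P.edgeLen i = 0
  · rw [h, zero_smul]
    have := dist_eq_zero.1 h
    rw [this, sub_self]
  · rw [edgeDir, smul_inv_smul₀ h]

lemma norm_edgeDir {i : ℕ} (h : P.edgeLen i ≠ 0) : ‖P.edgeDir i‖ = 1 := by
  rw [edgeDir, norm_smul, norm_inv, Real.norm_of_nonneg (P.edgeLen_nonneg i), norm_sub_rev,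
    ← dist_eq_norm]
  exact inv_mul_cancel₀ h

/-- The clamped terms of `param` are full edge vectors before edge `i`, which telescope, and vanish
after it. -/
lemma param_arc_add {i : ℕ} (hi : i + 1 < P.size) {t : ℝ} (h0 : 0 ≤ t) (h1 : t ≤ P.edgeLen i) :
    P.param (P.arc i + t) = P.vert i + t • P.edgeDir i := by
  have hterm : ∀ k ∈ Finset.range (P.size - 1),
      (min (max (P.arc i + t - P.arc k) 0) (P.edgeLen k)) • P.edgeDir k =
        (if k < i then P.vert (k + 1) - P.vert k else 0) +
          (if k = i then t • P.edgeDir i else 0) := by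
    intro k _
    rcases lt_trichotomy k i with hk | rfl | hk
    · have h2 : P.arc (k + 1) ≤ P.arc i := P.arc_mono hk
      rw [arc_succ] at h2
      rw [if_pos hk, if_neg hk.ne, add_zero, min_eq_right, edgeLen_smul_edgeDir]
      exact le_max_of_le_left (by linarith)
    · rw [if_neg (lt_irrefl _), if_pos rfl, zero_add, add_sub_cancel_left, max_eq_left h0,
        min_eq_left h1]
    · have h2 : P.arc (i + 1) ≤ P.arc k := P.arc_mono hk
      rw [arc_succ] at h2
      rw [if_neg hk.not_gt, if_neg hk.ne', add_zero, max_eq_right (by linarith),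
        min_eq_left (P.edgeLen_nonneg k), zero_smul]
  rw [param, Finset.sum_congr rfl hterm, Finset.sum_add_distrib, Finset.sum_ite_eq',
    if_pos (Finset.mem_range.2 (by omega)), ← Finset.sum_filter]
  have : (Finset.range (P.size - 1)).filter (· < i) = Finset.range i := by
    ext k; simp only [Finset.mem_filter, Finset.mem_range]; omega
  rw [this, Finset.sum_range_sub]
  abel

lemma param_arc {i : ℕ} (hi : i < P.size) : P.param (P.arc i) = P.vert i := by
  have h2 := P.two_le_size
  rcases Nat.lt_or_ge (i + 1) P.size with h | h
  · simpa using P.param_arc_add h le_rfl (P.edgeLen_nonneg i)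
  -- The last vertex starts no edge; it is reached as the end of the preceding one.
  · obtain ⟨k, rfl⟩ : ∃ k, i = k + 1 := ⟨i - 1, by omega⟩
    rw [arc_succ, P.param_arc_add hi (P.edgeLen_nonneg k) le_rfl, edgeLen_smul_edgeDir]
    abel

/-- The position on edge `i` of the projection of `q` to the line through the edge. -/
def proj (i : ℕ) (q : EuclideanSpace ℝ (Fin d)) : ℝ := inner ℝ (q - P.vert i) (P.edgeDir i)

/-- The position on edge `i` of the point that is nearest to `q`. -/
def offset (i : ℕ) (q : EuclideanSpace ℝ (Fin d)) : ℝ := max 0 (min (P.edgeLen i) (P.proj i q))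

lemma offset_nonneg (i : ℕ) (q : EuclideanSpace ℝ (Fin d)) : 0 ≤ P.offset i q := le_max_left _ _

lemma offset_le (i : ℕ) (q : EuclideanSpace ℝ (Fin d)) : P.offset i q ≤ P.edgeLen i :=
  max_le (P.edgeLen_nonneg i) (min_le_left _ _)

/-- Along the edge the squared distance is a quadratic in `t` with leading coefficient one and
vertex `proj`. The clamped value `offset` satisfies the variational inequality `0 ≤ (t - offset) *
(offset - proj)`, which gives the claim. The extra square on the left makes the minimizer unique. An
edge of length zero is treated apart because its direction is not a unit vector. -/
lemma dist_sq_le (i : ℕ) (q : EuclideanSpace ℝ (Fin d)) {t : ℝ} (h0 : 0 ≤ t)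
    (h1 : t ≤ P.edgeLen i) :
    dist (P.vert i + P.offset i q • P.edgeDir i) q ^ 2 + (t - P.offset i q) ^ 2 ≤
      dist (P.vert i + t • P.edgeDir i) q ^ 2 := by
  by_cases hl : P.edgeLen i = 0
  · have ht : t = 0 := by linarith
    have ho : P.offset i q = 0 := by linarith [P.offset_nonneg i q, P.offset_le i q]
    simp [ht, ho]
  have key : ∀ t : ℝ, dist (P.vert i + t • P.edgeDir i) q ^ 2 =
      ‖q - P.vert i‖ ^ 2 - 2 * (t * P.proj i q) + t ^ 2 := by
    intro t
    have : P.vert i + t • P.edgeDir i - q = -((q - P.vert i) - t • P.edgeDir i) := by abel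
    rw [dist_eq_norm, this, norm_neg, norm_sub_sq_real, inner_smul_right, norm_smul,
      P.norm_edgeDir hl, mul_one, Real.norm_eq_abs, sq_abs, proj]
  rw [key, key]
  have : 0 ≤ (t - P.offset i q) * (P.offset i q - P.proj i q) := by
    rcases le_total (P.proj i q) 0 with h | h
    · have : P.offset i q = 0 := max_eq_left ((min_le_right _ _).trans h)
      rw [this]; exact mul_nonneg (by linarith) (by linarith)
    · rcases le_total (P.proj i q) (P.edgeLen i) with h' | h'
      · have : P.offset i q = P.proj i q := by
          rw [offset, min_eq_right h', max_eq_right h]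
        rw [this]; simp
      · have : P.offset i q = P.edgeLen i := by
          rw [offset, min_eq_left h', max_eq_right (P.edgeLen_nonneg i)]
        rw [this]; exact mul_nonneg_of_nonpos_of_nonpos (by linarith) (by linarith)
  nlinarith

lemma sInf_isMinOn {i : ℕ} (hi : i + 1 < P.size) (q : EuclideanSpace ℝ (Fin d)) :
    sInf {x | x ∈ Set.Icc (P.arc i) (P.arc (i + 1)) ∧
      IsMinOn (fun x' => dist (P.param x') q) (Set.Icc (P.arc i) (P.arc (i + 1))) x} =
      P.arc i + P.offset i q := by
  have hmem : P.arc i + P.offset i q ∈ Set.Icc (P.arc i) (P.arc (i + 1)) := by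
    rw [arc_succ]; constructor <;> linarith [P.offset_nonneg i q, P.offset_le i q]
  have key : ∀ x ∈ Set.Icc (P.arc i) (P.arc (i + 1)),
      dist (P.param (P.arc i + P.offset i q)) q ^ 2 + (x - (P.arc i + P.offset i q)) ^ 2 ≤
        dist (P.param x) q ^ 2 := by
    intro x hx
    rw [arc_succ] at hx
    have := P.dist_sq_le i q (t := x - P.arc i) (by linarith [hx.1]) (by linarith [hx.2])
    rw [← P.param_arc_add hi (P.offset_nonneg i q) (P.offset_le i q),
      ← P.param_arc_add hi (by linarith [hx.1]) (by linarith [hx.2])] at this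
    simpa [sub_sub] using this
  have : {x | x ∈ Set.Icc (P.arc i) (P.arc (i + 1)) ∧
      IsMinOn (fun x' => dist (P.param x') q) (Set.Icc (P.arc i) (P.arc (i + 1))) x} =
      {P.arc i + P.offset i q} := by
    ext x
    simp only [Set.mem_ofPred_eq, Set.mem_singleton_iff]
    constructor
    · rintro ⟨hx, hmin⟩
      have h1 := key x hx
      have h2 : dist (P.param x) q ≤ dist (P.param (P.arc i + P.offset i q)) q := hmin hmem
      have h3 : dist (P.param x) q ^ 2 ≤ dist (P.param (P.arc i + P.offset i q)) q ^ 2 :=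
        pow_le_pow_left₀ dist_nonneg h2 2
      have h4 : (x - (P.arc i + P.offset i q)) ^ 2 = 0 := le_antisymm (by linarith) (sq_nonneg _)
      linarith [pow_eq_zero_iff (two_ne_zero) |>.1 h4]
    · rintro rfl
      refine ⟨hmem, fun x hx => ?_⟩
      have h1 := key x hx
      exact le_of_sq_le_sq (by nlinarith [sq_nonneg (x - (P.arc i + P.offset i q))]) dist_nonneg
  rw [this, csInf_singleton]
where
  le_of_sq_le_sq {a b : ℝ} (h : a ^ 2 ≤ b ^ 2) (hb : 0 ≤ b) : a ≤ b := abs_le_of_sq_le_sq' h hb |>.2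

end PolyCurve

section VE

variable {d : ℕ} (P Q : PolyCurve d)

/-! ### Closed formulas for portals, and elevation along edges -/

lemma location_hor {i j : ℕ} (hi : i + 1 < P.size) (hj : j < Q.size) :
    location P Q (.hor i j) = (P.arc i + P.offset i (Q.vert j), Q.arc j) := by
  simp only [location, elevation, Q.param_arc hj]
  rw [P.sInf_isMinOn hi]

lemma location_ver {i j : ℕ} (hi : i < P.size) (hj : j + 1 < Q.size) :
    location P Q (.ver i j) = (P.arc i, Q.arc j + Q.offset j (P.vert i)) := by
  simp only [location, elevation, P.param_arc hi, dist_comm (P.vert i)]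
  rw [Q.sInf_isMinOn hj]

lemma height_hor {i j : ℕ} (hi : i + 1 < P.size) (hj : j < Q.size) :
    height P Q (.hor i j) =
      dist (P.vert i + P.offset i (Q.vert j) • P.edgeDir i) (Q.vert j) := by
  rw [height, location_hor P Q hi hj, elevation, Q.param_arc hj,
    P.param_arc_add hi (P.offset_nonneg _ _) (P.offset_le _ _)]

lemma height_ver {i j : ℕ} (hi : i < P.size) (hj : j + 1 < Q.size) :
    height P Q (.ver i j) =
      dist (Q.vert j + Q.offset j (P.vert i) • Q.edgeDir j) (P.vert i) := by
  rw [height, location_ver P Q hi hj, elevation, P.param_arc hi,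
    Q.param_arc_add hj (Q.offset_nonneg _ _) (Q.offset_le _ _), dist_comm]

lemma height_start : height P Q .start = dist (P.vert 0) (Q.vert 0) := by
  have hP := P.param_arc (i := 0) (by have := P.two_le_size; omega)
  have hQ := Q.param_arc (i := 0) (by have := Q.two_le_size; omega)
  rw [PolyCurve.arc_zero] at hP hQ
  simp [height, location, elevation, hP, hQ]

lemma height_target :
    height P Q .target = dist (P.vert (P.size - 1)) (Q.vert (Q.size - 1)) := by
  have hP := P.param_arc (i := P.size - 1) (by have := P.two_le_size; omega)
  have hQ := Q.param_arc (i := Q.size - 1) (by have := Q.two_le_size; omega)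
  simp [height, location, elevation, hP, hQ]

/-- The elevation is convex within a cell. -/
lemma elevation_le_max {i j : ℕ} (hi : i + 1 < P.size) (hj : j + 1 < Q.size) {z w v : ℝ × ℝ}
    (hz : z ∈ Set.Icc (P.arc i) (P.arc (i + 1)) ×ˢ Set.Icc (Q.arc j) (Q.arc (j + 1)))
    (hw : w ∈ Set.Icc (P.arc i) (P.arc (i + 1)) ×ˢ Set.Icc (Q.arc j) (Q.arc (j + 1)))
    (hv : v ∈ segment ℝ z w) :
    elevation P Q v ≤ max (elevation P Q z) (elevation P Q w) := by
  have key : ∀ z ∈ Set.Icc (P.arc i) (P.arc (i + 1)) ×ˢ Set.Icc (Q.arc j) (Q.arc (j + 1)),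
      elevation P Q z = ‖(P.vert i + (z.1 - P.arc i) • P.edgeDir i) -
        (Q.vert j + (z.2 - Q.arc j) • Q.edgeDir j)‖ := by
    rintro ⟨x, y⟩ ⟨hx, hy⟩
    simp only [PolyCurve.arc_succ, Set.mem_Icc] at hx hy
    rw [← P.param_arc_add hi (by linarith) (by linarith),
      ← Q.param_arc_add hj (by linarith) (by linarith), elevation, dist_eq_norm]
    simp
  have hconv : Convex ℝ (Set.Icc (P.arc i) (P.arc (i + 1)) ×ˢ Set.Icc (Q.arc j) (Q.arc (j + 1))) :=
    (convex_Icc _ _).prod (convex_Icc _ _)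
  have hvm := hconv.segment_subset hz hw hv
  obtain ⟨a, b, ha, hb, hab, rfl⟩ := hv
  rw [key _ hvm]
  -- Within a cell both curves are affine, hence so is their difference; the triangle inequality
  -- then gives convexity of its norm.
  have e : (P.vert i + ((a • z + b • w).1 - P.arc i) • P.edgeDir i) -
        (Q.vert j + ((a • z + b • w).2 - Q.arc j) • Q.edgeDir j) =
      a • ((P.vert i + (z.1 - P.arc i) • P.edgeDir i) -
        (Q.vert j + (z.2 - Q.arc j) • Q.edgeDir j)) +
      b • ((P.vert i + (w.1 - P.arc i) • P.edgeDir i) -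
        (Q.vert j + (w.2 - Q.arc j) • Q.edgeDir j)) := by
    obtain rfl : b = 1 - a := by linarith
    simp only [Prod.fst_add, Prod.snd_add, Prod.smul_fst, Prod.smul_snd, smul_eq_mul]
    module
  rw [e]
  refine (norm_add_le _ _).trans ?_
  rw [norm_smul, norm_smul, Real.norm_of_nonneg ha, Real.norm_of_nonneg hb, ← key z hz,
    ← key w hw]
  have h1 := mul_le_mul_of_nonneg_left (le_max_left (elevation P Q z) (elevation P Q w)) ha
  have h2 := mul_le_mul_of_nonneg_left (le_max_right (elevation P Q z) (elevation P Q w)) hb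
  calc _ ≤ a * max (elevation P Q z) (elevation P Q w) +
        b * max (elevation P Q z) (elevation P Q w) := add_le_add h1 h2
    _ = _ := by rw [← add_mul, hab, one_mul]

lemma location_horVertex {i j : ℕ} (hi : i + 1 < P.size) (hj : j < Q.size) :
    (location P Q (horVertex P Q i j)).1 ∈ Set.Icc (P.arc i) (P.arc (i + 1)) ∧
      (location P Q (horVertex P Q i j)).2 = Q.arc j := by
  rw [horVertex]
  split_ifs with h1 h2
  · rw [h1.1, h1.2]
    simp [location, PolyCurve.arc_zero, PolyCurve.arc_succ, P.edgeLen_nonneg 0]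
  · have e1 : P.size - 1 = i + 1 := by omega
    have e2 : Q.size - 1 = j := by omega
    simp only [location, e1, e2]
    exact ⟨⟨P.arc_mono (by omega), le_rfl⟩, trivial⟩
  · rw [location_hor P Q hi hj, PolyCurve.arc_succ]
    exact ⟨⟨by linarith [P.offset_nonneg i (Q.vert j)], by linarith [P.offset_le i (Q.vert j)]⟩, rfl⟩

lemma location_verVertex {i j : ℕ} (hi : i < P.size) (hj : j + 1 < Q.size) :
    (location P Q (verVertex P Q i j)).1 = P.arc i ∧
      (location P Q (verVertex P Q i j)).2 ∈ Set.Icc (Q.arc j) (Q.arc (j + 1)) := by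
  rw [verVertex]
  split_ifs with h1 h2
  · rw [h1.1, h1.2]
    simp [location, PolyCurve.arc_zero, PolyCurve.arc_succ, Q.edgeLen_nonneg 0]
  · have e1 : P.size - 1 = i := by omega
    have e2 : Q.size - 1 = j + 1 := by omega
    simp only [location, e1, e2]
    exact ⟨trivial, Q.arc_mono (by omega), le_rfl⟩
  · rw [location_ver P Q hi hj, PolyCurve.arc_succ]
    exact ⟨rfl, by linarith [Q.offset_nonneg j (P.vert i)], by linarith [Q.offset_le j (P.vert i)]⟩

/-- Along an edge of the VE graph the elevation is at most the height of an endpoint. -/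
lemma elevation_edge_le {u v : VEVertex} (huv : VEAdj P Q u v) {z : ℝ × ℝ}
    (hz : z ∈ segment ℝ (location P Q u) (location P Q v)) :
    elevation P Q z ≤ max (height P Q u) (height P Q v) := by
  obtain ⟨i, j, hi, hj, hu, hv⟩ := huv
  have h1 := P.arc_mono (Nat.le_succ i)
  have h2 := Q.arc_mono (Nat.le_succ j)
  refine elevation_le_max P Q hi hj ?_ ?_ hz
  · rcases hu with rfl | rfl
    · obtain ⟨a, b⟩ := location_horVertex P Q hi (j := j) (by omega)
      exact ⟨a, by rw [b]; exact ⟨le_rfl, h2⟩⟩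
    · obtain ⟨a, b⟩ := location_verVertex P Q (i := i) (by omega) hj
      exact ⟨by rw [a]; exact ⟨le_rfl, h1⟩, b⟩
  · rcases hv with rfl | rfl
    · obtain ⟨a, b⟩ := location_horVertex P Q hi hj
      exact ⟨a, by rw [b]; exact ⟨h2, le_rfl⟩⟩
    · obtain ⟨a, b⟩ := location_verVertex P Q hi hj
      exact ⟨by rw [a]; exact ⟨h1, le_rfl⟩, b⟩

lemma mem_pathEdges_of_mem {V : Type} {l : List V} {v : V} (hl : 2 ≤ l.length) (hv : v ∈ l) :
    ∃ e ∈ pathEdges l, e.1 = v ∨ e.2 = v := by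
  induction l with
  | nil => simp at hv
  | cons a l ih =>
    cases l with
    | nil => simp at hl
    | cons b l =>
      rcases List.mem_cons.1 hv with rfl | hv
      · exact ⟨(v, b), by simp [pathEdges], .inl rfl⟩
      · cases l with
        | nil =>
          have : v = b := by simpa using hv
          exact ⟨(a, b), by simp [pathEdges], .inr this.symm⟩
        | cons c l =>
          obtain ⟨e, he, h⟩ := ih (by simp) hv
          exact ⟨e, by simpa [pathEdges] using .inr (by simpa [pathEdges] using he), h⟩

lemma adj_of_mem_pathEdges {V : Type} {G : V → V → Prop} {l : List V} (hl : l.IsChain G)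
    {e : V × V} (he : e ∈ pathEdges l) : e.1 ∈ l ∧ e.2 ∈ l ∧ G e.1 e.2 := by
  obtain ⟨u, v⟩ := e
  obtain ⟨p, q, rfl⟩ := exists_split_of_mem_pathEdges he
  exact ⟨by simp, by simp, (List.isChain_append.1 hl).2.2 u (by simp) v (by simp)⟩

/-- By convexity no point of a segment is higher than both of its ends. The bound is attained at a
highest vertex, which lies on some segment because a path from `start` to `target` has at least one
edge. -/
lemma isGreatest_elevation_morphing {l : List VEVertex}
    (hl : IsPath (VEAdj P Q) .start .target l) {r : ℝ} (hle : ∀ v ∈ l, height P Q v ≤ r)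
    (hr : ∃ v ∈ l, height P Q v = r) :
    IsGreatest (elevation P Q '' morphing P Q l) r := by
  constructor
  · obtain ⟨v, hv, rfl⟩ := hr
    have hlen : 2 ≤ l.length := by
      obtain ⟨l', rfl⟩ := hl.eq_cons_append (by simp)
      simp
    obtain ⟨e, he, h⟩ := mem_pathEdges_of_mem hlen hv
    refine ⟨location P Q v, ⟨e, he, ?_⟩, rfl⟩
    rcases h with rfl | rfl
    · exact left_mem_segment ℝ _ _
    · exact right_mem_segment ℝ _ _
  · rintro _ ⟨z, ⟨e, he, hz⟩, rfl⟩
    obtain ⟨h1, h2, h3⟩ := adj_of_mem_pathEdges hl.1 he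
    exact (elevation_edge_le P Q h3 hz).trans (max_le (hle _ h1) (hle _ h2))

/-! ### The VE graph -/

/-- The indices of the cell to which a vertex is the way in. -/
def cell : VEVertex → ℕ × ℕ
  | .start => (0, 0)
  | .target => (P.size - 1, Q.size - 1)
  | .hor i j => (i, j)
  | .ver i j => (i, j)

/-- The key under which a vertex is filed. -/
def code : VEVertex → ℕ
  | .start => 0
  | .target => 2 * ((P.size - 1) * Q.size + (Q.size - 1))
  | .hor i j => 2 * (i * Q.size + j)
  | .ver i j => 2 * (i * Q.size + j) + 1

/-- The start vertex and the vertices with an incoming edge. -/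
def Valid : VEVertex → Prop
  | .start => True
  | .target => True
  -- On the grid edges `i + j` has its largest value, `P.size + Q.size - 3`, exactly at the top
  -- right corner, where the vertex is `target`. Grid edges on the bottom and left sides have no
  -- incoming edge, whence `0 < j` here and `0 < i` for `ver`.
  | .hor i j => i + 1 < P.size ∧ j < Q.size ∧ 0 < j ∧ i + j + 3 ≠ P.size + Q.size
  | .ver i j => i < P.size ∧ j + 1 < Q.size ∧ 0 < i ∧ i + j + 3 ≠ P.size + Q.size

lemma horVertex_succ {i j : ℕ} (hi : i + 1 < P.size) (hj : j + 1 < Q.size) :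
    horVertex P Q i (j + 1) =
      if i + (j + 1) + 3 = P.size + Q.size then .target else .hor i (j + 1) := by
  simp only [horVertex]
  by_cases h : i + (j + 1) + 3 = P.size + Q.size
  · rw [if_neg (by omega), if_pos (by omega), if_pos h]
  · rw [if_neg (by omega), if_neg (by omega), if_neg h]

lemma verVertex_succ {i j : ℕ} (hi : i + 1 < P.size) (hj : j + 1 < Q.size) :
    verVertex P Q (i + 1) j =
      if i + 1 + j + 3 = P.size + Q.size then .target else .ver (i + 1) j := by
  simp only [verVertex]
  by_cases h : i + 1 + j + 3 = P.size + Q.size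
  · rw [if_neg (by omega), if_pos (by omega), if_pos h]
  · rw [if_neg (by omega), if_neg (by omega), if_neg h]

lemma cell_horVertex {i j : ℕ} (hj : j + 1 < Q.size) :
    cell P Q (horVertex P Q i j) = (i, j) := by
  simp only [horVertex]
  split_ifs with h1 h2
  · simp [cell, h1]
  · omega
  · rfl

lemma cell_verVertex {i j : ℕ} (hi : i + 1 < P.size) :
    cell P Q (verVertex P Q i j) = (i, j) := by
  simp only [verVertex]
  split_ifs with h1 h2
  · simp [cell, h1]
  · omega
  · rfl

/-- A grid edge is the bottom or left edge of at most one cell, and `start` belongs to cell `(0, 0)`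
on both counts. So a vertex has at most two successors, and they are read off from two indices. -/
lemma veAdj_iff {u v : VEVertex} (hu : Valid P Q u) :
    VEAdj P Q u v ↔ (cell P Q u).1 + 1 < P.size ∧ (cell P Q u).2 + 1 < Q.size ∧
      (v = horVertex P Q (cell P Q u).1 ((cell P Q u).2 + 1) ∨
        v = verVertex P Q ((cell P Q u).1 + 1) (cell P Q u).2) := by
  constructor
  · rintro ⟨i, j, hi, hj, rfl | rfl, hv⟩
    · rw [cell_horVertex P Q hj]; exact ⟨hi, hj, hv⟩
    · rw [cell_verVertex P Q hi]; exact ⟨hi, hj, hv⟩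
  · rintro ⟨hi, hj, hv⟩
    refine ⟨_, _, hi, hj, ?_, hv⟩
    cases u with
    | start => left; simp [cell, horVertex]
    | target => simp only [cell] at hi; omega
    | hor i j =>
      left
      simp only [cell] at hi hj ⊢
      simp only [Valid] at hu
      rw [horVertex, if_neg (by omega), if_neg (by omega)]
    | ver i j =>
      right
      simp only [cell] at hi hj ⊢
      simp only [Valid] at hu
      rw [verVertex, if_neg (by omega), if_neg (by omega)]

lemma valid_of_veAdj {u v : VEVertex} (h : VEAdj P Q u v) : Valid P Q v := by
  obtain ⟨i, j, hi, hj, -, rfl | rfl⟩ := h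
  · rw [horVertex_succ P Q hi hj]; split_ifs with h
    · trivial
    · exact ⟨hi, hj, by omega, h⟩
  · rw [verVertex_succ P Q hi hj]; split_ifs with h
    · trivial
    · exact ⟨hi, hj, by omega, h⟩

/-- An edge moves one cell up or to the right, or to `target`, whose indices are beyond all cells.
This potential shows that the graph is acyclic. -/
lemma cell_lt_of_veAdj {u v : VEVertex} (h : VEAdj P Q u v) :
    (cell P Q u).1 + (cell P Q u).2 < (cell P Q v).1 + (cell P Q v).2 := by
  obtain ⟨i, j, hi, hj, hu, hv⟩ := h
  have h1 : cell P Q u = (i, j) := by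
    rcases hu with rfl | rfl
    · exact cell_horVertex P Q hj
    · exact cell_verVertex P Q hi
  rw [h1]
  rcases hv with rfl | rfl
  · rw [horVertex_succ P Q hi hj]; split_ifs with h <;> simp only [cell] <;> omega
  · rw [verVertex_succ P Q hi hj]; split_ifs with h <;> simp only [cell] <;> omega

lemma veAdj_acyclic (v : VEVertex) : ¬ Relation.TransGen (VEAdj P Q) v v := by
  have : ∀ u v, Relation.TransGen (VEAdj P Q) u v →
      (cell P Q u).1 + (cell P Q u).2 < (cell P Q v).1 + (cell P Q v).2 := by
    intro u v h
    induction h with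
    | single h => exact cell_lt_of_veAdj P Q h
    | tail _ h ih => exact ih.trans (cell_lt_of_veAdj P Q h)
  exact fun h => lt_irrefl _ (this _ _ h)

/-- The path climbs the first column of cells and then follows the top row; `k` counts the cells
still to be entered. -/
lemma reflTransGen_target : Relation.ReflTransGen (VEAdj P Q) .start .target := by
  have hP := P.two_le_size
  have hQ := Q.two_le_size
  have key : ∀ k i j, i + 1 < P.size → j + 1 < Q.size → k + i + j + 4 = P.size + Q.size →
      ∀ u, (u = horVertex P Q i j ∨ u = verVertex P Q i j) →
        Relation.ReflTransGen (VEAdj P Q) u .target := by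
    intro k
    induction k with
    | zero =>
      intro i j hi hj hk u hu
      refine .single ⟨i, j, hi, hj, hu, .inl ?_⟩
      rw [horVertex_succ P Q hi hj, if_pos (by omega)]
    | succ k ih =>
      intro i j hi hj hk u hu
      by_cases h : j + 2 < Q.size
      · exact .head ⟨i, j, hi, hj, hu, .inl rfl⟩ (ih i (j + 1) hi h (by omega) _ (.inl rfl))
      · exact .head ⟨i, j, hi, hj, hu, .inr rfl⟩
          (ih (i + 1) j (by omega) hj (by omega) _ (.inr rfl))
  exact key (P.size + Q.size - 4) 0 0 (by omega) (by omega) (by omega) _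
    (.inl (by simp [horVertex]))

lemma valid_of_reflTransGen {v : VEVertex} (h : Relation.ReflTransGen (VEAdj P Q) .start v) :
    Valid P Q v := by
  rcases Relation.ReflTransGen.cases_tail h with rfl | ⟨u, -, h⟩
  · trivial
  · exact valid_of_veAdj P Q h

lemma code_lt {v : VEVertex} (hv : Valid P Q v) : code P Q v < 2 * (P.size * Q.size) := by
  have hP := P.two_le_size
  have hQ := Q.two_le_size
  have key : ∀ i j, i < P.size → j < Q.size → i * Q.size + j + 1 ≤ P.size * Q.size := by
    intro i j hi hj
    calc i * Q.size + j + 1 ≤ i * Q.size + Q.size := by omega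
      _ = (i + 1) * Q.size := by ring
      _ ≤ _ := Nat.mul_le_mul_right _ hi
  cases v with
  | start => simp only [code]; positivity
  | target => have := key (P.size - 1) (Q.size - 1) (by omega) (by omega); simp only [code]; omega
  | hor i j =>
    simp only [Valid] at hv
    have := key i j (by omega) (by omega); simp only [code]; omega
  | ver i j =>
    simp only [Valid] at hv
    have := key i j (by omega) (by omega); simp only [code]; omega

/-- Parity separates vertical grid edges from the rest, and `i`, `j` are digits to the base
`Q.size`. The even codes of `start` and `target` stay free because a valid `hor i j` has `0 < j` and
`i < P.size - 1`. -/
lemma code_injOn : Set.InjOn (code P Q) {v | Valid P Q v} := by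
  have hP := P.two_le_size
  have hQ := Q.two_le_size
  have key : ∀ i j i' j', j < Q.size → j' < Q.size → i * Q.size + j = i' * Q.size + j' →
      i = i' ∧ j = j' := by
    intro i j i' j' hj hj' h
    have h1 : i = i' := by
      have := congrArg (· / Q.size) h
      simpa [Nat.add_comm _ j, Nat.add_comm _ j', Nat.add_mul_div_right, (by omega : 0 < Q.size),
        Nat.div_eq_of_lt hj, Nat.div_eq_of_lt hj'] using this
    subst h1
    exact ⟨rfl, by omega⟩
  intro u hu v hv h
  simp only [Set.mem_ofPred_eq] at hu hv
  cases u <;> cases v <;> simp only [code, Valid] at h hu hv <;>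
    first
    | rfl
    | omega
    | skip
  case target.hor i j =>
    have := key i j (P.size - 1) (Q.size - 1) (by omega) (by omega) (by omega); omega
  case hor.target i j =>
    have := key i j (P.size - 1) (Q.size - 1) (by omega) (by omega) (by omega); omega
  case hor.hor i j i' j' =>
    obtain ⟨rfl, rfl⟩ := key i j i' j' (by omega) (by omega) (by omega); rfl
  case ver.ver i j i' j' =>
    obtain ⟨rfl, rfl⟩ := key i j i' j' (by omega) (by omega) (by omega); rfl

/-- The vertices that a search up to height `r` can reach. -/
lemma finite_reachable (r : ℝ) :
    {v | ∃ l, IsPath (VEAdj P Q) .start v l ∧ ∀ u ∈ l, height P Q u ≤ r}.Finite := by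
  refine Set.Finite.subset (s := {v | Valid P Q v}) ?_
    fun v ⟨l, hl, _⟩ => valid_of_reflTransGen P Q hl.reflTransGen
  refine Set.Finite.of_finite_image (f := code P Q) ?_ (code_injOn P Q)
  refine (Set.finite_lt_nat (2 * (P.size * Q.size))).subset ?_
  rintro _ ⟨v, hv, rfl⟩
  exact code_lt P Q hv

lemma veDist_eq {l : List VEVertex} (hl : IsPath (VEAdj P Q) .start .target l)
    (hopt : IsLocallyOptimal (VEAdj P Q) (height P Q) l) {r : ℝ}
    (hle : ∀ v ∈ l, height P Q v ≤ r) (hr : ∃ v ∈ l, height P Q v = r) : veDist P Q = r := by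
  refine IsLeast.csInf_eq ⟨⟨l, hl, hle⟩, ?_⟩
  rintro r' ⟨l', hl', hle'⟩
  obtain ⟨v, hv, rfl⟩ := hr
  obtain ⟨y, hy, hvy⟩ := hopt.exists_le (by simp) hl hl' v hv
  exact hvy.trans (hle' y hy)

end VE

/-! ### Notation for expressions and statements -/

instance : Add IExpr := ⟨.op .add⟩
instance : Sub IExpr := ⟨.op .sub⟩
instance : Mul IExpr := ⟨.op .mul⟩
instance : Div IExpr := ⟨.op .div⟩
instance : Add RExpr := ⟨.op .add⟩
instance : Sub RExpr := ⟨.op .sub⟩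
instance : Mul RExpr := ⟨.op .mul⟩
instance : Div RExpr := ⟨.op .div⟩

abbrev iv : ℕ → IExpr := .var
abbrev rv : ℕ → RExpr := .var
abbrev ic : ℕ → IExpr := .const
abbrev rc : ℕ → RExpr := .const

section
variable {W : ℕ} {s : State}

@[simp] lemma IExpr.eval_var (x : ℕ) : (IExpr.var x).eval s = s.ireg x := rfl
@[simp] lemma IExpr.eval_load (a : ℕ) (e : IExpr) : (IExpr.load a e).eval s = s.iarr a (e.eval s) :=
  rfl
@[simp] lemma IExpr.eval_add (e f : IExpr) : (e + f).eval s = e.eval s + f.eval s := rfl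
@[simp] lemma IExpr.eval_sub (e f : IExpr) : (e - f).eval s = e.eval s - f.eval s := rfl
@[simp] lemma IExpr.eval_mul (e f : IExpr) : (e * f).eval s = e.eval s * f.eval s := rfl
@[simp] lemma IExpr.eval_div (e f : IExpr) : (e / f).eval s = e.eval s / f.eval s := rfl
@[simp] lemma IExpr.eval_const (n : ℕ) : (IExpr.const n).eval s = n := rfl
@[simp] lemma IExpr.fits_var (x : ℕ) : (IExpr.var x).Fits W s ↔ x < 40 := Iff.rfl
@[simp] lemma IExpr.fits_load (a : ℕ) (e : IExpr) : (IExpr.load a e).Fits W s ↔ e.Fits W s := Iff.rfl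
@[simp] lemma IExpr.fits_add (e f : IExpr) :
    (e + f).Fits W s ↔ e.Fits W s ∧ f.Fits W s ∧ e.eval s + f.eval s ≤ W := Iff.rfl
@[simp] lemma IExpr.fits_mul (e f : IExpr) :
    (e * f).Fits W s ↔ e.Fits W s ∧ f.Fits W s ∧ e.eval s * f.eval s ≤ W := Iff.rfl
@[simp] lemma IExpr.fits_sub (e f : IExpr) : (e - f).Fits W s ↔ e.Fits W s ∧ f.Fits W s := Iff.rfl
@[simp] lemma IExpr.fits_div (e f : IExpr) : (e / f).Fits W s ↔ e.Fits W s ∧ f.Fits W s := Iff.rfl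
@[simp] lemma IExpr.fits_const (n : ℕ) : (IExpr.const n).Fits W s ↔ n ≤ W := Iff.rfl

@[simp] lemma RExpr.eval_var (x : ℕ) : (RExpr.var x).eval s = s.rreg x := rfl
@[simp] lemma RExpr.eval_load (a : ℕ) (e : IExpr) : (RExpr.load a e).eval s = s.rarr a (e.eval s) :=
  rfl
@[simp] lemma RExpr.eval_sqrt (e : RExpr) : (RExpr.sqrt e).eval s = Real.sqrt (e.eval s) := rfl
@[simp] lemma RExpr.eval_add (e f : RExpr) : (e + f).eval s = e.eval s + f.eval s := rfl
@[simp] lemma RExpr.eval_sub (e f : RExpr) : (e - f).eval s = e.eval s - f.eval s := rfl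
@[simp] lemma RExpr.eval_mul (e f : RExpr) : (e * f).eval s = e.eval s * f.eval s := rfl
@[simp] lemma RExpr.eval_div (e f : RExpr) : (e / f).eval s = e.eval s / f.eval s := rfl
@[simp] lemma RExpr.eval_const (n : ℕ) : (RExpr.const n).eval s = n := rfl
@[simp] lemma RExpr.fits_var (x : ℕ) : (RExpr.var x).Fits W s ↔ x < 40 := Iff.rfl
@[simp] lemma RExpr.fits_load (a : ℕ) (e : IExpr) : (RExpr.load a e).Fits W s ↔ e.Fits W s := Iff.rfl
@[simp] lemma RExpr.fits_sqrt (e : RExpr) : (RExpr.sqrt e).Fits W s ↔ e.Fits W s := Iff.rfl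
@[simp] lemma RExpr.fits_add (e f : RExpr) : (e + f).Fits W s ↔ e.Fits W s ∧ f.Fits W s := Iff.rfl
@[simp] lemma RExpr.fits_mul (e f : RExpr) : (e * f).Fits W s ↔ e.Fits W s ∧ f.Fits W s := Iff.rfl
@[simp] lemma RExpr.fits_sub (e f : RExpr) : (e - f).Fits W s ↔ e.Fits W s ∧ f.Fits W s := Iff.rfl
@[simp] lemma RExpr.fits_div (e f : RExpr) : (e / f).Fits W s ↔ e.Fits W s ∧ f.Fits W s := Iff.rfl
@[simp] lemma RExpr.fits_const (n : ℕ) : (RExpr.const n).Fits W s ↔ True := Iff.rfl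

@[simp] lemma Cond.holds_ilt (e f : IExpr) : (Cond.ilt e f).holds s ↔ e.eval s < f.eval s := Iff.rfl
@[simp] lemma Cond.holds_ieq (e f : IExpr) : (Cond.ieq e f).holds s ↔ e.eval s = f.eval s := Iff.rfl
@[simp] lemma Cond.holds_rlt (e f : RExpr) : (Cond.rlt e f).holds s ↔ e.eval s < f.eval s := Iff.rfl
@[simp] lemma Cond.fits_ilt (e f : IExpr) :
    (Cond.ilt e f).Fits W s ↔ e.Fits W s ∧ f.Fits W s := Iff.rfl
@[simp] lemma Cond.fits_ieq (e f : IExpr) :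
    (Cond.ieq e f).Fits W s ↔ e.Fits W s ∧ f.Fits W s := Iff.rfl
@[simp] lemma Cond.fits_rlt (e f : RExpr) :
    (Cond.rlt e f).Fits W s ↔ e.Fits W s ∧ f.Fits W s := Iff.rfl

lemma Ev.seq_wp {a b : Stmt} {n m : ℕ} {Q : State → Prop} (hn : a.cost + m = n)
    (h : a.wp W (fun s' => Ev W b s' m Q) s) : Ev W (.seq a b) s n Q :=
  hn ▸ Ev.seq (Ev.of_wp a h)

/-- The larger of two reals, computed with a square root. -/
def RExpr.max (e f : RExpr) : RExpr := (e + f + .sqrt ((e - f) * (e - f))) / rc 2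

/-- The smaller of two reals, computed with a square root. -/
def RExpr.min (e f : RExpr) : RExpr := (e + f - .sqrt ((e - f) * (e - f))) / rc 2

@[simp] lemma RExpr.eval_max (e f : RExpr) :
    (RExpr.max e f).eval s = Max.max (e.eval s) (f.eval s) := by
  simp only [RExpr.max, eval_div, eval_add, eval_sqrt, eval_mul, eval_sub, eval_const,
    Real.sqrt_mul_self_eq_abs]
  rcases le_total (e.eval s) (f.eval s) with h | h
  · rw [max_eq_right h, abs_of_nonpos (by linarith)]; push_cast; ring
  · rw [max_eq_left h, abs_of_nonneg (by linarith)]; push_cast; ring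

@[simp] lemma RExpr.eval_min (e f : RExpr) :
    (RExpr.min e f).eval s = Min.min (e.eval s) (f.eval s) := by
  simp only [RExpr.min, eval_div, eval_add, eval_sqrt, eval_mul, eval_sub, eval_const,
    Real.sqrt_mul_self_eq_abs]
  rcases le_total (e.eval s) (f.eval s) with h | h
  · rw [min_eq_left h, abs_of_nonpos (by linarith)]; push_cast; ring
  · rw [min_eq_right h, abs_of_nonneg (by linarith)]; push_cast; ring

@[simp] lemma RExpr.fits_max (e f : RExpr) : (RExpr.max e f).Fits W s ↔ e.Fits W s ∧ f.Fits W s := by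
  simp only [RExpr.max, fits_div, fits_add, fits_sqrt, fits_mul, fits_sub, fits_const]; tauto

@[simp] lemma RExpr.fits_min (e f : RExpr) : (RExpr.min e f).Fits W s ↔ e.Fits W s ∧ f.Fits W s := by
  simp only [RExpr.min, fits_div, fits_add, fits_sqrt, fits_mul, fits_sub, fits_const]; tauto

/-- The sum of the expressions `f 0, …, f (d - 1)`. -/
def RExpr.sum (f : ℕ → RExpr) : ℕ → RExpr
  | 0 => rc 0
  | d + 1 => RExpr.sum f d + f d

@[simp] lemma RExpr.eval_sum (f : ℕ → RExpr) (d : ℕ) :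
    (RExpr.sum f d).eval s = ∑ c ∈ Finset.range d, (f c).eval s := by
  induction d with
  | zero => simp [RExpr.sum]
  | succ d ih => simp [RExpr.sum, ih, Finset.sum_range_succ]

@[simp] lemma RExpr.fits_sum (f : ℕ → RExpr) (d : ℕ) :
    (RExpr.sum f d).Fits W s ↔ ∀ c < d, (f c).Fits W s := by
  induction d with
  | zero => simp [RExpr.sum]
  | succ d ih => simp only [RExpr.sum, RExpr.fits_add, ih, Nat.forall_lt_succ_right]

/-- Consecutive statements. -/
def Stmt.block : List Stmt → Stmt
  | [] => .skip
  | a :: l => .seq a (Stmt.block l)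

end

/-! ### A priority queue

The words in array `5` form the levels of a tournament tree. Node `p` of level `l` has the address
`l * S + p` and stands for the keys `k` with `k / 2 ^ l = p`: it holds `k + 1` for a key `k` of least
height in the queue among these, and `0` if there is none. The heights are in real array `6`. -/

/-- The tournament node for the keys `k` with `k / 2 ^ l = p` is correct for the queue `A`. -/
def IsBest (h : ℕ → ℝ) (A : ℕ → Prop) (l p v : ℕ) : Prop :=
  (v = 0 ∧ ∀ k, A k → k / 2 ^ l ≠ p) ∨
    ∃ k, v = k + 1 ∧ A k ∧ k / 2 ^ l = p ∧ ∀ k', A k' → k' / 2 ^ l = p → h k ≤ h k'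

/-- The winner of two nodes. -/
def pick (h : ℕ → ℝ) (a b : ℕ) : ℕ :=
  if a = 0 then b else if b = 0 then a else if h (b - 1) < h (a - 1) then b else a

/-- The keys below node `p` of level `l + 1` are those below its children `2 * p` and `2 * p + 1` in
level `l`. -/
lemma IsBest.pick {h : ℕ → ℝ} {A : ℕ → Prop} {l p a b : ℕ} (ha : IsBest h A l (2 * p) a)
    (hb : IsBest h A l (2 * p + 1) b) : IsBest h A (l + 1) p (pick h a b) := by
  have hdiv : ∀ k, k / 2 ^ (l + 1) = p ↔ k / 2 ^ l = 2 * p ∨ k / 2 ^ l = 2 * p + 1 := by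
    intro k
    rw [pow_succ, ← Nat.div_div_eq_div_mul]
    omega
  unfold VEFrechet.pick
  rcases ha with ⟨rfl, ha⟩ | ⟨k, rfl, hk, hkp, hmin⟩
  · rw [if_pos rfl]
    rcases hb with ⟨rfl, hb⟩ | ⟨k, rfl, hk, hkp, hmin⟩
    · exact .inl ⟨rfl, fun k hk => by rw [Ne, hdiv]; exact not_or.2 ⟨ha k hk, hb k hk⟩⟩
    · refine .inr ⟨k, rfl, hk, (hdiv k).2 (.inr hkp), fun k' hk' hd => ?_⟩
      exact hmin k' hk' (((hdiv k').1 hd).resolve_left (ha k' hk'))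
  · rw [if_neg (Nat.succ_ne_zero k)]
    rcases hb with ⟨rfl, hb⟩ | ⟨k₂, rfl, hk₂, hkp₂, hmin₂⟩
    · rw [if_pos rfl]
      refine .inr ⟨k, rfl, hk, (hdiv k).2 (.inl hkp), fun k' hk' hd => ?_⟩
      exact hmin k' hk' (((hdiv k').1 hd).resolve_right (hb k' hk'))
    · rw [if_neg (Nat.succ_ne_zero k₂)]
      simp only [Nat.add_sub_cancel]
      split_ifs with hlt
      · refine .inr ⟨k₂, rfl, hk₂, (hdiv k₂).2 (.inr hkp₂), fun k' hk' hd => ?_⟩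
        rcases (hdiv k').1 hd with h1 | h1
        · exact hlt.le.trans (hmin k' hk' h1)
        · exact hmin₂ k' hk' h1
      · refine .inr ⟨k, rfl, hk, (hdiv k).2 (.inl hkp), fun k' hk' hd => ?_⟩
        rcases (hdiv k').1 hd with h1 | h1
        · exact hmin k' hk' h1
        · exact (not_lt.1 hlt).trans (hmin₂ k' hk' h1)

lemma IsBest.congr {h h' : ℕ → ℝ} {A A' : ℕ → Prop} {l p v : ℕ} (hA : ∀ k, k / 2 ^ l = p → (A k ↔ A' k))
    (hh : ∀ k, A k → h k = h' k) (H : IsBest h A l p v) : IsBest h' A' l p v := by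
  rcases H with ⟨rfl, H⟩ | ⟨k, rfl, hk, hkp, hmin⟩
  · exact .inl ⟨rfl, fun k hk hp => H k ((hA k hp).2 hk) hp⟩
  · refine .inr ⟨k, rfl, (hA k hkp).1 hk, hkp, fun k' hk' hp => ?_⟩
    have := (hA k' hp).2 hk'
    rw [← hh k hk, ← hh k' this]
    exact hmin k' this hp

/-- Recompute the parent of the current node: the node is number `ireg 20` in its level, which
starts at address `ireg 21`, and `ireg 22` is the number of keys for which it stands. -/
def treeStep : Stmt := .block [
  .iset 23 (.load 5 (iv 21 + ic 2 * (iv 20 / ic 2))),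
  .iset 24 (.load 5 (iv 21 + (ic 2 * (iv 20 / ic 2) + ic 1))),
  .ite (.ieq (iv 23) (ic 0)) (.iset 23 (iv 24))
    (.ite (.ieq (iv 24) (ic 0)) .skip
      (.ite (.rlt (.load 6 (iv 24 - ic 1)) (.load 6 (iv 23 - ic 1))) (.iset 23 (iv 24)) .skip)),
  .iset 20 (iv 20 / ic 2),
  .iset 21 (iv 21 + iv 4),
  .iset 22 (ic 2 * iv 22),
  .iput 5 (iv 21 + iv 20) (iv 23)]

/-- Set the leaf of key `ireg 11` to `ireg 12`. -/
def treeInit : Stmt := .block [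
  .iset 20 (iv 11), .iset 21 (ic 0), .iset 22 (ic 1), .iput 5 (iv 20) (iv 12)]

/-- Set the leaf of key `ireg 11` to `ireg 12` and recompute its ancestors. -/
def treeUpdate : Stmt := .seq treeInit (.loop (.ilt (iv 22) (iv 3)) treeStep)

/-- The states differ at most in the words of array `5` and in scratch registers. -/
structure TreeFrame (s s' : State) : Prop where
  ireg : ∀ x < 20, s'.ireg x = s.ireg x
  rreg : s'.rreg = s.rreg
  rarr : s'.rarr = s.rarr
  iarr : ∀ a, a ≠ 5 → s'.iarr a = s.iarr a

lemma TreeFrame.refl (s : State) : TreeFrame s s :=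
  ⟨fun _ _ => rfl, rfl, rfl, fun _ _ => rfl⟩

lemma treeFrame_setI {s s' : State} {x v : ℕ} (hx : 20 ≤ x) :
    TreeFrame s (s'.setI x v) ↔ TreeFrame s s' := by
  have e : ∀ y < 20, (s'.setI x v).ireg y = s'.ireg y := fun y hy => by
    simp [show y ≠ x by omega]
  exact ⟨fun h => ⟨fun y hy => (e y hy).symm.trans (h.ireg y hy), h.rreg, h.rarr, h.iarr⟩,
    fun h => ⟨fun y hy => (e y hy).trans (h.ireg y hy), h.rreg, h.rarr, h.iarr⟩⟩

lemma treeFrame_setIArr {s s' : State} {i v : ℕ} :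
    TreeFrame s (s'.setIArr 5 i v) ↔ TreeFrame s s' := by
  have e : ∀ a, a ≠ 5 → (s'.setIArr 5 i v).iarr a = s'.iarr a := fun a ha => by simp [ha]
  exact ⟨fun h => ⟨h.ireg, h.rreg, h.rarr, fun a ha => (e a ha).symm.trans (h.iarr a ha)⟩,
    fun h => ⟨h.ireg, h.rreg, h.rarr, fun a ha => (e a ha).trans (h.iarr a ha)⟩⟩

lemma TreeFrame.trans {s s' s'' : State} (h : TreeFrame s s') (h' : TreeFrame s' s'') :
    TreeFrame s s'' :=
  ⟨fun x hx => (h'.ireg x hx).trans (h.ireg x hx), h'.rreg.trans h.rreg, h'.rarr.trans h.rarr,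
    fun a ha => (h'.iarr a ha).trans (h.iarr a ha)⟩

lemma treeStep_spec {W : ℕ} {s : State} (h1 : s.ireg 21 + s.ireg 20 + 2 ≤ W)
    (h2 : s.ireg 21 + s.ireg 4 + s.ireg 20 ≤ W) (h3 : 2 * s.ireg 22 ≤ W) :
    Ev W treeStep s treeStep.cost fun s' => TreeFrame s s' ∧ s'.ireg 20 = s.ireg 20 / 2 ∧
      s'.ireg 21 = s.ireg 21 + s.ireg 4 ∧ s'.ireg 22 = 2 * s.ireg 22 ∧
      s'.iarr 5 = Function.update (s.iarr 5) (s.ireg 21 + s.ireg 4 + s.ireg 20 / 2)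
        (pick (s.rarr 6) (s.iarr 5 (s.ireg 21 + 2 * (s.ireg 20 / 2)))
          (s.iarr 5 (s.ireg 21 + (2 * (s.ireg 20 / 2) + 1)))) := by
  refine Ev.of_wp _ ?_
  have e1 : 2 * (s.ireg 20 / 2) ≤ s.ireg 20 := Nat.mul_div_le _ _
  simp [treeStep, Stmt.block, Stmt.wp, numVars, treeFrame_setI, treeFrame_setIArr, TreeFrame.refl]
  repeat' first | apply And.intro | intro
  all_goals first
    | omega
    | (congr 1; rw [pick, if_pos ‹_›])
    | (congr 1; rw [pick, if_neg ‹_›, if_pos ‹_›])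
    | (congr 1; rw [pick, if_neg ‹_›, if_neg ‹_›, if_pos ‹_›])
    | (congr 1; rw [pick, if_neg ‹_›, if_neg ‹_›, if_neg (not_lt.2 ‹_›)])

lemma address_inj {S l l' p p' : ℕ} (hp : p < S) (hp' : p' < S) (h : l * S + p = l' * S + p') :
    l = l' ∧ p = p' := by
  have h1 : l = l' := by
    have := congrArg (· / S) h
    simpa [Nat.add_comm _ p, Nat.add_comm _ p', Nat.add_mul_div_right, (by omega : 0 < S),
      Nat.div_eq_of_lt hp, Nat.div_eq_of_lt hp'] using this
  subst h1
  exact ⟨rfl, by omega⟩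

def treeUpdateCost (L : ℕ) : ℕ :=
  treeInit.cost + (L * (treeStep.cost + 5) + 5)

/-- Here `A` is the queue after the change. Only the nodes above leaf `k` may be out of date, so the
same lemma serves insertion (`v = k + 1`) and removal (`v = 0`). The condition `k + 2 < S` keeps the
sibling of every visited node inside its level. The last conclusion keeps the unused levels blank
for a later doubling of the capacity. -/
lemma treeUpdate_spec {W : ℕ} {s : State} {S L k v : ℕ} {A : ℕ → Prop} (hS : s.ireg 4 = S)
    (hL : s.ireg 3 = 2 ^ L) (hk : s.ireg 11 = k) (hv : s.ireg 12 = v) (hkS : k + 2 < S)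
    (hW : (L + 2) * S ≤ W) (hWL : 2 * 2 ^ L ≤ W)
    (hleaf : IsBest (s.rarr 6) A 0 k v)
    (hrest : ∀ l ≤ L, ∀ p < S, p ≠ k / 2 ^ l → IsBest (s.rarr 6) A l p (s.iarr 5 (l * S + p))) :
    Ev W treeUpdate s (treeUpdateCost L) fun s' => TreeFrame s s' ∧
      (∀ l ≤ L, ∀ p < S, IsBest (s.rarr 6) A l p (s'.iarr 5 (l * S + p))) ∧
      ∀ a, (L + 1) * S ≤ a → s'.iarr 5 a = s.iarr 5 a := by
  have hW1 : 1 ≤ W := by have := Nat.one_le_two_pow (n := L); omega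
  have hSW : S ≤ W := by nlinarith
  refine Ev.seq_wp rfl ?_
  simp only [treeInit, Stmt.block, Stmt.wp, IExpr.fits_var, IExpr.fits_const, hW1, Nat.zero_le,
    numVars, Nat.reduceLT, true_and]
  set s0 := (((s.setI 20 ((iv 11).eval s)).setI 21 _).setI 22 _).setIArr 5 _ _ with hs0
  -- After `l` rounds all nodes up to level `l` are correct, and above it all nodes that are not
  -- ancestors of leaf `k`.
  let I : ℕ → State → Prop := fun r s' => ∃ l ≤ L, r = L - l ∧ TreeFrame s s' ∧
    s'.ireg 20 = k / 2 ^ l ∧ s'.ireg 21 = l * S ∧ s'.ireg 22 = 2 ^ l ∧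
    (∀ l' ≤ L, ∀ p < S, (l' ≤ l ∨ p ≠ k / 2 ^ l') →
      IsBest (s.rarr 6) A l' p (s'.iarr 5 (l' * S + p))) ∧
    ∀ a, (L + 1) * S ≤ a → s'.iarr 5 a = s.iarr 5 a
  have h0 : I L s0 := by
    refine ⟨0, Nat.zero_le _, by simp, ⟨fun x hx => ?_, rfl, rfl, fun a ha => ?_⟩, ?_, ?_, ?_, ?_, ?_⟩
    · simp [hs0, show x ≠ 20 by omega, show x ≠ 21 by omega, show x ≠ 22 by omega]
    · simp [hs0, ha]
    · simp [hs0, hk]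
    · simp [hs0]
    · simp [hs0]
    · intro l' hl' p hp hor
      have e : s0.iarr 5 = Function.update (s.iarr 5) k v := by simp [hs0, hk, hv]
      rw [e]
      by_cases hl0 : l' * S + p = k
      · have := address_inj (l' := 0) (p' := k) hp (by omega) (by simpa using hl0)
        obtain ⟨rfl, rfl⟩ := this
        simpa using hleaf
      · rw [Function.update_of_ne hl0]
        refine hrest l' hl' p hp ?_
        rcases hor with h | h
        · obtain rfl : l' = 0 := by omega
          simpa using hl0
        · exact h
    · intro a ha
      have : a ≠ k := by nlinarith
      simp [hs0, hk, this]
  have hloop := Ev.loop (W := W) (c := .ilt (iv 22) (iv 3)) (a := treeStep) (n := treeStep.cost) I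
    (fun r s' _ => by simp) ?_ L h0
  · refine hloop.mono ?_ fun s' hs' => ?_
    · simp only [Cond.cost, IExpr.cost]
      exact le_rfl
    obtain ⟨hn, r, l, hl, rfl, hf, h20, h21, h22, hb, hz⟩ := hs'
    refine ⟨hf, ?_, hz⟩
    have : l = L := by
      simp only [Cond.holds_ilt, IExpr.eval_var, hf.ireg 3 (by norm_num), h22, hL] at hn
      have := Nat.pow_le_pow_iff_right (a := 2) (by norm_num) |>.1 (not_lt.1 hn)
      omega
    subst this
    exact fun l' hl' p hp => hb l' hl' p hp (.inl hl')
  · rintro r s' ⟨l, hl, rfl, hf, h20, h21, h22, hb, hz⟩ hc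
    simp only [Cond.holds_ilt, IExpr.eval_var, hf.ireg 3 (by norm_num), h22, hL] at hc
    have hlL : l < L := (Nat.pow_lt_pow_iff_right (a := 2) (by norm_num)).1 hc
    have h4 : s'.ireg 4 = S := by rw [hf.ireg 4 (by norm_num), hS]
    have hkl : k / 2 ^ l ≤ k := Nat.div_le_self _ _
    have hkl' : k / 2 ^ l / 2 ≤ k / 2 ^ l := Nat.div_le_self _ _
    have hlS : l * S + 3 * S ≤ W := by nlinarith
    have hp2 : 2 ^ l ≤ 2 ^ L := Nat.pow_le_pow_right (by norm_num) hl
    have hdd : k / 2 ^ (l + 1) = k / 2 ^ l / 2 := by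
      rw [pow_succ, ← Nat.div_div_eq_div_mul]
    refine ⟨L - (l + 1), by omega, (treeStep_spec ?_ ?_ ?_).mono le_rfl ?_⟩
    · rw [h21, h20]; omega
    · rw [h21, h20, h4]; omega
    · rw [h22]; omega
    · rintro s'' ⟨hf', e20, e21, e22, e5⟩
      rw [h21, h20, h4] at e5
      refine ⟨l + 1, hlL, rfl, hf.trans hf', ?_, ?_, ?_, ?_, ?_⟩
      · rw [e20, h20, hdd]
      · rw [e21, h21, h4]; ring
      · rw [e22, h22, pow_succ]; ring
      · intro l' hl' p hp hor
        rw [e5]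
        have e : l * S + S + k / 2 ^ l / 2 = (l + 1) * S + k / 2 ^ (l + 1) := by rw [hdd]; ring
        rw [e]
        by_cases heq : l' * S + p = (l + 1) * S + k / 2 ^ (l + 1)
        · obtain ⟨rfl, rfl⟩ := address_inj hp (by omega) heq
          rw [Function.update_self, hf.rarr]
          refine IsBest.pick ?_ ?_
          · rw [hdd]; exact hb l hl _ (by omega) (.inl le_rfl)
          · rw [hdd]; exact hb l hl _ (by omega) (.inl le_rfl)
        · rw [Function.update_of_ne heq]
          refine hb l' hl' p hp ?_
          rcases hor with h | h
          · rcases Nat.lt_or_ge l l' with h' | h'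
            · obtain rfl : l' = l + 1 := by omega
              exact .inr fun hp' => heq (by rw [hp'])
            · exact .inl h'
          · exact .inr h
      · intro a ha
        rw [e5, Function.update_of_ne, hz a ha]
        have : (l + 1) * S + S ≤ (L + 1) * S := by nlinarith
        have : (l + 1) * S = l * S + S := by ring
        omega

/-! ### Geometric expressions

Real arrays `0` and `1` hold the coordinates of the vertices of `P` and `Q`, real arrays `4` and `5`
the arc lengths of the vertices. -/

section Expressions

variable {d W : ℕ} {s : State} {P Q : PolyCurve d} {a a' : ℕ} {e e' : IExpr}

lemma PolyCurve.coord_eq (P : PolyCurve d) (i : ℕ) {c : ℕ} (hc : c < d) :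
    P.coord (i * d + c) = P.vert i ⟨c, hc⟩ := by
  have h0 : 0 < d := by omega
  have h1 : (i * d + c) / d = i := by
    rw [Nat.add_comm, Nat.add_mul_div_right _ _ h0, Nat.div_eq_of_lt hc, Nat.zero_add]
  have h2 : (i * d + c) % d = c := by
    rw [Nat.add_comm, Nat.add_mul_mod_self_right, Nat.mod_eq_of_lt hc]
  rw [PolyCurve.coord, dif_pos h0]
  simp only [h1, h2]

lemma dist_eq_sqrt_sum {x y : EuclideanSpace ℝ (Fin d)} {f g : ℕ → ℝ}
    (hf : ∀ c (hc : c < d), f c = x ⟨c, hc⟩) (hg : ∀ c (hc : c < d), g c = y ⟨c, hc⟩) :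
    Real.sqrt (∑ c ∈ Finset.range d, (f c - g c) * (f c - g c)) = dist x y := by
  rw [EuclideanSpace.dist_eq, Finset.sum_range]
  congr 1
  refine Finset.sum_congr rfl fun c _ => ?_
  rw [hf c c.2, hg c c.2, Real.dist_eq, sq_abs]
  ring

/-- Coordinate `c` of vertex `e` of the curve in array `a`. -/
def coordE (d a : ℕ) (e : IExpr) (c : ℕ) : RExpr := .load a (e * ic d + ic c)

def distE (d : ℕ) (f g : ℕ → RExpr) : RExpr := .sqrt (.sum (fun c => (f c - g c) * (f c - g c)) d)

def edgeLenE (d a : ℕ) (e : IExpr) : RExpr := distE d (coordE d a e) (coordE d a (e + ic 1))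

def edgeDirE (d a : ℕ) (e : IExpr) (c : ℕ) : RExpr :=
  (coordE d a (e + ic 1) c - coordE d a e c) / edgeLenE d a e

def offsetE (d a : ℕ) (e : IExpr) (a' : ℕ) (e' : IExpr) : RExpr :=
  .max (rc 0) (.min (edgeLenE d a e)
    (.sum (fun c => (coordE d a' e' c - coordE d a e c) * edgeDirE d a e c) d))

def portalHeightE (d a : ℕ) (e : IExpr) (a' : ℕ) (e' : IExpr) : RExpr :=
  distE d (fun c => coordE d a e c + rv 4 * edgeDirE d a e c) (coordE d a' e')

lemma eval_coordE (h : s.rarr a = P.coord) {c : ℕ} (hc : c < d) :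
    (coordE d a e c).eval s = P.vert (e.eval s) ⟨c, hc⟩ := by
  simp [coordE, h, P.coord_eq _ hc]

lemma eval_distE {x y : EuclideanSpace ℝ (Fin d)} {f g : ℕ → RExpr}
    (hf : ∀ c (hc : c < d), (f c).eval s = x ⟨c, hc⟩)
    (hg : ∀ c (hc : c < d), (g c).eval s = y ⟨c, hc⟩) : (distE d f g).eval s = dist x y := by
  simp [distE, ← dist_eq_sqrt_sum hf hg]

lemma eval_edgeLenE (h : s.rarr a = P.coord) :
    (edgeLenE d a e).eval s = P.edgeLen (e.eval s) :=
  eval_distE (fun _ hc => eval_coordE h hc) fun _ hc => eval_coordE h hc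

/-- Edges of length zero need no test: division by zero gives zero on the machine, and `edgeDir` is
zero there too. -/
lemma eval_edgeDirE (h : s.rarr a = P.coord) {c : ℕ} (hc : c < d) :
    (edgeDirE d a e c).eval s = P.edgeDir (e.eval s) ⟨c, hc⟩ := by
  simp [edgeDirE, eval_coordE h hc, eval_edgeLenE h, PolyCurve.edgeDir, div_eq_inv_mul]

lemma eval_offsetE (h : s.rarr a = P.coord) (h' : s.rarr a' = Q.coord) :
    (offsetE d a e a' e').eval s = P.offset (e.eval s) (Q.vert (e'.eval s)) := by
  simp only [offsetE, RExpr.eval_max, RExpr.eval_min, RExpr.eval_const, eval_edgeLenE h,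
    RExpr.eval_sum, PolyCurve.offset, Nat.cast_zero, RExpr.eval_mul, RExpr.eval_sub]
  congr 2
  rw [PolyCurve.proj, PiLp.inner_apply, Finset.sum_range]
  refine Finset.sum_congr rfl fun c _ => ?_
  rw [eval_coordE h' c.2, eval_coordE h c.2, eval_edgeDirE h c.2]
  simp [mul_comm]

lemma eval_portalHeightE (h : s.rarr a = P.coord) (h' : s.rarr a' = Q.coord) :
    (portalHeightE d a e a' e').eval s =
      dist (P.vert (e.eval s) + s.rreg 4 • P.edgeDir (e.eval s)) (Q.vert (e'.eval s)) :=
  eval_distE (fun c hc => by simp [eval_coordE h hc, eval_edgeDirE h hc])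
    fun c hc => eval_coordE h' hc

lemma fits_coordE {c : ℕ} (hc : c < d) (he : e.Fits W s) (hW : (e.eval s + 1) * (d + 1) ≤ W) :
    (coordE d a e c).Fits W s := by
  have h1 : e.eval s * d + d ≤ W := by nlinarith
  simp only [coordE, RExpr.fits_load, IExpr.fits_add, IExpr.fits_mul, IExpr.fits_const,
    IExpr.eval_mul, IExpr.eval_const]
  exact ⟨⟨he, by nlinarith, by omega⟩, by omega, by omega⟩

lemma fits_distE {f g : ℕ → RExpr} (hf : ∀ c < d, (f c).Fits W s) (hg : ∀ c < d, (g c).Fits W s) :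
    (distE d f g).Fits W s := by
  simp only [distE, RExpr.fits_sqrt, RExpr.fits_sum, RExpr.fits_mul, RExpr.fits_sub]
  exact fun c hc => ⟨⟨hf c hc, hg c hc⟩, hf c hc, hg c hc⟩

lemma fits_coordE_succ {c : ℕ} (hc : c < d) (he : e.Fits W s)
    (hW : (e.eval s + 2) * (d + 1) ≤ W) : (coordE d a (e + ic 1) c).Fits W s := by
  refine fits_coordE hc ?_ (by simpa [add_assoc] using hW)
  simp only [IExpr.fits_add, IExpr.fits_const, IExpr.eval_const]
  exact ⟨he, by nlinarith, by nlinarith⟩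

lemma fits_edgeLenE (he : e.Fits W s) (hW : (e.eval s + 2) * (d + 1) ≤ W) :
    (edgeLenE d a e).Fits W s :=
  fits_distE (fun _ hc => fits_coordE hc he (by nlinarith)) fun _ hc => fits_coordE_succ hc he hW

lemma fits_edgeDirE {c : ℕ} (hc : c < d) (he : e.Fits W s) (hW : (e.eval s + 2) * (d + 1) ≤ W) :
    (edgeDirE d a e c).Fits W s :=
  ⟨⟨fits_coordE_succ hc he hW, fits_coordE hc he (by nlinarith)⟩, fits_edgeLenE he hW⟩

lemma fits_offsetE (he : e.Fits W s) (hW : (e.eval s + 2) * (d + 1) ≤ W)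
    (he' : e'.Fits W s) (hW' : (e'.eval s + 2) * (d + 1) ≤ W) :
    (offsetE d a e a' e').Fits W s := by
  simp only [offsetE, RExpr.fits_max, RExpr.fits_min, RExpr.fits_const, RExpr.fits_sum,
    RExpr.fits_mul, RExpr.fits_sub, true_and]
  exact ⟨fits_edgeLenE he hW, fun c hc => ⟨⟨fits_coordE hc he' (by nlinarith),
    fits_coordE hc he (by nlinarith)⟩, fits_edgeDirE hc he hW⟩⟩

lemma fits_portalHeightE (he : e.Fits W s) (hW : (e.eval s + 2) * (d + 1) ≤ W)
    (he' : e'.Fits W s) (hW' : (e'.eval s + 2) * (d + 1) ≤ W) :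
    (portalHeightE d a e a' e').Fits W s :=
  fits_distE (fun c hc => ⟨fits_coordE hc he (by nlinarith), (by norm_num : 4 < numVars),
    fits_edgeDirE hc he hW⟩) fun c hc => fits_coordE hc he' (by nlinarith)

end Expressions

/-! ### Locating a vertex -/

/-- The memory holds the curves and the arc lengths of their vertices. -/
structure HasInput {d : ℕ} (P Q : PolyCurve d) (s : State) : Prop where
  n : s.ireg 0 = P.size
  m : s.ireg 1 = Q.size
  stride : s.ireg 4 = 2 * (P.size * Q.size) + 4
  coordP : s.rarr 0 = P.coord
  coordQ : s.rarr 1 = Q.coord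
  arcP : ∀ i < P.size, s.rarr 4 i = P.arc i
  arcQ : ∀ j < Q.size, s.rarr 5 j = Q.arc j

/-- Words are long enough. -/
def LongWords {d : ℕ} (P Q : PolyCurve d) (W : ℕ) : Prop :=
  20 * (d + 1) * (P.size * Q.size) ^ 2 ≤ W

/-- `1` for vertices on vertical grid edges. -/
def bit : VEVertex → ℕ
  | .ver _ _ => 1
  | _ => 0

/-- Registers `8`, `9`, `10` describe the vertex. -/
def Describes {d : ℕ} (P Q : PolyCurve d) (v : VEVertex) (s : State) : Prop :=
  s.ireg 8 = bit v ∧ s.ireg 9 = (cell P Q v).1 ∧ s.ireg 10 = (cell P Q v).2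

/-- Compute the location and the height of the described vertex in real registers `1`, `2`, `3`. -/
def locate (d : ℕ) : Stmt :=
  .ite (.ieq (iv 9 + iv 10 + ic 2) (iv 0 + iv 1))
    (.block [.rset 1 (.load 4 (iv 9)), .rset 2 (.load 5 (iv 10)),
      .rset 3 (distE d (coordE d 0 (iv 9)) (coordE d 1 (iv 10)))])
    (.ite (.ieq (iv 8) (ic 0))
      (.block [.rset 4 (offsetE d 0 (iv 9) 1 (iv 10)), .rset 1 (.load 4 (iv 9) + rv 4),
        .rset 2 (.load 5 (iv 10)), .rset 3 (portalHeightE d 0 (iv 9) 1 (iv 10))])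
      (.block [.rset 4 (offsetE d 1 (iv 10) 0 (iv 9)), .rset 1 (.load 4 (iv 9)),
        .rset 2 (.load 5 (iv 10) + rv 4), .rset 3 (portalHeightE d 1 (iv 10) 0 (iv 9))]))

section Locate

variable {d W : ℕ} {P Q : PolyCurve d} {s : State}

lemma PolyCurve.size_mul_bounds (P Q : PolyCurve d) :
    4 ≤ P.size * Q.size ∧ 2 * P.size ≤ P.size * Q.size ∧ 2 * Q.size ≤ P.size * Q.size := by
  have := P.two_le_size
  have := Q.two_le_size
  exact ⟨by nlinarith, by nlinarith, by nlinarith⟩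

lemma LongWords.bounds (hW : LongWords P Q W) {k : ℕ} (hk : k < P.size ∨ k < Q.size) :
    (k + 2) * (d + 1) ≤ W := by
  obtain ⟨h1, h2, h3⟩ := P.size_mul_bounds Q
  refine le_trans ?_ hW
  have h4 : k + 2 ≤ P.size * Q.size := by omega
  calc (k + 2) * (d + 1) ≤ (P.size * Q.size) * (d + 1) := Nat.mul_le_mul_right _ h4
    _ ≤ _ := by nlinarith [Nat.zero_le (d * (P.size * Q.size) ^ 2)]

lemma LongWords.le (hW : LongWords P Q W) : 20 * (P.size * Q.size) ^ 2 ≤ W :=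
  le_trans (by nlinarith [Nat.zero_le (d * (P.size * Q.size) ^ 2)]) hW

lemma LongWords.le_linear (hW : LongWords P Q W) : 80 * (P.size * Q.size) ≤ W :=
  le_trans (by nlinarith [(P.size_mul_bounds Q).1]) hW.le

lemma cell_lt {v : VEVertex} (hv : Valid P Q v) :
    (cell P Q v).1 < P.size ∧ (cell P Q v).2 < Q.size := by
  have := P.two_le_size
  have := Q.two_le_size
  cases v <;> simp only [cell, Valid] at hv ⊢ <;> omega

lemma locate_spec (hin : HasInput P Q s) (hW : LongWords P Q W) {v : VEVertex}
    (hv : Valid P Q v) (h0 : v ≠ .start) (hd : Describes P Q v s) :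
    Ev W (locate d) s (locate d).cost fun s' => s'.ireg = s.ireg ∧ s'.iarr = s.iarr ∧
      s'.rarr = s.rarr ∧ (s'.rreg 1, s'.rreg 2) = location P Q v ∧ s'.rreg 3 = height P Q v := by
  obtain ⟨hi, hj⟩ := cell_lt hv
  have hWi := hW.bounds (.inl hi)
  have hWj := hW.bounds (.inr hj)
  have hWl := hW.le_linear
  obtain ⟨hB1, hB2, hB3⟩ := P.size_mul_bounds Q
  obtain ⟨h8, h9, h10⟩ := hd
  -- The program recognizes `target` by its index sum. It would mistake `start` for a horizontal
  -- portal, which is why that vertex is excluded and handled by `setup`.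
  have htarget : (cell P Q v).1 + (cell P Q v).2 + 2 = P.size + Q.size ↔ v = .target := by
    cases v <;> simp only [cell, Valid, reduceCtorEq, iff_false, iff_true] at hi hj hv ⊢ <;>
      first | omega | simp at h0
  refine Ev.of_wp _ ?_
  simp only [locate, Stmt.wp, Stmt.block, Cond.fits_ieq, Cond.holds_ieq, IExpr.fits_add,
    IExpr.fits_var, IExpr.fits_const, IExpr.eval_add, IExpr.eval_var, IExpr.eval_const, h8, h9, h10,
    hin.n, hin.m, htarget]
  have f9 : ∀ s' : State, s'.ireg = s.ireg → (iv 9).Fits W s' ∧ ((iv 9).eval s' + 2) * (d + 1) ≤ W :=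
    fun s' h => ⟨by simp, by simpa [h, h9] using hWi⟩
  have f10 : ∀ s' : State, s'.ireg = s.ireg →
      (iv 10).Fits W s' ∧ ((iv 10).eval s' + 2) * (d + 1) ≤ W :=
    fun s' h => ⟨by simp, by simpa [h, h10] using hWj⟩
  refine ⟨by norm_num; omega, fun ht => ?_, fun ht => ⟨by norm_num, fun hb => ?_, fun hb => ?_⟩⟩
  · subst ht
    refine ⟨by norm_num, by simp, by norm_num, by simp, by norm_num, ?_, rfl, rfl, rfl, ?_, ?_⟩
    · exact fits_distE (fun c hc => fits_coordE hc (by simp) (by simp [h9]; nlinarith))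
        fun c hc => fits_coordE hc (by simp) (by simp [h10]; nlinarith)
    · simp only [cell] at h9 h10 hi hj
      simp [location, h9, h10, hin.arcP _ hi, hin.arcQ _ hj]
    · rw [height_target]
      simp only [State.setR_rreg, if_true]
      rw [eval_distE (fun c hc => eval_coordE (P := P) (by simp [hin.coordP]) hc)
        (fun c hc => eval_coordE (P := Q) (by simp [hin.coordQ]) hc)]
      simp [h9, h10, cell]
  · obtain ⟨i, j, rfl⟩ : ∃ i j, v = .hor i j := by
      cases v <;> simp_all [bit]
    simp only [cell, Valid] at h9 h10 hi hj hv
    refine ⟨by norm_num, fits_offsetE (f9 _ rfl).1 (f9 _ rfl).2 (f10 _ rfl).1 (f10 _ rfl).2,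
      by norm_num, by simp, by norm_num, by simp, by norm_num,
      fits_portalHeightE (f9 _ rfl).1 (f9 _ rfl).2 (f10 _ rfl).1 (f10 _ rfl).2,
      rfl, rfl, rfl, ?_, ?_⟩
    · rw [location_hor P Q hv.1 hj]
      simp [eval_offsetE (P := P) (Q := Q) hin.coordP hin.coordQ, h9, h10, hin.arcP _ hi,
        hin.arcQ _ hj]
    · rw [height_hor P Q hv.1 hj]
      simp only [State.setR_rreg, if_true]
      rw [eval_portalHeightE (P := P) (Q := Q) (by simp [hin.coordP]) (by simp [hin.coordQ])]
      simp [eval_offsetE (P := P) (Q := Q) hin.coordP hin.coordQ, h9, h10]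
  · obtain ⟨i, j, rfl⟩ : ∃ i j, v = .ver i j := by
      cases v <;> simp_all [bit]
    simp only [cell, Valid] at h9 h10 hi hj hv
    refine ⟨by norm_num, fits_offsetE (f10 _ rfl).1 (f10 _ rfl).2 (f9 _ rfl).1 (f9 _ rfl).2,
      by norm_num, by simp, by norm_num, by simp, by norm_num,
      fits_portalHeightE (f10 _ rfl).1 (f10 _ rfl).2 (f9 _ rfl).1 (f9 _ rfl).2,
      rfl, rfl, rfl, ?_, ?_⟩
    · rw [location_ver P Q hi hv.2.1]
      simp [eval_offsetE (P := Q) (Q := P) hin.coordQ hin.coordP, h9, h10, hin.arcP _ hi,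
        hin.arcQ _ hj]
    · rw [height_ver P Q hi hv.2.1]
      simp only [State.setR_rreg, if_true]
      rw [eval_portalHeightE (P := Q) (Q := P) (by simp [hin.coordQ]) (by simp [hin.coordP])]
      simp [eval_offsetE (P := Q) (Q := P) hin.coordQ hin.coordP, h9, h10]

end Locate

/-! ### Representation of the search -/

section Layout

variable {d : ℕ}

/-- The memory describes the search tree. -/
structure HasTree (P Q : PolyCurve d) (g : Tree VEVertex) (s : State) : Prop where
  valid : ∀ k < g.c, Valid P Q (g.vx k)
  cells : ∀ k < g.c, s.iarr 1 k = (cell P Q (g.vx k)).1 ∧ s.iarr 2 k = (cell P Q (g.vx k)).2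
  par : ∀ k < g.c, 0 < k → s.iarr 3 k = g.par k
  depth : ∀ k < g.c, s.iarr 4 k + 1 = (g.p k).length
  height : ∀ k < g.c, s.rarr 6 k = height P Q (g.vx k)
  loc : ∀ k < g.c, (s.rarr 7 k, s.rarr 8 k) = location P Q (g.vx k)
  top : ∀ k < g.c, (∀ v ∈ g.p k, VEFrechet.height P Q v ≤ s.rarr 9 k) ∧
    ∃ v ∈ g.p k, VEFrechet.height P Q v = s.rarr 9 k

/-- The memory holds the queue of the discovered vertices outside `D`. -/
structure HasQueue (P Q : PolyCurve d) (g : Tree VEVertex) (D : Finset ℕ) (L : ℕ) (s : State) :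
    Prop where
  count : s.ireg 2 = g.c
  cap : s.ireg 3 = 2 ^ L
  base : s.ireg 14 = L * (2 * (P.size * Q.size) + 4)
  c_le : g.c ≤ 2 ^ L
  le_c : 2 ^ L ≤ 2 * g.c
  tree : ∀ l ≤ L, ∀ p < 2 * (P.size * Q.size) + 4, IsBest (s.rarr 6) (fun k => k < g.c ∧ k ∉ D) l p
    (s.iarr 5 (l * (2 * (P.size * Q.size) + 4) + p))
  fresh : ∀ a, (L + 1) * (2 * (P.size * Q.size) + 4) ≤ a → s.iarr 5 a = 0

/-- Discovered vertices are marked. -/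
def HasMarks (P Q : PolyCurve d) (g : Tree VEVertex) (s : State) : Prop :=
  ∀ v, Valid P Q v → (s.iarr 0 (code P Q v) = 0 ↔ ∀ k < g.c, g.vx k ≠ v)

structure Layout (P Q : PolyCurve d) (g : Tree VEVertex) (D : Finset ℕ) (L : ℕ) (s : State) :
    Prop where
  input : HasInput P Q s
  tree : HasTree P Q g s
  queue : HasQueue P Q g D L s
  marks : HasMarks P Q g s

lemma Layout.congr {P Q : PolyCurve d} {g : Tree VEVertex} {D : Finset ℕ} {L : ℕ} {s s' : State}
    (h : Layout P Q g D L s)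
    (hi : ∀ x, x < 5 ∨ x = 14 → s'.ireg x = s.ireg x) (ha : s'.iarr = s.iarr)
    (hr : s'.rarr = s.rarr) : Layout P Q g D L s' := by
  obtain ⟨⟨a1, a2, a3, a4, a5, a6, a7⟩, ⟨b1, b2, b3, b4, b5, b6, b7⟩,
    ⟨c1, c2, c3, c4, c5, c6, c7⟩, m⟩ := h
  refine ⟨⟨?_, ?_, ?_, ?_, ?_, ?_, ?_⟩, ⟨b1, ?_, ?_, ?_, ?_, ?_, ?_⟩,
    ⟨?_, ?_, ?_, c4, c5, ?_, ?_⟩, ?_⟩ <;> (try simp only [HasMarks]) <;>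
    (try rw [hi _ (by norm_num)]) <;> (try simp only [ha, hr]) <;> assumption

/-- The number of discovered vertices is at most quadratic. -/
lemma Search.count_le {P Q : PolyCurve d} {h : VEVertex → ℝ} {g : Tree VEVertex} {E : Finset ℕ}
    {y : ℕ} (S : Search (VEAdj P Q) h .start g E y) : g.c ≤ 2 * (P.size * Q.size) := by
  have hv : ∀ k < g.c, Valid P Q (g.vx k) := fun k hk =>
    valid_of_reflTransGen P Q (S.isPath k hk).reflTransGen
  have := Finset.card_le_card_of_injOn (s := Finset.range g.c)
    (t := Finset.range (2 * (P.size * Q.size))) (fun k => code P Q (g.vx k))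
    (fun k hk => by simpa using code_lt P Q (hv k (by simpa using hk)))
    (fun i hi j hj hij => by
      simp only [Finset.coe_range, Set.mem_Iio] at hi hj
      exact S.inj i hi j hj (code_injOn P Q (hv i hi) (hv j hj) hij))
  simpa using this

end Layout

/-! ### Discovering a vertex -/

/-- If registers `9`, `10` stand for a grid edge at the top right corner, replace the description
in registers `8`, `9`, `10` by that of the target; file the key of the vertex in register `13`. -/
def prepare : Stmt := .block [
  .ite (.ieq (iv 9 + iv 10 + ic 3) (iv 0 + iv 1))
    (.block [.iset 8 (ic 0), .iset 9 (iv 0 - ic 1), .iset 10 (iv 1 - ic 1)]) .skip,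
  .iset 13 (ic 2 * (iv 9 * iv 1 + iv 10) + iv 8)]

/-- File the described vertex as the next one, with vertex `ireg 5` as its parent. -/
def record : Stmt := .block [
  .iput 0 (iv 13) (ic 1), .iput 1 (iv 2) (iv 9), .iput 2 (iv 2) (iv 10), .iput 3 (iv 2) (iv 5),
  .iput 4 (iv 2) (.load 4 (iv 5) + ic 1),
  .rput 6 (iv 2) (rv 3), .rput 7 (iv 2) (rv 1), .rput 8 (iv 2) (rv 2),
  .rput 9 (iv 2) (.max (.load 9 (iv 5)) (rv 3)),
  .iset 11 (iv 2), .iset 12 (iv 2 + ic 1),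
  .ite (.ieq (iv 2) (iv 3)) (.block [.iset 3 (ic 2 * iv 3), .iset 14 (iv 14 + iv 4)]) .skip,
  .iset 2 (iv 2 + ic 1)]

/-- Discover the vertex on the grid edge that registers `8`, `9`, `10` stand for. -/
def discoverStmt (d : ℕ) : Stmt := .seq prepare
  (.ite (.ieq (.load 0 (iv 13)) (ic 0)) (.seq (locate d) (.seq record treeUpdate)) .skip)

section Discover

variable {d W : ℕ} {P Q : PolyCurve d} {s : State}

lemma prepare_spec (hin : HasInput P Q s) (hW : LongWords P Q W) {i j : ℕ} {v : VEVertex}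
    (hi : i + 1 < P.size) (hj : j + 1 < Q.size)
    (hv : (s.ireg 8 = 0 ∧ s.ireg 9 = i ∧ s.ireg 10 = j + 1 ∧ v = horVertex P Q i (j + 1)) ∨
      (s.ireg 8 = 1 ∧ s.ireg 9 = i + 1 ∧ s.ireg 10 = j ∧ v = verVertex P Q (i + 1) j)) :
    Ev W prepare s prepare.cost fun s' => Describes P Q v s' ∧ s'.ireg 13 = code P Q v ∧
      (∀ x, x < 8 ∨ x = 14 → s'.ireg x = s.ireg x) ∧ s'.iarr = s.iarr ∧ s'.rarr = s.rarr := by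
  have hWl := hW.le_linear
  obtain ⟨hB1, hB2, hB3⟩ := P.size_mul_bounds Q
  refine Ev.of_wp _ ?_
  have hmul : ∀ a b c, a < P.size → b < Q.size → c ≤ 1 → a * Q.size ≤ W ∧ a * Q.size + b ≤ W ∧
      2 * (a * Q.size + b) ≤ W ∧ 2 * (a * Q.size + b) + c ≤ W := by
    intro a b c ha hb hc
    have : a * Q.size + Q.size ≤ P.size * Q.size := by
      calc a * Q.size + Q.size = (a + 1) * Q.size := by ring
        _ ≤ _ := Nat.mul_le_mul_right _ ha
    omega
  have htgt := hmul (P.size - 1) (Q.size - 1) 0 (by omega) (by omega) (by omega)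
  simp only [prepare, Stmt.wp, Stmt.block, Cond.fits_ieq, Cond.holds_ieq, IExpr.fits_add,
    IExpr.fits_var, IExpr.fits_const, IExpr.eval_add, IExpr.eval_var, IExpr.eval_const,
    IExpr.fits_mul, IExpr.eval_mul, IExpr.eval_sub, IExpr.fits_sub, State.setI_ireg, hin.n, hin.m,
    numVars]
  have hother : ∀ x, x < 8 ∨ x = 14 → x ≠ 8 ∧ x ≠ 9 ∧ x ≠ 10 ∧ x ≠ 13 := by omega
  rcases hv with ⟨h8, h9, h10, rfl⟩ | ⟨h8, h9, h10, rfl⟩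
  · have hnt := hmul i (j + 1) 0 (by omega) (by omega) (by omega)
    rw [h8, h9, h10, horVertex_succ P Q hi hj]
    refine ⟨by norm_num; omega, fun ht => ?_, fun ht => ?_⟩
    · rw [if_pos ht]
      norm_num
      repeat' apply And.intro
      all_goals first
        | omega
        | simp [bit, cell, code]
        | (intro x hx; simp [hother x hx])
    · rw [if_neg ht]
      norm_num
      refine ⟨by omega, by simp [Describes, bit, cell, h8, h9, h10], by simp [code], ?_⟩
      intro x hx
      simp [hother x hx]
  · have hnt := hmul (i + 1) j 1 (by omega) (by omega) (by omega)
    rw [h8, h9, h10, verVertex_succ P Q hi hj]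
    refine ⟨by norm_num; omega, fun ht => ?_, fun ht => ?_⟩
    · rw [if_pos ht]
      norm_num
      repeat' apply And.intro
      all_goals first
        | omega
        | simp [bit, cell, code]
        | (intro x hx; simp [hother x hx])
    · rw [if_neg ht]
      norm_num
      refine ⟨by omega, by simp [Describes, bit, cell, h8, h9, h10], by simp [code], ?_⟩
      intro x hx
      simp [hother x hx]

lemma record_spec (h1 : s.ireg 2 + 1 ≤ W) (h2 : s.iarr 4 (s.ireg 5) + 1 ≤ W)
    (h3 : 2 * s.ireg 3 ≤ W) (h4 : s.ireg 14 + s.ireg 4 ≤ W) (h5 : 2 ≤ W) :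
    Ev W record s record.cost fun s' =>
      (s'.iarr 0 = Function.update (s.iarr 0) (s.ireg 13) 1 ∧
        s'.iarr 1 = Function.update (s.iarr 1) (s.ireg 2) (s.ireg 9) ∧
        s'.iarr 2 = Function.update (s.iarr 2) (s.ireg 2) (s.ireg 10) ∧
        s'.iarr 3 = Function.update (s.iarr 3) (s.ireg 2) (s.ireg 5) ∧
        s'.iarr 4 = Function.update (s.iarr 4) (s.ireg 2) (s.iarr 4 (s.ireg 5) + 1) ∧
        s'.iarr 5 = s.iarr 5) ∧
      ((∀ a < 6, s'.rarr a = s.rarr a) ∧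
        s'.rarr 6 = Function.update (s.rarr 6) (s.ireg 2) (s.rreg 3) ∧
        s'.rarr 7 = Function.update (s.rarr 7) (s.ireg 2) (s.rreg 1) ∧
        s'.rarr 8 = Function.update (s.rarr 8) (s.ireg 2) (s.rreg 2) ∧
        s'.rarr 9 = Function.update (s.rarr 9) (s.ireg 2)
          (max (s.rarr 9 (s.ireg 5)) (s.rreg 3))) ∧
      (s'.ireg 2 = s.ireg 2 + 1 ∧ s'.ireg 11 = s.ireg 2 ∧ s'.ireg 12 = s.ireg 2 + 1 ∧
        s'.ireg 3 = (if s.ireg 2 = s.ireg 3 then 2 * s.ireg 3 else s.ireg 3) ∧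
        s'.ireg 14 = (if s.ireg 2 = s.ireg 3 then s.ireg 14 + s.ireg 4 else s.ireg 14) ∧
        ∀ x < 8, x ≠ 2 → x ≠ 3 → s'.ireg x = s.ireg x) := by
  have : 1 ≤ W := by omega
  refine Ev.of_wp _ ?_
  simp [record, Stmt.block, Stmt.wp, numVars, h1, h2, h3, h4, h5, this]
  constructor
  · intro hc
    refine ⟨fun a ha => ?_, ?_⟩
    · simp [show a ≠ 6 by omega, show a ≠ 7 by omega, show a ≠ 8 by omega, show a ≠ 9 by omega]
    · simp only [hc]
      refine ⟨by simp, by simp, fun x hx h2 h3 => ?_⟩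
      simp [h2, h3, show x ≠ 11 by omega, show x ≠ 12 by omega, show x ≠ 14 by omega]
  · intro hc
    refine ⟨fun a ha => ?_, ?_⟩
    · simp [show a ≠ 6 by omega, show a ≠ 7 by omega, show a ≠ 8 by omega, show a ≠ 9 by omega]
    · simp only [hc]
      refine ⟨by simp, by simp, fun x hx h2 _ => ?_⟩
      simp [h2, show x ≠ 11 by omega, show x ≠ 12 by omega]

end Discover

/-! ### Correctness and cost of a discovery -/

section Discover

variable {d W : ℕ} {P Q : PolyCurve d} {s : State}

/-- The capacity of the queue is bounded by the size of the diagram. -/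
lemma queue_bounds (hW : LongWords P Q W) {c L : ℕ} (hc : c ≤ 2 * (P.size * Q.size))
    (hL : 2 ^ L ≤ 2 * c) : (L + 3) * (2 * (P.size * Q.size) + 4) ≤ W ∧ 4 * 2 ^ L ≤ W := by
  have h1 := hW.le
  have h2 := hW.le_linear
  have h3 := (P.size_mul_bounds Q).1
  have h4 : L < 2 ^ L := Nat.lt_two_pow_self
  have h5 : L + 3 ≤ 5 * (P.size * Q.size) := by omega
  have h6 : 2 * (P.size * Q.size) + 4 ≤ 3 * (P.size * Q.size) := by omega
  refine ⟨(Nat.mul_le_mul h5 h6).trans (le_trans ?_ h1), by omega⟩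
  nlinarith

def discoverCost (d Λ : ℕ) : ℕ :=
  prepare.cost + ((Cond.ieq (.load 0 (iv 13)) (ic 0)).cost +
    (((locate d).cost + (record.cost + treeUpdateCost Λ)) + 1))

lemma treeUpdateCost_mono {L Λ : ℕ} (h : L ≤ Λ) : treeUpdateCost L ≤ treeUpdateCost Λ := by
  unfold treeUpdateCost
  have := Nat.mul_le_mul_right (treeStep.cost + 5) h
  omega

lemma hasTree_discover {g : Tree VEVertex} {D : Finset ℕ} {L y : ℕ} {v : VEVertex} {s s' : State}
    (lay : Layout P Q g D L s) (hy : y < g.c) (hv : Valid P Q v)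
    (i1 : s'.iarr 1 = Function.update (s.iarr 1) g.c (cell P Q v).1)
    (i2 : s'.iarr 2 = Function.update (s.iarr 2) g.c (cell P Q v).2)
    (i3 : s'.iarr 3 = Function.update (s.iarr 3) g.c y)
    (i4 : s'.iarr 4 = Function.update (s.iarr 4) g.c (s.iarr 4 y + 1))
    (r6 : s'.rarr 6 = Function.update (s.rarr 6) g.c (height P Q v))
    (r7 : s'.rarr 7 = Function.update (s.rarr 7) g.c (location P Q v).1)
    (r8 : s'.rarr 8 = Function.update (s.rarr 8) g.c (location P Q v).2)
    (r9 : s'.rarr 9 = Function.update (s.rarr 9) g.c (max (s.rarr 9 y) (height P Q v))) :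
    HasTree P Q (Search.discover g y v) s' := by
  have hcases : ∀ k, k < g.c + 1 → (k < g.c ∧ k ≠ g.c) ∨ k = g.c := by omega
  obtain ⟨t1, t2, t3, t4, t5, t6, t7⟩ := lay.tree
  refine ⟨?_, ?_, ?_, ?_, ?_, ?_, ?_⟩ <;> intro k hk <;> rcases hcases k hk with ⟨hlt, hne⟩ | rfl
  · simpa [Search.discover, hne] using t1 k hlt
  · simpa [Search.discover] using hv
  · simpa [Search.discover, hne, i1, i2] using t2 k hlt
  · simp [Search.discover, i1, i2]
  · simpa [Search.discover, hne, i3] using t3 k hlt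
  · simp [Search.discover, i3]
  · simpa [Search.discover, hne, i4] using t4 k hlt
  · simpa [Search.discover, i4] using t4 y hy
  · simpa [Search.discover, hne, r6] using t5 k hlt
  · simp [Search.discover, r6]
  · simpa [Search.discover, hne, r7, r8] using t6 k hlt
  · simp [Search.discover, r7, r8]
  · simpa [Search.discover, hne, r9] using t7 k hlt
  · simp only [Search.discover, Function.update_self, r9, List.mem_append, List.mem_singleton]
    obtain ⟨h1, w, hw, h2⟩ := t7 y hy
    constructor
    · rintro u (hu | rfl)
      · exact (h1 u hu).trans (le_max_left _ _)
      · exact le_max_right _ _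
    · rcases le_total (s.rarr 9 y) (height P Q v) with h | h
      · exact ⟨v, .inr rfl, (max_eq_right h).symm⟩
      · exact ⟨w, .inl hw, by rw [h2, max_eq_left h]⟩

lemma hasMarks_discover {g : Tree VEVertex} {y : ℕ} {v : VEVertex} {s s' : State}
    (hm : HasMarks P Q g s) (hv : Valid P Q v)
    (i0 : s'.iarr 0 = Function.update (s.iarr 0) (code P Q v) 1) :
    HasMarks P Q (Search.discover g y v) s' := by
  intro u hu
  rw [i0]
  by_cases huv : u = v
  · subst huv
    simp only [Function.update_self, one_ne_zero, false_iff, not_forall, not_not]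
    exact ⟨g.c, Nat.lt_succ_self _, by simp [Search.discover]⟩
  · have hne : code P Q u ≠ code P Q v := fun h => huv (code_injOn P Q hu hv h)
    rw [Function.update_of_ne hne, hm u hu]
    constructor
    · intro h k hk
      rcases Nat.lt_succ_iff_lt_or_eq.1 hk with hk | rfl
      · simpa [Search.discover, hk.ne] using h k hk
      · simpa [Search.discover] using fun h : v = u => huv h.symm
    · intro h k hk
      simpa [Search.discover, hk.ne] using h k (Nat.lt_succ_of_lt hk)

/-- Nodes that are not ancestors of the new key are correct without any work, even if the capacity
has just doubled: all keys are then below `2 ^ (L + 1)`, so in the new top level only node `0`, an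
ancestor of the new key, stands for any of them, and the other nodes are rightly blank. -/
lemma queue_rest {g : Tree VEVertex} {D : Finset ℕ} {L L' y : ℕ} {v : VEVertex} {s : State}
    {h : ℕ → ℝ} (hq : HasQueue P Q g D L s) (hL' : L' = if g.c = 2 ^ L then L + 1 else L)
    (hh : ∀ k < g.c, s.rarr 6 k = h k) (l : ℕ) (hl : l ≤ L') (p : ℕ)
    (hp : p < 2 * (P.size * Q.size) + 4) (hne : p ≠ g.c / 2 ^ l) :
    IsBest h (fun k => k < (Search.discover g y v).c ∧ k ∉ D) l p
      (s.iarr 5 (l * (2 * (P.size * Q.size) + 4) + p)) := by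
  by_cases hlL : l ≤ L
  · refine (hq.tree l hlL p hp).congr (fun k hk => ?_) fun k hk => hh k hk.1
    have : k ≠ g.c := by rintro rfl; exact hne hk.symm
    simp only [Search.discover]
    constructor
    · exact fun h => ⟨by omega, h.2⟩
    · exact fun h => ⟨by omega, h.2⟩
  · have hcL : g.c = 2 ^ L := by
      by_contra hc
      rw [if_neg hc] at hL'
      omega
    rw [if_pos hcL] at hL'
    obtain rfl : l = L + 1 := by omega
    refine .inl ⟨hq.fresh _ (Nat.le_add_right _ _), fun k hk hkp => ?_⟩
    have hk : k < g.c + 1 := hk.1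
    have h2 : 2 ^ (L + 1) = 2 * 2 ^ L := by rw [pow_succ]; ring
    have h3 := Nat.one_le_two_pow (n := L)
    rw [Nat.div_eq_of_lt (by omega)] at hkp
    rw [Nat.div_eq_of_lt (by omega)] at hne
    exact hne hkp.symm

/-- The search after a vertex has been looked at. -/
structure Extended (P Q : PolyCurve d) (g : Tree VEVertex) (E : Finset ℕ) (y : ℕ) (v : VEVertex)
    (s : State) (g' : Tree VEVertex) (L' : ℕ) (s' : State) : Prop where
  lay : Layout P Q g' (insert y E) L' s'
  search : Search (VEAdj P Q) (height P Q) .start g' E y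
  le : g.c ≤ g'.c
  le' : g'.c ≤ g.c + 1
  vx : ∀ k < g.c, g'.vx k = g.vx k
  found : ∃ k < g'.c, g'.vx k = v
  ireg : s'.ireg 5 = s.ireg 5 ∧ s'.ireg 6 = s.ireg 6 ∧ s'.ireg 7 = s.ireg 7

lemma new_spec (hW : LongWords P Q W) {g : Tree VEVertex}
    {E : Finset ℕ} {L Λ y : ℕ} {v : VEVertex} (lay : Layout P Q g (insert y E) L s)
    (S : Search (VEAdj P Q) (height P Q) .start g E y) (hyv : VEAdj P Q (g.vx y) v)
    (hnew : ∀ k < g.c, g.vx k ≠ v) (hΛ : 2 * (g.c + 1) ≤ 2 ^ Λ) (h5 : s.ireg 5 = y)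
    (hdes : Describes P Q v s) (h13 : s.ireg 13 = code P Q v) :
    Ev W (.seq (locate d) (.seq record treeUpdate)) s
      ((locate d).cost + (record.cost + treeUpdateCost Λ)) fun s' =>
        ∃ g' L', Extended P Q g E y v s g' L' s' := by
  have hy : y < g.c := S.lt y (Finset.mem_insert_self _ _)
  have hv := valid_of_veAdj P Q hyv
  have hstart : v ≠ .start := by
    rintro rfl
    have := cell_lt_of_veAdj P Q hyv
    simp [cell] at this
  -- The count bound is applied to the enlarged tree; this leaves room for the new key in the arrays
  -- and in the words.
  have S' := S.discover_search hyv hnew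
  have hc' : g.c + 1 ≤ 2 * (P.size * Q.size) := S'.count_le
  have hB := (P.size_mul_bounds Q).1
  obtain ⟨hWL, hWL'⟩ := queue_bounds hW (c := g.c) (by omega) lay.queue.le_c
  have hWl := hW.le_linear
  have hcD : g.c ∉ insert y E := fun h => lt_irrefl _ (S.lt _ h)
  obtain ⟨h8, h9, h10⟩ := hdes
  refine Ev.seq ((locate_spec lay.input hW hv hstart ⟨h8, h9, h10⟩).mono le_rfl ?_)
  rintro s1 ⟨e1, e2, e3, hloc, hht⟩
  have lay1 : Layout P Q g (insert y E) L s1 := lay.congr (fun x _ => by rw [e1]) e2 e3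
  rw [← e1] at h5 h9 h10 h13
  have hin := lay1.input
  have hq := lay1.queue
  have hdep : s1.iarr 4 y + 1 ≤ g.c := by
    rw [lay1.tree.depth y hy]
    have := S.length_path_le y hy
    omega
  refine Ev.seq ((record_spec ?_ ?_ ?_ ?_ (by omega)).mono le_rfl ?_)
  · rw [hq.count]; omega
  · rw [h5]; omega
  · rw [hq.cap]; omega
  · rw [hq.base, hin.stride]; nlinarith
  rintro s2 ⟨⟨i0, i1, i2, i3, i4, i5⟩, ⟨rlow, r6, r7, r8, r9⟩, ⟨w2, w11, w12, w3, w14, wlow⟩⟩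
  rw [hq.count] at i1 i2 i3 i4 r6 r7 r8 r9 w2 w11 w12 w3 w14
  rw [h13] at i0
  rw [h9] at i1
  rw [h10] at i2
  rw [h5] at i3 i4 r9
  have hl1 : s1.rreg 1 = (location P Q v).1 := by rw [← hloc]
  have hl2 : s1.rreg 2 = (location P Q v).2 := by rw [← hloc]
  rw [hht] at r6 r9
  rw [hl1] at r7
  rw [hl2] at r8
  set L' := if g.c = 2 ^ L then L + 1 else L with hL'
  have hpow : 2 ^ (L + 1) = 2 * 2 ^ L := by rw [pow_succ]; ring
  have w3' : s2.ireg 3 = 2 ^ L' := by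
    rw [w3, hq.cap, hL']; split_ifs <;> simp [hpow]
  have w14' : s2.ireg 14 = L' * (2 * (P.size * Q.size) + 4) := by
    rw [w14, hq.base, hq.cap, hin.stride, hL']; split_ifs <;> ring
  have hcL' : g.c + 1 ≤ 2 ^ L' := by
    have := hq.c_le
    have := Nat.one_le_two_pow (n := L)
    rw [hL']; split_ifs <;> omega
  have hL'c : 2 ^ L' ≤ 2 * (g.c + 1) := by
    have := hq.le_c
    rw [hL']; split_ifs <;> omega
  have hLL' : L ≤ L' := by rw [hL']; split_ifs <;> omega
  have hL'Λ : L' ≤ Λ := (Nat.pow_le_pow_iff_right (by norm_num : 1 < 2)).1 (hL'c.trans hΛ)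
  obtain ⟨hWL2, hWL2'⟩ := queue_bounds hW hc' hL'c
  refine (treeUpdate_spec (S := 2 * (P.size * Q.size) + 4) (L := L') (k := g.c) (v := g.c + 1)
    (A := fun k => k < (Search.discover g y v).c ∧ k ∉ insert y E)
    ?_ w3' w11 w12 (by omega) ?_ (by omega) ?_ ?_).mono (treeUpdateCost_mono hL'Λ) ?_
  · rw [wlow 4 (by norm_num) (by norm_num) (by norm_num), hin.stride]
  · nlinarith
  · refine .inr ⟨g.c, rfl, ⟨Nat.lt_succ_self _, hcD⟩, by simp, fun k' _ hk' => ?_⟩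
    have : k' = g.c := by simpa using hk'
    rw [this]
  · intro l hl p hp hne
    rw [i5]
    refine queue_rest hq rfl (fun k hk => ?_) l hl p hp hne
    rw [r6, Function.update_of_ne hk.ne]
  rintro s3 ⟨fr, htree, hfresh⟩
  refine ⟨Search.discover g y v, L', ⟨⟨?_, ?_, ⟨?_, ?_, ?_, hcL', hL'c, ?_, ?_⟩, ?_⟩, S',
    Nat.le_succ _, le_rfl, fun k hk => by simp [Search.discover, hk.ne],
    ⟨g.c, Nat.lt_succ_self _, by simp [Search.discover]⟩, ?_⟩⟩
  · refine ⟨?_, ?_, ?_, ?_, ?_, ?_, ?_⟩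
    · rw [fr.ireg 0 (by norm_num), wlow 0 (by norm_num) (by norm_num) (by norm_num), hin.n]
    · rw [fr.ireg 1 (by norm_num), wlow 1 (by norm_num) (by norm_num) (by norm_num), hin.m]
    · rw [fr.ireg 4 (by norm_num), wlow 4 (by norm_num) (by norm_num) (by norm_num), hin.stride]
    · rw [fr.rarr, rlow 0 (by norm_num), hin.coordP]
    · rw [fr.rarr, rlow 1 (by norm_num), hin.coordQ]
    · rw [fr.rarr, rlow 4 (by norm_num)]; exact hin.arcP
    · rw [fr.rarr, rlow 5 (by norm_num)]; exact hin.arcQ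
  · refine hasTree_discover lay1 hy hv ?_ ?_ ?_ ?_ ?_ ?_ ?_ ?_
    · rw [fr.iarr 1 (by norm_num), i1]
    · rw [fr.iarr 2 (by norm_num), i2]
    · rw [fr.iarr 3 (by norm_num), i3]
    · rw [fr.iarr 4 (by norm_num), i4]
    · rw [fr.rarr, r6]
    · rw [fr.rarr, r7]
    · rw [fr.rarr, r8]
    · rw [fr.rarr, r9]
  · rw [fr.ireg 2 (by norm_num), w2]; rfl
  · rw [fr.ireg 3 (by norm_num), w3']
  · rw [fr.ireg 14 (by norm_num), w14']
  · rw [fr.rarr]; exact htree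
  · intro a ha
    rw [hfresh a ha, i5]
    exact hq.fresh a (le_trans (Nat.mul_le_mul_right _ (by omega)) ha)
  · refine hasMarks_discover lay1.marks hv ?_
    rw [fr.iarr 0 (by norm_num), i0]
  · refine ⟨?_, ?_, ?_⟩
    · rw [fr.ireg 5 (by norm_num), wlow 5 (by norm_num) (by norm_num) (by norm_num), e1]
    · rw [fr.ireg 6 (by norm_num), wlow 6 (by norm_num) (by norm_num) (by norm_num), e1]
    · rw [fr.ireg 7 (by norm_num), wlow 7 (by norm_num) (by norm_num) (by norm_num), e1]

lemma discoverStmt_spec (hW : LongWords P Q W) {g : Tree VEVertex}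
    {E : Finset ℕ} {L Λ y i j : ℕ} {v : VEVertex} (lay : Layout P Q g (insert y E) L s)
    (S : Search (VEAdj P Q) (height P Q) .start g E y) (hyv : VEAdj P Q (g.vx y) v)
    (hΛ : 2 * (g.c + 1) ≤ 2 ^ Λ) (h5 : s.ireg 5 = y)
    (hi : i + 1 < P.size) (hj : j + 1 < Q.size)
    (hv : (s.ireg 8 = 0 ∧ s.ireg 9 = i ∧ s.ireg 10 = j + 1 ∧ v = horVertex P Q i (j + 1)) ∨
      (s.ireg 8 = 1 ∧ s.ireg 9 = i + 1 ∧ s.ireg 10 = j ∧ v = verVertex P Q (i + 1) j)) :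
    Ev W (discoverStmt d) s (discoverCost d Λ) fun s' =>
        ∃ g' L', Extended P Q g E y v s g' L' s' := by
  refine Ev.seq ((prepare_spec lay.input hW hi hj hv).mono le_rfl ?_)
  rintro s1 ⟨hdes, h13, hreg, e2, e3⟩
  have lay1 : Layout P Q g (insert y E) L s1 := lay.congr (fun x hx => hreg x (by omega)) e2 e3
  have hvv := valid_of_veAdj P Q hyv
  have hmark := lay1.marks v hvv
  rw [← h13] at hmark
  refine Ev.ite (by simp) (fun hc => ?_) (fun hc => ?_)
  · refine (new_spec hW lay1 S hyv (hmark.1 (by simpa using hc)) hΛ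
      (by rw [hreg 5 (by norm_num), h5]) hdes h13).mono le_rfl ?_
    rintro s2 ⟨g', L', h⟩
    refine ⟨g', L', { h with ireg := ?_ }⟩
    rw [← hreg 5 (by norm_num), ← hreg 6 (by norm_num), ← hreg 7 (by norm_num)]
    exact h.ireg
  · have hc : ¬ s1.iarr 0 (s1.ireg 13) = 0 := by simpa using hc
    rw [hmark] at hc
    push Not at hc
    refine (Ev.skip ?_).mono (Nat.zero_le _) fun _ h => h
    exact ⟨g, L, lay1, S, le_rfl, Nat.le_succ _, fun _ _ => rfl, hc,
      hreg 5 (by norm_num), hreg 6 (by norm_num), hreg 7 (by norm_num)⟩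

end Discover

/-! ### The main loop -/

/-- The current vertex is vertex number `y`. -/
def IsCurrent {d : ℕ} (P Q : PolyCurve d) (g : Tree VEVertex) (y : ℕ) (s : State) : Prop :=
  s.ireg 5 = y ∧ s.ireg 6 = (cell P Q (g.vx y)).1 ∧ s.ireg 7 = (cell P Q (g.vx y)).2

def describeTop : Stmt := .block [.iset 8 (ic 0), .iset 9 (iv 6), .iset 10 (iv 7 + ic 1)]

def describeRight : Stmt := .block [.iset 8 (ic 1), .iset 9 (iv 6 + ic 1), .iset 10 (iv 7)]

/-- Look at all neighbours of the current vertex. -/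
def expand (d : ℕ) : Stmt := .ite (.ilt (iv 6 + ic 1) (iv 0))
  (.ite (.ilt (iv 7 + ic 1) (iv 1))
    (.seq describeTop (.seq (discoverStmt d) (.seq describeRight (discoverStmt d)))) .skip) .skip

def chooseKey : Stmt := .block [.iset 5 (.load 5 (iv 14) - ic 1), .iset 11 (iv 5), .iset 12 (ic 0)]

def loadCell : Stmt := .block [.iset 6 (.load 1 (iv 5)), .iset 7 (.load 2 (iv 5))]

/-- Proceed to a lowest vertex in the queue, and remove it from there. -/
def popStmt : Stmt := .seq chooseKey (.seq treeUpdate loadCell)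

/-- Process vertices until the target comes up. -/
def searchLoop (d : ℕ) : Stmt :=
  .loop (.ilt (iv 6 + iv 7 + ic 2) (iv 0 + iv 1)) (.seq (expand d) popStmt)

section MainLoop

variable {d W : ℕ} {P Q : PolyCurve d} {s : State}

def expandCost (d Λ : ℕ) : ℕ :=
  (Cond.ilt (iv 6 + ic 1) (iv 0)).cost + (((Cond.ilt (iv 7 + ic 1) (iv 1)).cost +
    ((describeTop.cost + (discoverCost d Λ + (describeRight.cost + discoverCost d Λ))) + 1)) + 1)

/-- Portals on the top and right sides of the diagram have no successors; both tests catch them.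
Otherwise the two outgoing grid edges of the cell are looked at, which adds at most two vertices. -/
lemma expand_spec (hW : LongWords P Q W) {g : Tree VEVertex} {E : Finset ℕ} {L Λ y : ℕ}
    (lay : Layout P Q g (insert y E) L s)
    (S : Search (VEAdj P Q) (height P Q) .start g E y) (hΛ : 2 * (g.c + 2) ≤ 2 ^ Λ)
    (hcur : IsCurrent P Q g y s) :
    Ev W (expand d) s (expandCost d Λ) fun s' => ∃ g' L', Layout P Q g' (insert y E) L' s' ∧
      Search (VEAdj P Q) (height P Q) .start g' E y ∧ g'.c ≤ g.c + 2 ∧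
      (∀ k < g.c, g'.vx k = g.vx k) ∧
      ∀ v, VEAdj P Q (g'.vx y) v → ∃ k < g'.c, g'.vx k = v := by
  have hy : y < g.c := S.lt y (Finset.mem_insert_self _ _)
  have hvy := lay.tree.valid y hy
  obtain ⟨hB1, hB2, hB3⟩ := P.size_mul_bounds Q
  have hWl := hW.le_linear
  obtain ⟨h5, h6, h7⟩ := hcur
  obtain ⟨hc1, hc2⟩ := cell_lt hvy
  have hadj := fun v => veAdj_iff P Q (v := v) hvy
  have hfalse : ¬ ((cell P Q (g.vx y)).1 + 1 < P.size ∧ (cell P Q (g.vx y)).2 + 1 < Q.size) →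
      ∃ g' L', Layout P Q g' (insert y E) L' s ∧
      Search (VEAdj P Q) (height P Q) .start g' E y ∧ g'.c ≤ g.c + 2 ∧
      (∀ k < g.c, g'.vx k = g.vx k) ∧
      ∀ v, VEAdj P Q (g'.vx y) v → ∃ k < g'.c, g'.vx k = v := by
    intro h
    refine ⟨g, L, lay, S, Nat.le_add_right _ _, fun _ _ => rfl, fun v hv => ?_⟩
    obtain ⟨h1, h2, -⟩ := (hadj v).1 hv
    exact absurd ⟨h1, h2⟩ h
  refine Ev.ite (by simp [h6]; omega) (fun hi => ?_)
    (fun hi => (Ev.skip (hfalse fun h => hi ?_)).mono (Nat.zero_le _) fun _ h => h)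
  swap
  · simpa [h6, lay.input.n] using h.1
  refine Ev.ite (by simp [h7]; omega) (fun hj => ?_)
    (fun hj => (Ev.skip (hfalse fun h => hj ?_)).mono (Nat.zero_le _) fun _ h => h)
  swap
  · simpa [h7, lay.input.m] using h.2
  have hi : (cell P Q (g.vx y)).1 + 1 < P.size := by simpa [h6, lay.input.n] using hi
  have hj : (cell P Q (g.vx y)).2 + 1 < Q.size := by simpa [h7, lay.input.m] using hj
  refine Ev.seq_wp rfl ?_
  simp only [describeTop, Stmt.wp, Stmt.block, IExpr.fits_const, IExpr.fits_var, IExpr.fits_add,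
    IExpr.eval_var, IExpr.eval_add, IExpr.eval_const]
  refine ⟨by norm_num, Nat.zero_le _, by norm_num, by norm_num, by norm_num,
    ⟨by norm_num, by omega, by simp [h7]; omega⟩, ?_⟩
  set s1 := State.setI _ 10 _ with hs1
  have lay1 : Layout P Q g (insert y E) L s1 := by
    refine lay.congr (fun x hx => ?_) rfl rfl
    rw [hs1]
    rcases hx with hx | rfl
    · simp [show x ≠ 8 by omega, show x ≠ 9 by omega, show x ≠ 10 by omega]
    · simp
  refine Ev.seq ((discoverStmt_spec (Λ := Λ) hW lay1 S ((hadj _).2 ⟨hi, hj, .inl rfl⟩) (by omega)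
    (by simp [hs1, h5]) hi hj (.inl ⟨by simp [hs1], by simp [hs1, h6], by simp [hs1, h7], rfl⟩)).mono
      le_rfl ?_)
  rintro s2 ⟨g2, L2, X⟩
  obtain ⟨r5, r6, r7⟩ := X.ireg
  have r5 : s2.ireg 5 = y := by rw [r5]; simp [hs1, h5]
  have r6 : s2.ireg 6 = (cell P Q (g.vx y)).1 := by rw [r6]; simp [hs1, h6]
  have r7 : s2.ireg 7 = (cell P Q (g.vx y)).2 := by rw [r7]; simp [hs1, h7]
  refine Ev.seq_wp rfl ?_
  simp only [describeRight, Stmt.wp, Stmt.block, IExpr.fits_const, IExpr.fits_var, IExpr.fits_add,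
    IExpr.eval_var, IExpr.eval_add, IExpr.eval_const]
  refine ⟨by norm_num, by omega, by norm_num, ⟨by norm_num, by omega, by simp [r6]; omega⟩,
    by norm_num, by norm_num, ?_⟩
  set s3 := State.setI _ 10 _ with hs3
  have lay3 : Layout P Q g2 (insert y E) L2 s3 := by
    refine X.lay.congr (fun x hx => ?_) rfl rfl
    rw [hs3]
    rcases hx with hx | rfl
    · simp [show x ≠ 8 by omega, show x ≠ 9 by omega, show x ≠ 10 by omega]
    · simp
  have hvx := X.vx y hy
  have hc2 := X.le'
  refine (discoverStmt_spec (Λ := Λ) hW lay3 X.search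
    (by rw [hvx]; exact (hadj _).2 ⟨hi, hj, .inr rfl⟩) (by omega)
    (by simp [hs3, r5]) hi hj
    (.inr ⟨by simp [hs3], by simp [hs3, r6], by simp [hs3, r7], rfl⟩)).mono le_rfl ?_
  rintro s4 ⟨g4, L4, Y⟩
  have hle := X.le
  have hle' := Y.le
  have hc4 := Y.le'
  have hvx4 : ∀ k < g.c, g4.vx k = g.vx k := fun k hk =>
    (Y.vx k (by omega)).trans (X.vx k hk)
  refine ⟨g4, L4, Y.lay, Y.search, by omega, hvx4, fun v hv => ?_⟩
  rw [hvx4 y hy] at hv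
  obtain ⟨-, -, rfl | rfl⟩ := (hadj _).1 hv
  · obtain ⟨k, hk, hkv⟩ := X.found
    exact ⟨k, by omega, (Y.vx k hk).trans hkv⟩
  · exact Y.found

def popCost (Λ : ℕ) : ℕ := chooseKey.cost + (treeUpdateCost Λ + loadCell.cost)

/-- All keys are below `2 ^ L`, so the root of the tournament stands for the whole frontier; as the
frontier is nonempty, the root names a lowest vertex, as `Search.pop` requires. -/
lemma popStmt_spec (hW : LongWords P Q W) {g : Tree VEVertex} {E : Finset ℕ} {L Λ y : ℕ}
    (lay : Layout P Q g (insert y E) L s)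
    (S : Search (VEAdj P Q) (height P Q) .start g E y) (hΛ : 2 * g.c ≤ 2 ^ Λ)
    (hcl : ∀ v, VEAdj P Q (g.vx y) v → ∃ k < g.c, g.vx k = v)
    (hex : ∃ k < g.c, k ∉ insert y E) :
    Ev W popStmt s (popCost Λ) fun s' => ∃ y', Layout P Q g (insert y' (insert y E)) L s' ∧
      Search (VEAdj P Q) (height P Q) .start g (insert y E) y' ∧ IsCurrent P Q g y' s' := by
  have hq := lay.queue
  have hin := lay.input
  have hB := (P.size_mul_bounds Q).1
  have hWl := hW.le_linear
  have hroot := hq.tree L le_rfl 0 (by omega)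
  have hdiv : ∀ k < g.c, k / 2 ^ L = 0 := fun k hk => Nat.div_eq_of_lt (by have := hq.c_le; omega)
  rw [Nat.add_zero, ← hq.base] at hroot
  obtain ⟨y', hval, ⟨hy', hyD⟩, -, hmin⟩ : ∃ y', s.iarr 5 (s.ireg 14) = y' + 1 ∧
      (y' < g.c ∧ y' ∉ insert y E) ∧ y' / 2 ^ L = 0 ∧
      ∀ k', (k' < g.c ∧ k' ∉ insert y E) → k' / 2 ^ L = 0 → s.rarr 6 y' ≤ s.rarr 6 k' := by
    rcases hroot with ⟨-, h⟩ | h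
    · obtain ⟨k, hk, hkD⟩ := hex
      exact absurd (hdiv k hk) (h k ⟨hk, hkD⟩)
    · exact h
  have hcc := S.count_le
  have hS' := S.pop hcl hy' hyD fun k hk hkD => by
    have := hmin k ⟨hk, hkD⟩ (hdiv k hk)
    rwa [lay.tree.height y' hy', lay.tree.height k hk] at this
  obtain ⟨hWL, hWL'⟩ := queue_bounds hW hcc hq.le_c
  refine Ev.seq_wp rfl ?_
  simp only [chooseKey, Stmt.wp, Stmt.block, IExpr.fits_const, IExpr.fits_var, IExpr.fits_load,
    IExpr.fits_sub, IExpr.eval_load, IExpr.eval_sub, IExpr.eval_var, IExpr.eval_const, hval,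
    Nat.add_sub_cancel]
  refine ⟨by norm_num, ⟨by norm_num, by omega⟩, by norm_num, by norm_num, by norm_num,
    Nat.zero_le _, ?_⟩
  set s1 := State.setI _ 12 0 with hs1
  have low : ∀ x, x < 5 ∨ x = 14 → s1.ireg x = s.ireg x := by
    intro x hx
    rw [hs1]
    rcases hx with hx | rfl
    · simp [show x ≠ 5 by omega, show x ≠ 11 by omega, show x ≠ 12 by omega]
    · simp
  have lay1 : Layout P Q g (insert y E) L s1 := lay.congr low rfl rfl
  have hr1 : s1.rarr = s.rarr := rfl
  have ha1 : s1.iarr = s.iarr := rfl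
  have hLΛ : L ≤ Λ :=
    (Nat.pow_le_pow_iff_right (by norm_num : 1 < 2)).1 (hq.le_c.trans hΛ)
  refine Ev.seq ((treeUpdate_spec (S := 2 * (P.size * Q.size) + 4) (L := L) (k := y') (v := 0)
    (A := fun k => k < g.c ∧ k ∉ insert y' (insert y E))
    lay1.input.stride lay1.queue.cap (by simp [hs1]) (by simp [hs1])
    (by omega) ?_ (by omega) ?_ ?_).mono (treeUpdateCost_mono hLΛ) ?_)
  · nlinarith
  · refine .inl ⟨rfl, fun k hk hk' => hk.2 ?_⟩
    have : k = y' := by simpa using hk'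
    rw [this]; exact Finset.mem_insert_self _ _
  · intro l hl p hp hne
    refine (hq.tree l hl p hp).congr (fun k hk => ?_) fun k _ => rfl
    have : k ≠ y' := by rintro rfl; exact hne hk.symm
    simp [this]
  rintro s2 ⟨fr, htree, hfresh⟩
  refine Ev.of_wp _ ?_
  have e5 : s2.ireg 5 = y' := by rw [fr.ireg 5 (by norm_num)]; simp [hs1]
  have hcell := lay1.tree.cells y' hy'
  simp only [loadCell, Stmt.wp, Stmt.block, IExpr.fits_load, IExpr.fits_var, IExpr.eval_load,
    IExpr.eval_var]
  refine ⟨by norm_num, by norm_num, by norm_num, by norm_num, y', ?_, hS', ?_⟩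
  · have lay2 : Layout P Q g (insert y' (insert y E)) L s2 := by
      obtain ⟨⟨a1, a2, a3, a4, a5, a6, a7⟩, ⟨b1, b2, b3, b4, b5, b6, b7⟩,
        ⟨c1, c2, c3, c4, c5, c6, c7⟩, m⟩ := lay1
      refine ⟨⟨?_, ?_, ?_, ?_, ?_, ?_, ?_⟩, ⟨b1, ?_, ?_, ?_, ?_, ?_, ?_⟩,
        ⟨?_, ?_, ?_, c4, c5, ?_, ?_⟩, ?_⟩
      · rw [fr.ireg 0 (by norm_num), a1]
      · rw [fr.ireg 1 (by norm_num), a2]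
      · rw [fr.ireg 4 (by norm_num), a3]
      · rw [fr.rarr, a4]
      · rw [fr.rarr, a5]
      · rwa [fr.rarr]
      · rwa [fr.rarr]
      · rwa [fr.iarr 1 (by norm_num), fr.iarr 2 (by norm_num)]
      · rwa [fr.iarr 3 (by norm_num)]
      · rwa [fr.iarr 4 (by norm_num)]
      · rwa [fr.rarr]
      · rwa [fr.rarr]
      · rwa [fr.rarr]
      · rw [fr.ireg 2 (by norm_num), c1]
      · rw [fr.ireg 3 (by norm_num), c2]
      · rw [fr.ireg 14 (by norm_num), c3]
      · rw [fr.rarr]; exact htree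
      · exact fun a ha => (hfresh a ha).trans (c7 a ha)
      · unfold HasMarks; rwa [fr.iarr 0 (by norm_num)]
    refine lay2.congr (fun x hx => ?_) rfl rfl
    rcases hx with hx | rfl
    · simp [show x ≠ 6 by omega, show x ≠ 7 by omega]
    · simp
  · rw [← fr.iarr 1 (by norm_num), ← fr.iarr 2 (by norm_num)] at hcell
    exact ⟨by simp [e5], by simp [e5, hcell.1], by simp [e5, hcell.2]⟩

/-! ### The number of rounds -/

/-- The VE-Fréchet distance is attained. -/
lemma veDist_isLeast (P Q : PolyCurve d) :
    ∃ l, IsPath (VEAdj P Q) .start .target l ∧ ∀ v ∈ l, height P Q v ≤ veDist P Q := by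
  set R : Set ℝ := {r | ∃ l, IsPath (VEAdj P Q) .start .target l ∧ ∀ v ∈ l, height P Q v ≤ r}
    with hR
  have hmax : ∀ l : List VEVertex, l ≠ [] → ∃ v ∈ l, ∀ w ∈ l, height P Q w ≤ height P Q v := by
    classical
    intro l hl
    obtain ⟨v, hv, h⟩ := l.toFinset.exists_max_image (height P Q)
      (by simpa [Finset.nonempty_iff_ne_empty] using hl)
    exact ⟨v, by simpa using hv, fun w hw => h w (by simpa using hw)⟩
  have hfin : {v | Valid P Q v}.Finite := by
    refine Set.Finite.of_finite_image (f := code P Q) ?_ (code_injOn P Q)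
    refine (Set.finite_lt_nat (2 * (P.size * Q.size))).subset ?_
    rintro _ ⟨v, hv, rfl⟩
    exact code_lt P Q hv
  -- Every admissible bound can be lowered to the height of a vertex of the path, and only finitely
  -- many such heights exist; hence the infimum is attained.
  have hRH : ∀ r ∈ R, ∃ r' ∈ R ∩ height P Q '' {v | Valid P Q v}, r' ≤ r := by
    rintro r ⟨l, hl, hle⟩
    obtain ⟨v, hv, h⟩ := hmax l hl.ne_nil
    refine ⟨_, ⟨⟨l, hl, h⟩, v, ?_, rfl⟩, hle v hv⟩
    obtain ⟨p, q, rfl⟩ := List.append_of_mem hv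
    have hpre : IsPath (VEAdj P Q) .start v (p ++ [v]) := by
      have : p ++ v :: q = (p ++ [v]) ++ q := by simp
      rw [this] at hl
      refine ⟨(List.isChain_append.1 hl.1).1, ?_, by simp⟩
      have := hl.2.1
      rwa [List.head?_append_of_ne_nil _ (by simp)] at this
    exact valid_of_reflTransGen P Q hpre.reflTransGen
  obtain ⟨l, hl⟩ := exists_isPath_of_reflTransGen (reflTransGen_target P Q)
  obtain ⟨v, -, hv⟩ := hmax l hl.ne_nil
  obtain ⟨r', hr', -⟩ := hRH _ ⟨l, hl, hv⟩
  obtain ⟨r₀, hr₀, hmin⟩ := Set.exists_min_image (R ∩ height P Q '' {v | Valid P Q v}) id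
    ((hfin.image _).subset Set.inter_subset_right) ⟨r', hr'⟩
  have : veDist P Q = r₀ := by
    refine IsLeast.csInf_eq ⟨hr₀.1, fun r hr => ?_⟩
    obtain ⟨r₁, hr₁, hle⟩ := hRH r hr
    exact (hmin r₁ hr₁).trans hle
  rw [this]
  exact hr₀.1

/-- The number of processed vertices is at most the reachable complexity. -/
lemma Search.card_le {g : Tree VEVertex} {E : Finset ℕ} {y : ℕ}
    (S : Search (VEAdj P Q) (height P Q) .start g E y) (ht : ∀ k ∈ E, g.vx k ≠ .target) :
    (insert y E).card ≤ reachableComplexity P Q (veDist P Q) := by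
  classical
  obtain ⟨l, hl, hle⟩ := veDist_isLeast P Q
  have hinj : Set.InjOn g.vx (insert y E : Finset ℕ) := fun i hi j hj hij =>
    S.inj i (S.lt i hi) j (S.lt j hj) hij
  rw [← Finset.card_image_of_injOn hinj, ← Set.ncard_coe_finset, reachableComplexity]
  refine Set.ncard_le_ncard ?_ (finite_reachable P Q _)
  intro v hv
  obtain ⟨k, hk, rfl⟩ := Finset.mem_image.1 (Finset.mem_coe.1 hv)
  -- The tree path itself witnesses that a popped vertex is reachable at this height.
  exact ⟨g.p k, S.isPath k (S.lt k hk), S.height_le ht hl hle hk⟩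

lemma cell_eq_target_iff {v : VEVertex} (hv : Valid P Q v) :
    (cell P Q v).1 + (cell P Q v).2 + 2 < P.size + Q.size ↔ v ≠ .target := by
  have := P.two_le_size
  have := Q.two_le_size
  cases v <;> simp only [cell, Valid, ne_eq, reduceCtorEq, not_false_eq_true, iff_true,
    not_true_eq_false, iff_false] at hv ⊢ <;> omega

def roundCost (d Λ : ℕ) : ℕ := expandCost d Λ + popCost Λ + 13

/-- The counter of the loop is `N` minus the number of processed vertices, which decreases because
`Search.card_le` keeps `E.card + 1 ≤ N`. The bound `g.c ≤ 2 * E.card + 1` reflects that each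
processed vertex contributes at most two new ones. -/
lemma searchLoop_spec (hW : LongWords P Q W) {g : Tree VEVertex} {L Λ y : ℕ}
    (lay : Layout P Q g (insert y ∅) L s)
    (S : Search (VEAdj P Q) (height P Q) .start g ∅ y) (hcur : IsCurrent P Q g y s)
    (hc : g.c ≤ 1) (hΛ : 4 * reachableComplexity P Q (veDist P Q) + 2 ≤ 2 ^ Λ) :
    Ev W (searchLoop d) s
      (reachableComplexity P Q (veDist P Q) * roundCost d Λ + 13)
      fun s' => ∃ g E y L, Layout P Q g (insert y E) L s' ∧
        Search (VEAdj P Q) (height P Q) .start g E y ∧ s'.ireg 5 = y ∧ g.vx y = .target ∧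
        g.c ≤ 2 * reachableComplexity P Q (veDist P Q) := by
  set N := reachableComplexity P Q (veDist P Q) with hN
  have hWl := hW.le_linear
  obtain ⟨hB1, hB2, hB3⟩ := P.size_mul_bounds Q
  let I : ℕ → State → Prop := fun r s => ∃ g E y L, Layout P Q g (insert y E) L s ∧
    Search (VEAdj P Q) (height P Q) .start g E y ∧ IsCurrent P Q g y s ∧
    g.c ≤ 2 * E.card + 1 ∧ (∀ k ∈ E, g.vx k ≠ .target) ∧ r = N - E.card
  have hloop := Ev.loop (W := W) (c := .ilt (iv 6 + iv 7 + ic 2) (iv 0 + iv 1))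
    (a := .seq (expand d) popStmt) (n := expandCost d Λ + popCost Λ) I ?_ ?_ N
    (s := s) ⟨g, ∅, y, L, lay, S, hcur, by simpa using hc, by simp, by simp⟩
  · refine hloop.mono ?_ ?_
    · have : (Cond.ilt (iv 6 + iv 7 + ic 2) (iv 0 + iv 1)).cost = 12 := rfl
      rw [this, roundCost]
    · rintro s' ⟨hn, r, g, E, y, L, lay, S, ⟨h5, h6, h7⟩, hc, ht, -⟩
      have hy := S.lt y (Finset.mem_insert_self _ _)
      refine ⟨g, E, y, L, lay, S, h5, ?_, ?_⟩
      · by_contra hne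
        refine hn ?_
        have := (cell_eq_target_iff (lay.tree.valid y hy)).2 hne
        simpa [h6, h7, lay.input.n, lay.input.m] using this
      · have := S.card_le ht
        rw [Finset.card_insert_of_notMem S.y_notMem] at this
        omega
  · rintro r s ⟨g, E, y, L, lay, S, ⟨h5, h6, h7⟩, hc, ht, rfl⟩
    have := cell_lt (lay.tree.valid y (S.lt y (Finset.mem_insert_self _ _)))
    simp only [Cond.fits_ilt, IExpr.fits_add, IExpr.fits_var, IExpr.fits_const, IExpr.eval_add,
      IExpr.eval_var, IExpr.eval_const, h6, h7, lay.input.n, lay.input.m]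
    norm_num
    omega
  · rintro r s ⟨g, E, y, L, lay, S, hcur, hc, ht, rfl⟩ hcond
    have hy := S.lt y (Finset.mem_insert_self _ _)
    have hcard := S.card_le ht
    rw [Finset.card_insert_of_notMem S.y_notMem] at hcard
    have hyt : g.vx y ≠ .target := by
      refine (cell_eq_target_iff (lay.tree.valid y hy)).1 ?_
      simpa [hcur.2.1, hcur.2.2, lay.input.n, lay.input.m] using hcond
    refine ⟨N - (insert y E).card, by rw [Finset.card_insert_of_notMem S.y_notMem]; omega, ?_⟩
    -- Here `g.c + 2 ≤ 2 * E.card + 3 ≤ 2 * N + 1`; this is the origin of `4 * N + 2` in the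
    -- condition on `Λ`.
    refine Ev.seq ((expand_spec (Λ := Λ) hW lay S (by omega) hcur).mono le_rfl ?_)
    rintro s1 ⟨g1, L1, lay1, S1, hc1, hvx, hcl⟩
    have ht1 : ∀ k ∈ insert y E, g1.vx k ≠ .target := by
      intro k hk
      rw [hvx k (S.lt k hk)]
      rcases Finset.mem_insert.1 hk with rfl | hk
      · exact hyt
      · exact ht k hk
    have hcl1 : ∀ k ∈ insert y E, ∀ v, VEAdj P Q (g1.vx k) v → ∃ j < g1.c, g1.vx j = v := by
      intro k hk
      rcases Finset.mem_insert.1 hk with rfl | hk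
      · exact hcl
      · exact S1.closed k hk
    -- The queue cannot run empty: a path to the unprocessed target crosses the frontier.
    obtain ⟨l, hl⟩ := exists_isPath_of_reflTransGen (reflTransGen_target P Q)
    obtain ⟨j, hj, hjD, -⟩ :=
      Search.exists_frontier g1 (insert y E) hcl1 ht1 ⟨0, S1.zero_mem, S1.root.1⟩ hl
    refine (popStmt_spec (Λ := Λ) hW lay1 S1 (by omega) hcl ⟨j, hj, hjD⟩).mono le_rfl ?_
    rintro s2 ⟨y', lay2, S2, hcur2⟩
    refine ⟨g1, insert y E, y', L1, lay2, S2, hcur2, ?_, ht1, rfl⟩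
    rw [Finset.card_insert_of_notMem S.y_notMem]
    omega

end MainLoop

/-! ### Preparing the input -/

def arcInit : Stmt := .block [.iset 8 (ic 0), .rset 1 (rc 0)]

def arcStep (d a a' : ℕ) : Stmt := .block [.rput a' (iv 8) (rv 1),
  .rset 1 (rv 1 + edgeLenE d a (iv 8)), .iset 8 (iv 8 + ic 1)]

/-- Compute in array `a'` the arc lengths of the `ireg r` vertices of the curve in array `a`. -/
def arcStmt (d a a' r : ℕ) : Stmt := .seq arcInit (.loop (.ilt (iv 8) (iv r)) (arcStep d a a'))

def setup (d : ℕ) : Stmt := .block [.iset 4 (ic 2 * (iv 0 * iv 1) + ic 4), .iset 2 (ic 1),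
  .iset 3 (ic 1), .iput 0 (ic 0) (ic 1), .rset 3 (distE d (coordE d 0 (ic 0)) (coordE d 1 (ic 0))),
  .rput 6 (ic 0) (rv 3), .rput 9 (ic 0) (rv 3)]

section Input

variable {d W : ℕ} {s : State}

lemma arcStmt_spec {R : PolyCurve d} {a a' r : ℕ} (haa : a' ≠ a) (hr : r < 8)
    (ha : s.rarr a = R.coord) (hs : s.ireg r = R.size) (hW : (R.size + 2) * (d + 1) ≤ W) :
    Ev W (arcStmt d a a' r) s (arcInit.cost + (R.size * ((arcStep d a a').cost + 5) + 5)) fun s' =>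
      (∀ i < R.size, s'.rarr a' i = R.arc i) ∧ (∀ b, b ≠ a' → s'.rarr b = s.rarr b) ∧
        s'.iarr = s.iarr ∧ ∀ x, x ≠ 8 → s'.ireg x = s.ireg x := by
  have hWs : R.size + 2 ≤ W := le_trans (Nat.le_mul_of_pos_right _ (Nat.succ_pos d)) hW
  refine Ev.seq_wp rfl ?_
  simp only [arcInit, Stmt.block, Stmt.wp, IExpr.fits_const, RExpr.fits_const, IExpr.eval_const,
    RExpr.eval_const]
  refine ⟨by norm_num, Nat.zero_le _, by norm_num, trivial, ?_⟩
  let I : ℕ → State → Prop := fun k s' => ∃ i ≤ R.size, k = R.size - i ∧ s'.ireg 8 = i ∧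
    s'.rreg 1 = R.arc i ∧ (∀ j < i, s'.rarr a' j = R.arc j) ∧
    (∀ b, b ≠ a' → s'.rarr b = s.rarr b) ∧ s'.iarr = s.iarr ∧ ∀ x, x ≠ 8 → s'.ireg x = s.ireg x
  have hloop := Ev.loop (W := W) (c := .ilt (iv 8) (iv r)) (a := arcStep d a a')
    (n := (arcStep d a a').cost) I (fun _ s' _ => by simp; omega) ?_ R.size
    (s := (s.setI 8 0).setR 1 ((0 : ℕ) : ℝ)) ?_
  · refine hloop.mono le_rfl ?_
    rintro s' ⟨hn, k, i, hi, rfl, h8, h1, hj, hb, hi', hx⟩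
    refine ⟨fun j hj' => hj j ?_, hb, hi', hx⟩
    have : R.size ≤ i := by simpa [h8, hx r (by omega), hs] using hn
    omega
  · rintro k s' ⟨i, hi, rfl, h8, h1, hj, hb, hi', hx⟩ hc
    have hlt : i < R.size := by simpa [h8, hx r (by omega), hs] using hc
    have hWi : (i + 2) * (d + 1) ≤ W := le_trans (Nat.mul_le_mul_right _ (by omega)) hW
    refine ⟨R.size - (i + 1), by omega, Ev.of_wp _ ?_⟩
    simp only [arcStep, Stmt.block, Stmt.wp, IExpr.fits_var, RExpr.fits_var, RExpr.fits_add,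
      IExpr.fits_add, IExpr.fits_const, IExpr.eval_var, IExpr.eval_const, RExpr.eval_var,
      RExpr.eval_add, IExpr.eval_add, h8, h1]
    refine ⟨by norm_num, by norm_num, by norm_num, ⟨by norm_num, fits_edgeLenE (by simp)
      (by simpa [h8] using hWi)⟩, by norm_num, ⟨by norm_num, by omega, by simp [h8]; omega⟩,
      i + 1, hlt, rfl, by simp [h8], ?_, ?_, ?_, ?_, ?_⟩
    · simp only [State.setI_rreg, State.setR_rreg, if_true, State.setRArr_rreg, h1]
      rw [eval_edgeLenE (P := R) (by simp [haa.symm, hb a haa.symm, ha])]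
      simp [h8, R.arc_succ]
    · intro j hji
      rcases Nat.lt_succ_iff_lt_or_eq.1 hji with hji | rfl
      · simp [hji.ne, hj j hji]
      · simp
    · intro b hb'
      simp [hb', hb b hb']
    · simp [hi']
    · intro x hx'
      simp [hx', hx x hx']
  · refine ⟨0, Nat.zero_le _, rfl, by simp, by simp [R.arc_zero], by simp, fun _ _ => rfl, rfl,
      fun x hx => by simp [hx]⟩

/-- The search tree that consists of the start vertex. -/
def startTree : Tree VEVertex where
  c := 1
  vx := fun _ => .start
  par := fun _ => 0
  p := fun _ => [.start]

/-- The start vertex counts as popped at once, so the queue is empty with capacity `2 ^ 0`. Blank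
memory already describes the empty queue and the cell, depth and location of the start vertex; only
its mark and its heights are written. -/
lemma setup_spec {P Q : PolyCurve d} (hW : LongWords P Q W)
    (hn : s.ireg 0 = P.size) (hm : s.ireg 1 = Q.size) (hreg : ∀ x, 2 ≤ x → x ≠ 8 → s.ireg x = 0)
    (hi : ∀ a i, s.iarr a i = 0) (hP : s.rarr 0 = P.coord) (hQ : s.rarr 1 = Q.coord)
    (hX : ∀ i < P.size, s.rarr 4 i = P.arc i) (hY : ∀ j < Q.size, s.rarr 5 j = Q.arc j)
    (hr : ∀ a i, 6 ≤ a → s.rarr a i = 0) :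
    Ev W (setup d) s (setup d).cost fun s' => Layout P Q startTree (insert 0 ∅) 0 s' ∧
      IsCurrent P Q startTree 0 s' := by
  have hWl := hW.le_linear
  have hW0 := hW.bounds (k := 0) (.inl (by have := P.two_le_size; omega))
  obtain ⟨hB1, hB2, hB3⟩ := P.size_mul_bounds Q
  refine Ev.of_wp _ ?_
  simp only [setup, Stmt.block, Stmt.wp, IExpr.fits_var, RExpr.fits_var,
      IExpr.fits_add, IExpr.fits_mul, IExpr.fits_const, IExpr.eval_var, IExpr.eval_const,
      RExpr.eval_var, IExpr.eval_add, IExpr.eval_mul, hn, hm]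
  refine ⟨by norm_num, ⟨⟨by omega, ⟨by norm_num, by norm_num, by omega⟩, by omega⟩, by omega,
    by omega⟩, by norm_num, by omega, by norm_num, by omega, Nat.zero_le _, by omega, by norm_num,
    fits_distE (fun c hc => fits_coordE hc (Nat.zero_le _) (by simp; omega))
      (fun c hc => fits_coordE hc (Nat.zero_le _) (by simp; omega)),
    Nat.zero_le _, by norm_num, Nat.zero_le _, by norm_num, ?_⟩
  rw [eval_distE (fun c hc => eval_coordE (P := P) (by simp [hP]) hc)
        (fun c hc => eval_coordE (P := Q) (by simp [hQ]) hc)]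
  simp only [IExpr.eval_const, ← height_start P Q]
  refine ⟨⟨⟨by simp [hn], by simp [hm], by simp, by simp [hP], by simp [hQ], by simpa using hX,
    by simpa using hY⟩, ⟨?_, ?_, ?_, ?_, ?_, ?_, ?_⟩, ⟨?_, ?_, ?_, ?_, ?_, ?_, ?_⟩, ?_⟩, ?_⟩
  · exact fun k _ => trivial
  · intro k hk
    simp [startTree, cell, hi]
  · exact fun k hk h0 => by simp only [startTree] at hk; omega
  · intro k hk
    simp [startTree, hi]
  · intro k hk
    have : k = 0 := by simp only [startTree] at hk; omega
    simp [startTree, this]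
  · intro k hk
    simp [startTree, location, hr]
  · intro k hk
    have : k = 0 := by simp only [startTree] at hk; omega
    simp [startTree, this]
  · simp [startTree]
  · simp
  · simp [hreg]
  · simp [startTree]
  · simp [startTree]
  · intro l hl p hp
    refine .inl ⟨by simp [hi], fun k hk => ?_⟩
    simp only [startTree] at hk
    have := hk.2
    simp only [Finset.mem_insert, Finset.notMem_empty, or_false] at this
    omega
  · intro a _
    simp [hi]
  · intro v hv
    have h1 : (∀ k < startTree.c, startTree.vx k ≠ v) ↔ VEVertex.start ≠ v := by
      simp [startTree]
    rw [h1]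
    by_cases hvs : VEVertex.start = v
    · subst hvs; simp [code]
    · have hc : code P Q v ≠ 0 := fun h => hvs
        (code_injOn P Q (by trivial : Valid P Q .start) hv (by rw [h]; rfl))
      simp [hvs, hc, hi]
  · simp [IsCurrent, hreg, startTree, cell]

end Input

/-! ### Writing the output -/

def outputInit : Stmt := .block [.rset 0 (.load 9 (iv 5)), .iset 0 (.load 4 (iv 5) + ic 1),
  .iset 8 (iv 0)]

def outputStep : Stmt := .block [.iset 8 (iv 8 - ic 1), .rput 2 (iv 8) (.load 7 (iv 5)),
  .rput 3 (iv 8) (.load 8 (iv 5)), .iset 5 (.load 3 (iv 5))]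

/-- Write the locations of the vertices of the path in the tree to vertex `ireg 5`. -/
def outputStmt : Stmt := .seq outputInit (.loop (.ilt (ic 0) (iv 8)) outputStep)

section Output

variable {d W : ℕ} {P Q : PolyCurve d} {s : State}

/-- Following parents yields the path backwards, so the array is filled from its end; the stored
depth tells where that is. In the invariant `t` is both the next free position plus one and the
length of the tree path to the current vertex, a prefix of the whole path. -/
lemma outputStmt_spec (hW : LongWords P Q W) {g : Tree VEVertex} {E D : Finset ℕ} {L y : ℕ}
    (lay : Layout P Q g D L s)
    (S : Search (VEAdj P Q) (height P Q) .start g E y) (h5 : s.ireg 5 = y) :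
    Ev W outputStmt s (outputInit.cost + (g.c * (outputStep.cost + 4) + 4)) fun s' =>
      s'.rreg 0 = s.rarr 9 y ∧ s'.Outputs ((g.p y).map (location P Q)) := by
  have hy : y < g.c := S.lt y (Finset.mem_insert_self _ _)
  have hdep := lay.tree.depth y hy
  have hlen := S.length_path_le y hy
  have hc := S.count_le
  have hWl := hW.le_linear
  have hB := (P.size_mul_bounds Q).1
  refine Ev.seq_wp rfl ?_
  simp only [outputInit, Stmt.block, Stmt.wp, IExpr.fits_const, RExpr.fits_load, IExpr.eval_const,
    IExpr.fits_var, IExpr.fits_add, IExpr.fits_load, IExpr.eval_add, IExpr.eval_load,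
    IExpr.eval_var, RExpr.eval_load, h5]
  refine ⟨by norm_num, by norm_num, by norm_num, ⟨by norm_num, by omega,
    by simp [h5]; omega⟩, by norm_num, by norm_num, ?_⟩
  set s1 := State.setI _ 8 _ with hs1
  let I : ℕ → State → Prop := fun t s' => s'.ireg 8 = t ∧ s'.ireg 0 = (g.p y).length ∧
    s'.rreg 0 = s.rarr 9 y ∧ s'.iarr = s.iarr ∧ s'.rarr 7 = s.rarr 7 ∧ s'.rarr 8 = s.rarr 8 ∧
    (t = 0 ∨ ∃ k < g.c, s'.ireg 5 = k ∧ (g.p k).length = t ∧ g.p k <+: g.p y) ∧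
    ∀ (i : ℕ) (hi : i < (g.p y).length), t ≤ i →
      (s'.rarr 2 i, s'.rarr 3 i) = location P Q (g.p y)[i]
  have h0 : I (g.p y).length s1 := by
    refine ⟨by simp [hs1, h5, hdep], by simp [hs1, h5, hdep], by simp [hs1], rfl, rfl, rfl,
      .inr ⟨y, hy, by simp [hs1, h5], rfl, List.prefix_rfl⟩, fun i hi hi' => by omega⟩
  have hloop := Ev.loop (W := W) (c := .ilt (ic 0) (iv 8)) (a := outputStep)
    (n := outputStep.cost) I (fun _ s' _ => by simp) ?_ _ h0
  · refine hloop.mono ?_ ?_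
    · have : (Cond.ilt (ic 0) (iv 8)).cost = 3 := rfl
      rw [this]
      have := Nat.mul_le_mul_right (outputStep.cost + 3 + 1) (hlen.trans hy)
      exact Nat.add_le_add_right this _
    · rintro s' ⟨hn, t, h8, hl, hr0, -, -, -, -, hout⟩
      have ht : t = 0 := by simpa [h8] using hn
      subst ht
      refine ⟨hr0, by simpa using hl, fun k hk => ?_⟩
      have hk' : k < (g.p y).length := by simpa using hk
      have := hout k hk' (Nat.zero_le _)
      simp [← this]
  · rintro t s' ⟨h8, hl, hr0, hi, h7, h8', hk, hout⟩ hc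
    have ht : 0 < t := by simpa [h8] using hc
    obtain ⟨k, hk, hk5, hklen, hpre⟩ := hk.resolve_left (by omega)
    refine ⟨t - 1, by omega, Ev.of_wp _ ?_⟩
    simp only [outputStep, Stmt.block, Stmt.wp, IExpr.fits_const, RExpr.fits_load,
      IExpr.eval_const, IExpr.fits_var, IExpr.fits_sub, IExpr.fits_load, IExpr.eval_sub,
      IExpr.eval_load, IExpr.eval_var, RExpr.eval_load, h8]
    refine ⟨by norm_num, ⟨by norm_num, by omega⟩, by norm_num, by norm_num, by norm_num,
      by norm_num, by norm_num, by norm_num, by simp, by simp [hl], by simp [hr0], by simp [hi],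
      by simp [h7], by simp [h8'], ?_, ?_⟩
    -- At the root the counter drops to zero, so its meaningless parent entry is never followed.
    · rcases Nat.eq_zero_or_pos k with rfl | h0
      · rw [S.root.2] at hklen
        left; simp at hklen; omega
      · obtain ⟨p1, p2, p3, p4⟩ := S.parent k hk h0
        refine .inr ⟨g.par k, by omega, ?_, ?_, ?_⟩
        · have := lay.tree.par k hk h0
          simp [hk5, hi, this]
        · rw [p4] at hklen; simp at hklen; omega
        · exact (List.prefix_append (g.p (g.par k)) [g.vx k]).trans (p4 ▸ hpre)
    · intro i hil hti
      rcases Nat.lt_or_ge i t with hit | hit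
      · obtain rfl : i = t - 1 := by omega
        have hlast : (g.p y)[t - 1] = g.vx k := by
          have h1 : t - 1 < (g.p k).length := by omega
          rw [← hpre.getElem h1]
          have h2 := (S.isPath k hk).2.2
          rw [List.getLast?_eq_getElem?, hklen, List.getElem?_eq_getElem h1] at h2
          simpa using h2
        rw [hlast, ← lay.tree.loc k hk]
        simp [hk5, h7, h8']
      · rw [← hout i hil hit]
        have : i ≠ t - 1 := by omega
        simp [this]

end Output

/-! ### The program -/

def mainStmt (d : ℕ) : Stmt := .seq (arcStmt d 0 4 0) (.seq (arcStmt d 1 5 1)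
  (.seq (setup d) (.seq (searchLoop d) outputStmt)))

section Main

variable {d W : ℕ}

/-- `start` and `target` are both reachable. This makes the logarithm of the complexity positive, so
that terms linear in `N` are absorbed by `N log N`. -/
lemma two_le_reachableComplexity (P Q : PolyCurve d) :
    2 ≤ reachableComplexity P Q (veDist P Q) := by
  obtain ⟨l, hl, hle⟩ := veDist_isLeast P Q
  have hs : VEVertex.start ∈ l := List.mem_of_mem_head? hl.2.1
  rw [reachableComplexity, ← Set.ncard_pair (a := VEVertex.start) (b := VEVertex.target) (by simp)]
  refine Set.ncard_le_ncard ?_ (finite_reachable P Q _)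
  rintro v (rfl | rfl)
  · exact ⟨[.start], .single _, by simpa using hle _ hs⟩
  · exact ⟨l, hl, hle⟩

def totalCost (d n m N Λ : ℕ) : ℕ :=
  arcInit.cost + (n * ((arcStep d 0 4).cost + 5) + 5) +
    (arcInit.cost + (m * ((arcStep d 1 5).cost + 5) + 5) +
      ((setup d).cost + (N * roundCost d Λ + 13 +
        (outputInit.cost + (2 * N * (outputStep.cost + 4) + 4)))))

lemma mainStmt_spec (P Q : PolyCurve d) (hW : LongWords P Q W) {Λ : ℕ}
    (hΛ : 4 * reachableComplexity P Q (veDist P Q) + 2 ≤ 2 ^ Λ) :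
    Ev W (mainStmt d) (initState P Q)
      (totalCost d P.size Q.size (reachableComplexity P Q (veDist P Q)) Λ) fun s =>
        ∃ l, s.rreg 0 = veDist P Q ∧ IsRetractableVEPath P Q l ∧
          IsGreatest (elevation P Q '' morphing P Q l) (veDist P Q) ∧
          s.Outputs (l.map (location P Q)) := by
  have hP : (P.size + 2) * (d + 1) ≤ W := by
    have h1 := (P.size_mul_bounds Q).1
    have h2 := (P.size_mul_bounds Q).2.1
    refine le_trans ?_ hW
    calc (P.size + 2) * (d + 1) ≤ (20 * (P.size * Q.size) ^ 2) * (d + 1) :=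
          Nat.mul_le_mul_right _ (by nlinarith)
      _ = _ := by ring
  have hQ : (Q.size + 2) * (d + 1) ≤ W := by
    have h1 := (P.size_mul_bounds Q).1
    have h2 := (P.size_mul_bounds Q).2.2
    refine le_trans ?_ hW
    calc (Q.size + 2) * (d + 1) ≤ (20 * (P.size * Q.size) ^ 2) * (d + 1) :=
          Nat.mul_le_mul_right _ (by nlinarith)
      _ = _ := by ring
  refine Ev.seq ((arcStmt_spec (R := P) (by norm_num) (by norm_num) rfl rfl hP).mono le_rfl ?_)
  rintro s1 ⟨x1, r1, i1, e1⟩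
  refine Ev.seq ((arcStmt_spec (R := Q) (by norm_num) (by norm_num)
    (by rw [r1 1 (by norm_num)]; rfl) (by rw [e1 1 (by norm_num)]; rfl) hQ).mono le_rfl ?_)
  rintro s2 ⟨x2, r2, i2, e2⟩
  have hreg : ∀ x, x ≠ 8 → s2.ireg x = (initState P Q).ireg x := fun x hx =>
    (e2 x hx).trans (e1 x hx)
  refine Ev.seq ((setup_spec (P := P) (Q := Q) hW ?_ ?_ ?_ ?_ ?_ ?_ ?_ x2 ?_).mono le_rfl ?_)
  · rw [hreg 0 (by norm_num)]; rfl
  · rw [hreg 1 (by norm_num)]; rfl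
  · intro x hx hx'
    rw [hreg x hx']
    simp [initState, show x ≠ 0 by omega, show x ≠ 1 by omega]
  · intro a i
    rw [i2, i1]; rfl
  · rw [r2 0 (by norm_num), r1 0 (by norm_num)]; rfl
  · rw [r2 1 (by norm_num), r1 1 (by norm_num)]; rfl
  · rw [r2 4 (by norm_num)]; exact x1
  · intro a i ha
    rw [r2 a (by omega), r1 a (by omega)]
    simp [initState, show a ≠ 0 by omega, show a ≠ 1 by omega]
  rintro s3 ⟨lay, hcur⟩
  have S0 : Search (VEAdj P Q) (height P Q) .start startTree ∅ 0 :=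
    Search.init _ _ _ _ rfl rfl rfl
  refine Ev.seq ((searchLoop_spec hW lay S0 hcur le_rfl hΛ).mono le_rfl ?_)
  rintro s4 ⟨g, E, y, L, lay, S, h5, hyt, hc⟩
  refine (outputStmt_spec hW lay S h5).mono ?_ ?_
  · have := Nat.mul_le_mul_right (outputStep.cost + 4) hc
    omega
  rintro s5 ⟨h0, hout⟩
  have hy : y < g.c := S.lt y (Finset.mem_insert_self _ _)
  have hpath := S.isPath y hy
  rw [hyt] at hpath
  obtain ⟨hle, hex⟩ := lay.tree.top y hy
  have hopt := S.opt y hy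
  have hdist := veDist_eq P Q hpath hopt hle hex
  refine ⟨g.p y, by rw [h0, hdist], ⟨hpath, ?_, hopt⟩, ?_, hout⟩
  · exact hopt.isRetractable (veAdj_acyclic P Q) hpath.1 hpath.ne_nil
  · rw [hdist]
    exact isGreatest_elevation_morphing P Q hpath hle hex

/-! ### Summing up the costs -/

lemma roundCost_eq (d Λ : ℕ) :
    roundCost d Λ = roundCost d 0 + 3 * (treeStep.cost + 5) * Λ := by
  -- The factor three stands for the tree updates of a round: up to two insertions and one removal.
  simp only [roundCost, expandCost, popCost, discoverCost, treeUpdateCost]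
  ring

lemma cost_arith (a b e r u k n m N t : ℕ) (hn : 1 ≤ n) (ht : 1 ≤ t) :
    a * n + b * m + e * N + N * (r + u * (t + 4)) + k ≤
      (a + b + e + r + 5 * u + k) * (n + m + N * t) := by
  have h2 : N ≤ N * t := Nat.le_mul_of_pos_right _ ht
  have h3 : N * (r + u * (t + 4)) ≤ (r + 5 * u) * (N * t) := by
    calc N * (r + u * (t + 4)) = r * N + u * (N * t) + 4 * u * N := by ring
      _ ≤ r * (N * t) + u * (N * t) + 4 * u * (N * t) := by gcongr
      _ = _ := by ring
  have h4 : e * N ≤ e * (N * t) := Nat.mul_le_mul_left _ h2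
  have h5 : k ≤ k * n := Nat.le_mul_of_pos_right _ hn
  have ha : a * n ≤ a * (n + m + N * t) := Nat.mul_le_mul_left _ (by omega)
  have hb : b * m ≤ b * (n + m + N * t) := Nat.mul_le_mul_left _ (by omega)
  have he : e * (N * t) ≤ e * (n + m + N * t) := Nat.mul_le_mul_left _ (by omega)
  have hr : (r + 5 * u) * (N * t) ≤ (r + 5 * u) * (n + m + N * t) :=
    Nat.mul_le_mul_left _ (by omega)
  have hk : k * n ≤ k * (n + m + N * t) := Nat.mul_le_mul_left _ (by omega)
  calc _ ≤ a * (n + m + N * t) + b * (n + m + N * t) + e * (n + m + N * t) +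
        (r + 5 * u) * (n + m + N * t) + k * (n + m + N * t) := by linarith
    _ = _ := by ring

lemma totalCost_le (d : ℕ) : ∃ K : ℕ, ∀ n m N : ℕ, 2 ≤ n → 2 ≤ N →
    totalCost d n m N (Nat.log 2 N + 4) ≤ K * (n + m + N * Nat.log 2 N) := by
  refine ⟨_, fun n m N hn hN => le_trans (le_of_eq ?_)
    (cost_arith ((arcStep d 0 4).cost + 5) ((arcStep d 1 5).cost + 5)
      (2 * (outputStep.cost + 4)) (roundCost d 0) (3 * (treeStep.cost + 5))
      (arcInit.cost + 5 + (arcInit.cost + 5) + (setup d).cost + 13 + outputInit.cost + 4)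
      n m N (Nat.log 2 N) (by omega) (Nat.log_pos (by norm_num) hN))⟩
  rw [totalCost, roundCost_eq d (Nat.log 2 N + 4)]
  generalize (arcStep d 0 4).cost = a, (arcStep d 1 5).cost = b, outputStep.cost = e,
    roundCost d 0 = r, treeStep.cost = u, arcInit.cost = k, (setup d).cost = k',
    outputInit.cost = k'', Nat.log 2 N = t
  ring

lemma natLog_le_log {N : ℕ} (hN : 2 ≤ N) : (Nat.log 2 N : ℝ) ≤ 2 * Real.log N := by
  have h1 : ((2 : ℕ) ^ Nat.log 2 N : ℕ) ≤ N := Nat.pow_log_le_self 2 (by omega)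
  have h2 : (2 : ℝ) ^ Nat.log 2 N ≤ N := by exact_mod_cast h1
  have h3 := Real.log_le_log (by positivity) h2
  rw [Real.log_pow] at h3
  have h4 : (Nat.log 2 N : ℝ) * (1 / 2) ≤ Nat.log 2 N * Real.log 2 :=
    mul_le_mul_of_nonneg_left (by linarith [Real.log_two_gt_d9]) (Nat.cast_nonneg _)
  linarith

/-- With `w = P.size + Q.size ≥ 4` the exponent splits as `3 + d + 4`: `20 ≤ w ^ 3`, `d + 1 ≤ 2 ^ d
≤ w ^ d`, and the product of the sizes is at most `w ^ 2`. -/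
lemma longWords_pow (P Q : PolyCurve d) : LongWords P Q ((P.size + Q.size) ^ (d + 7)) := by
  have hp := P.two_le_size
  have hq := Q.two_le_size
  set w := P.size + Q.size with hw
  have hw4 : 4 ≤ w := by omega
  have h1 : 20 ≤ w ^ 3 := le_trans (by norm_num) (Nat.pow_le_pow_left hw4 3)
  have h2 : d + 1 ≤ w ^ d :=
    le_trans (Nat.lt_two_pow_self (n := d)) (Nat.pow_le_pow_left (by omega) d)
  have h3 : (P.size * Q.size) ^ 2 ≤ w ^ 4 := by
    have : P.size * Q.size ≤ w ^ 2 := by rw [hw]; nlinarith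
    calc _ ≤ (w ^ 2) ^ 2 := Nat.pow_le_pow_left this 2
      _ = w ^ 4 := by ring
  calc 20 * (d + 1) * (P.size * Q.size) ^ 2 ≤ w ^ 3 * w ^ d * w ^ 4 := by gcongr
    _ = w ^ (d + 7) := by ring

end Main

end VEFrechet

end

/-- For every dimension `d` there is one real RAM program (with words of `O(log (n + m))` bits) that,
on any two polygonal curves `P`, `Q` in `ℝ^d` with `n` and `m` vertices, halts after
`O(n + m + N log N)` steps with the VE-Fréchet distance in real register `0` and with the sequence
of the locations of the vertices of a retractable VE-Fréchet morphing, which realizes that distance,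
as its output. -/
theorem mainTheorem5 (d : ℕ) :
    ∃ (prog : VEFrechet.Prog) (κ C : ℕ), ∀ P Q : VEFrechet.PolyCurve d,
      ∃ (T : ℕ) (σ : VEFrechet.State) (l : List VEFrechet.VEVertex),
        VEFrechet.Runs ((P.size + Q.size) ^ κ) prog (VEFrechet.initState P Q) T σ ∧
        (T : ℝ) ≤ C * ((P.size : ℝ) + Q.size +
          (VEFrechet.reachableComplexity P Q (VEFrechet.veDist P Q) : ℝ) *
            Real.log (VEFrechet.reachableComplexity P Q (VEFrechet.veDist P Q))) ∧
        σ.rreg 0 = VEFrechet.veDist P Q ∧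
        VEFrechet.IsRetractableVEPath P Q l ∧
        IsGreatest (VEFrechet.elevation P Q '' VEFrechet.morphing P Q l)
          (VEFrechet.veDist P Q) ∧
        σ.Outputs (l.map (VEFrechet.location P Q)) := by
  obtain ⟨K, hK⟩ := VEFrechet.totalCost_le d
  -- The factor two pays for the passage from the binary to the natural logarithm.
  refine ⟨(VEFrechet.mainStmt d).compile, d + 7, 2 * K, fun P Q => ?_⟩
  have hN := VEFrechet.two_le_reachableComplexity P Q
  have hW := VEFrechet.longWords_pow P Q
  set N := VEFrechet.reachableComplexity P Q (VEFrechet.veDist P Q) with hNdef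
  have hΛ : 4 * N + 2 ≤ 2 ^ (Nat.log 2 N + 4) := by
    have h1 : N < 2 ^ (Nat.log 2 N + 1) := Nat.lt_pow_succ_log_self (by norm_num) N
    have h2 : 2 ^ (Nat.log 2 N + 4) = 8 * 2 ^ (Nat.log 2 N + 1) := by ring
    omega
  have hwords : (VEFrechet.initState P Q).WordsLE ((P.size + Q.size) ^ (d + 7)) := by
    have h1 : P.size + Q.size ≤ (P.size + Q.size) ^ (d + 7) := Nat.le_self_pow (by omega) _
    refine ⟨fun x => ?_, fun _ _ => Nat.zero_le _⟩
    simp only [VEFrechet.initState]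
    split_ifs <;> omega
  obtain ⟨T, σ, s, hrun, hT, -, hag, l, h0, hret, hgr, hlen, hout⟩ :=
    VEFrechet.mainStmt_spec P Q hW hΛ (VEFrechet.initState P Q)
      ⟨fun _ _ => rfl, fun _ _ => rfl, rfl, rfl⟩ hwords
  refine ⟨T, σ, l, hrun, ?_, by rw [hag.2.1 0 (by norm_num), h0], hret, hgr,
    by rw [hag.1 0 (by norm_num), hlen], fun k hk => ?_⟩
  · have h1 : (T : ℝ) ≤ K * (P.size + Q.size + N * Nat.log 2 N) := by
      exact_mod_cast hT.trans (hK _ _ _ P.two_le_size hN)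
    have h2 : (N : ℝ) * Nat.log 2 N ≤ N * (2 * Real.log N) :=
      mul_le_mul_of_nonneg_left (VEFrechet.natLog_le_log hN) (Nat.cast_nonneg _)
    have h3 : (0 : ℝ) ≤ P.size := Nat.cast_nonneg _
    have h4 : (0 : ℝ) ≤ Q.size := Nat.cast_nonneg _
    push_cast
    calc (T : ℝ) ≤ K * (P.size + Q.size + N * Nat.log 2 N) := h1
      _ ≤ K * (2 * (P.size + Q.size + N * Real.log N)) :=
          mul_le_mul_of_nonneg_left (by linarith) (Nat.cast_nonneg _)
      _ = _ := by ring
  · rw [hag.2.2.2]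
    exact hout k hk
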